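/- Let $G=(V,E)$ be a connected simple graph on $n$ nodes. Every edge $\{u,v\}$ has positive integral costs $w(u,v)$ and $w(v,u)$ for traversing it from $u$ to $v$ and from $v$ to $u$, and every node $v$ has a demand $b_v\in\mathbb{Z}$, with $\sum_v b_v=0$. Orient each edge in its more expensive direction (breaking ties by node identifiers). Let $A\in\mathbb{R}^{V\times E}$ be the node-arc incidence matrix (the column of the arc $(u,v)$ has $-1$ at $u$ and $+1$ at $v$), let $w^+\ge w^-$ be the vectors of forward and backward costs, $W_\pm=\mathrm{diag}(w^\pm)$, $W_*=[W_+\;-W_-]^T$, $R_*=[W_+^{-1}\;-W_-^{-1}]^T$, $p(z)=\sum_i\max\{0,z_i\}$, $q(z)=\max\{0,\max_i z_i\}$, and $\lambda=\max_{e\in E} w^+_e/w^-_e\ge 1$ ($\lambda=1$ if $E=\emptyset$). The asymmetric shortest transshipment problem is the primal-dual pair $$\min\{p(W_*x): Ax=b\}=\max\{b^Ty: q(R_*A^Ty)\le 1\}.$$ In the broadcast congest model, the nodes have unique $O(\log n)$-bit identifiers, and initially each node knows its identifier, its demand, $\epsilon$, the identifiers of its neighbors, and both costs of each incident edge. In each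 synchronous round, every node may perform arbitrary local computations and broadcasts one $O(\log n)$-bit message, which is received exactly by its neighbors in $G$. Identifiers, costs and the absolute values of demands are assumed to be at most $n^c$ for a fixed constant $c$. For every $c$ there is a deterministic algorithm in this model that, for every such instance and every $0<\epsilon\le 1$, computes a $(1+\epsilon)$-approximation of the asymmetric shortest transshipment problem in $\tilde O(\lambda^4\epsilon^{-3}n)$ rounds, that is, in at most $C\,\lambda^4\epsilon^{-3}\,n\,(\lfloor\log_2 n\rfloor+1)^{k}$ rounds, where $C$ and $k$ (and the constant in the message size) depend only on $c$. In particular, if $\lambda=O(\mathrm{polylog}\,n)$, for instance for symmetric costs, this is $\tilde O(\epsilon^{-3}n)$ rounds. Here, a $(1+\epsilon)$-approximation is computed if every node $v$ has decided on a value $z_v$ with $\mathrm{OPT}\le z_v\le(1+\epsilon)\,\mathrm{OPT}$, where $\mathrm{OPT}$ is the optimum, on a potential $y_v$, and on the flow $x_e$ of each incident edge $e$ (the same at both endpoints), such that $Ax=b$, $q(R_*A^Ty)\le1$ and $p(W_*x)\le(1+\epsilon)\,b^Ty$. -/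

import Mathlib

open Finset Matrix

noncomputable section

namespace Transshipment

/-! ### Transshipment instances on a network -/

/-- An instance of the asymmetric transshipment problem: a connected simple graph whose nodes carry
unique identifiers, with a positive integral cost `cost u v` for traversing the edge `{u, v}` from
`u` to `v`, and an integral demand at every node (total demand zero, i.e. the instance is feasible).
Values of `cost` on non-adjacent pairs are irrelevant. -/
structure Network (V : Type) [Fintype V] where
  graph : SimpleGraph V
  connected : graph.Connected
  ident : V → ℕ
  ident_injective : Function.Injective ident
  cost : V → V → ℕ
  cost_pos : ∀ u v, graph.Adj u v → 1 ≤ cost u v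
  demand : V → ℤ
  sum_demand : ∑ v, demand v = 0

variable {V : Type} [Fintype V]

namespace Network

variable (N : Network V)

/-- Identifiers, edge costs and demands are polynomially bounded, with exponent `c`, in the
number of nodes. -/
def PolyBounded (c : ℕ) : Prop :=
  (∀ v, N.ident v ≤ Fintype.card V ^ c) ∧
  (∀ u v, N.graph.Adj u v → N.cost u v ≤ Fintype.card V ^ c) ∧
  (∀ v, |N.demand v| ≤ (Fintype.card V : ℤ) ^ c)

/-- Each edge is oriented in its more expensive direction; ties are broken by identifiers. -/
def IsForward (u v : V) : Prop :=
  N.graph.Adj u v ∧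
    (N.cost v u < N.cost u v ∨ (N.cost v u = N.cost u v ∧ N.ident u < N.ident v))

/-- The edges of the network, each represented by its forward arc `(tail, head)`. -/
abbrev Edge : Type := {a : V × V // N.IsForward a.1 a.2}

def tail (e : N.Edge) : V := e.1.1

def head (e : N.Edge) : V := e.1.2

instance : Fintype N.Edge := Fintype.ofFinite _

/-- Forward weights `w⁺`. -/
def wPlus (e : N.Edge) : ℝ := N.cost (N.tail e) (N.head e)

/-- Backward weights `w⁻`. -/
def wMinus (e : N.Edge) : ℝ := N.cost (N.head e) (N.tail e)

/-- The maximum `λ = ‖W₋⁻¹ w⁺‖_∞` of the cost ratio between the two directions of an edge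
(and `1` if there are no edges). -/
def asymmetry : ℝ := max 1 (⨆ e : N.Edge, N.wPlus e / N.wMinus e)

open Classical in
/-- The node-arc incidence matrix: the column of the arc `(u, v)` has `-1` at `u` and `1` at `v`. -/
def incidence : Matrix V N.Edge ℝ :=
  fun v e => (if v = N.head e then 1 else 0) - (if v = N.tail e then 1 else 0)

open Classical in
/-- `W_* = [W₊ -W₋]ᵀ`. -/
def wStar : Matrix (N.Edge ⊕ N.Edge) N.Edge ℝ :=
  Matrix.fromRows (Matrix.diagonal N.wPlus) (-Matrix.diagonal N.wMinus)

open Classical in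
/-- `R_* = [W₊⁻¹ -W₋⁻¹]ᵀ`. -/
def rStar : Matrix (N.Edge ⊕ N.Edge) N.Edge ℝ :=
  Matrix.fromRows (Matrix.diagonal fun e => (N.wPlus e)⁻¹)
    (-Matrix.diagonal fun e => (N.wMinus e)⁻¹)

end Network

/-- The asymmetric norm `p(x) = ∑ᵢ max {0, xᵢ}`. -/
def pNorm {ι : Type} [Fintype ι] (x : ι → ℝ) : ℝ := ∑ i, max 0 (x i)

/-- The asymmetric norm `q(x) = max {0, maxᵢ xᵢ}` (which is `0` on the empty index set). -/
def qNorm {ι : Type} [Fintype ι] (x : ι → ℝ) : ℝ := ⨆ i, max 0 (x i)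

namespace Network

variable (N : Network V)

/-- Primal feasibility `A x = b`. -/
def PrimalFeasible (x : N.Edge → ℝ) : Prop :=
  N.incidence *ᵥ x = fun v => (N.demand v : ℝ)

/-- Primal objective `p(W_* x)`. -/
def primalCost (x : N.Edge → ℝ) : ℝ := pNorm (N.wStar *ᵥ x)

/-- Dual feasibility `q(R_* Aᵀ y) ≤ 1`. -/
def DualFeasible (y : V → ℝ) : Prop :=
  qNorm (N.rStar *ᵥ (N.incidenceᵀ *ᵥ y)) ≤ 1

/-- Dual objective `bᵀ y`. -/
def dualValue (y : V → ℝ) : ℝ := ∑ v, (N.demand v : ℝ) * y v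

/-- `opt` is the (attained) optimum `min {p(W_* x) : A x = b}`. -/
def IsOptimum (opt : ℝ) : Prop :=
  IsLeast {z | ∃ x, N.PrimalFeasible x ∧ z = N.primalCost x} opt

end Network

/-! ### The broadcast congest model -/

/-- What a node knows initially: its own identifier, its demand, the accuracy `ε`, and for every
incident edge the identifier of the other endpoint together with the cost of traversing the edge
towards that endpoint and the cost of traversing it from that endpoint. In particular
the number of nodes is not known. -/
structure LocalInput where
  ident : ℕ
  demand : ℤ
  accuracy : ℝ
  incident : Finset (ℕ × ℕ × ℕ)

/-- A deterministic algorithm for the broadcast congest model; all nodes run the same one. In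
each synchronous round, a node broadcasts to its neighbors one message (a bit string, possibly
empty) that depends on its state, receives the messages of its neighbors, labeled by
their senders' identifiers, and updates its state by an arbitrary local computation. A node's
output is `none` as long as it has not decided. -/
structure BroadcastAlgorithm (Out : Type) where
  State : Type
  init : LocalInput → State
  message : State → List Bool
  step : State → Finset (ℕ × List Bool) → State
  output : State → Option Out

namespace Network

variable (N : Network V)

open Classical in
/-- The initial knowledge of node `v` if the accuracy is `ε`. -/
def localInput (ε : ℝ) (v : V) : LocalInput where
  ident := N.ident v
  demand := N.demand v
  accuracy := ε
  incident := (univ.filter fun u => N.graph.Adj v u).image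
    fun u => (N.ident u, N.cost v u, N.cost u v)

end Network

namespace BroadcastAlgorithm

variable {Out : Type} (alg : BroadcastAlgorithm Out) (N : Network V) (ε : ℝ)

open Classical in
/-- The state of each node after `t` rounds. -/
def stateAt : ℕ → V → alg.State
  | 0, v => alg.init (N.localInput ε v)
  | t + 1, v => alg.step (stateAt t v)
      ((univ.filter fun u => N.graph.Adj v u).image
        fun u => (N.ident u, alg.message (stateAt t u)))

/-- In the execution on `N`, no node ever broadcasts a message of more than `s` bits. -/
def MessagesBounded (s : ℕ) : Prop :=
  ∀ t v, (alg.message (alg.stateAt N ε t v)).length ≤ s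

/-- In the execution on `N`, each node `v` has decided on the output `out v` after `T` rounds,
and never announces any other output. -/
def ComputesWithin (T : ℕ) (out : V → Out) : Prop :=
  (∀ v t, T ≤ t → alg.output (alg.stateAt N ε t v) = some (out v)) ∧
  (∀ v t o, alg.output (alg.stateAt N ε t v) = some o → o = out v)

end BroadcastAlgorithm

/-- A node's part of the output: an approximation of the optimum value, the node's own potential
(dual variable), and the flow on each incident edge, indexed by the identifier of the
other endpoint and signed with respect to the forward orientation of the edge. -/
structure NodeOutput where
  value : ℝ
  potential : ℝ
  flow : ℕ → ℝ

/-- The outputs of the nodes form a `(1 + ε)`-approximate solution: every node knows the optimum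
up to a factor of `1 + ε`, and the nodes jointly know feasible primal and dual solutions
`x`, `y` with `p(W_* x) ≤ (1 + ε) bᵀ y`, where both endpoints of an edge know its flow. -/
def Network.IsApproximation (N : Network V) (ε : ℝ) (out : V → NodeOutput) : Prop :=
  (∃ opt, N.IsOptimum opt ∧ ∀ v, opt ≤ (out v).value ∧ (out v).value ≤ (1 + ε) * opt) ∧
  ∃ (x : N.Edge → ℝ) (y : V → ℝ),
    (∀ e, (out (N.tail e)).flow (N.ident (N.head e)) = x e ∧
      (out (N.head e)).flow (N.ident (N.tail e)) = x e) ∧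
    (∀ v, (out v).potential = y v) ∧
    N.PrimalFeasible x ∧ N.DualFeasible y ∧ N.primalCost x ≤ (1 + ε) * N.dualValue y

end Transshipment

end

noncomputable section

namespace Transshipment

/-! The algorithm is a program for a shared blackboard. A board is filled by gossip: in every round
each node broadcasts its least known item that it has not sent yet. By pipelining, `m` items reach
all nodes within `2 * m` rounds, and the local test `2 * |known| ≤ t` becomes true everywhere in the
same round (`two_mul_card_gossip_le_iff`), so the phases stay synchronized although the number of
nodes is unknown. Hence a phase with `m` items costs `2 * m` rounds (`compile_spec`), and whatever
is computed from boards alone is the same at all nodes.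

The edges are too many to be posted. Only a sparse subgraph is made public, by a derandomized
Baswana-Sen clustering for each cost class (`meets_sparsify`): a potential that changes little along
the selected edges changes along any edge by at most `O(log n)` times the power of two of its class.

For a target value `g`, multiplicative weights are run on a public potential `Φ`. Each node knows
the exponential weights of its incident arcs; they define a flow of cost at most `g`, of which the
node posts only its rounded inflow and outflow. If the unsatisfied demands can be routed cheaply on
the public subgraph, the sum of the two flows is a solution. Otherwise duality
(`exists_flow_or_potential`) yields a potential on which the flow falls short; scaled down by the
stretch, it is added to `Φ` and lowers the normalized total weight (`totalWeight_add_le`). After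
`O(λ² ε⁻² log³ n)` iterations a multiple of `Φ` is dual feasible with value `g`.

The value `g` runs through the powers of `1 + ε / 3`. The flow found for some `g` is paired with the
potential found for the preceding value, and `(1 + ε / 3) ^ 2 ≤ 1 + ε`. There are `O(ε⁻¹ log n)`
values and each iteration takes `4 * n` rounds, so the exponent of `λ` is even 2 here
(`scan_rounds_le`). If `n * ε < 1`, then posting all edges is affordable, since `n ^ 2 < n / ε`. -/

/-! ### Gossip -/

/-- The least known item that has not been sent yet; a pair consists of the known items and
the items sent so far. -/
def nextItem (s : Finset ℕ × Finset ℕ) : Option ℕ :=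
  if h : (s.1 \ s.2).Nonempty then some ((s.1 \ s.2).min' h) else none

lemma mem_nextItem {s : Finset ℕ × Finset ℕ} {x : ℕ} :
    x ∈ nextItem s ↔ x ∈ s.1 \ s.2 ∧ ∀ y ∈ s.1 \ s.2, x ≤ y := by
  unfold nextItem
  split_ifs with h
  · simp only [Option.mem_def, Option.some.injEq]
    constructor
    · rintro rfl
      exact ⟨min'_mem _ _, fun y hy => min'_le _ _ hy⟩
    · rintro ⟨h1, h2⟩
      exact le_antisymm (min'_le _ _ h1) (h2 _ (min'_mem _ _))
  · simp only [Option.mem_def, reduceCtorEq, false_iff, not_and]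
    intro hx
    exact absurd ⟨x, hx⟩ h

lemma exists_nextItem {s : Finset ℕ × Finset ℕ} {y : ℕ} (hy : y ∈ s.1 \ s.2) :
    ∃ x ∈ nextItem s, x ≤ y := by
  refine ⟨(s.1 \ s.2).min' ⟨y, hy⟩, ?_, min'_le _ _ hy⟩
  exact mem_nextItem.2 ⟨min'_mem _ _, fun z hz => min'_le _ _ hz⟩

section Gossip

variable {V : Type} [Fintype V] (G : SimpleGraph V) (P : V → Finset ℕ)

open Classical in
/-- The known and the sent items of each node after `t` rounds of gossip, where `P v` is the
set of the items that node `v` knows initially. -/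
def gossip : ℕ → V → Finset ℕ × Finset ℕ
  | 0, v => (P v, ∅)
  | t + 1, v =>
    ((gossip t v).1 ∪ (univ.filter fun u => G.Adj v u).biUnion
        fun u => (nextItem (gossip t u)).toFinset,
      (gossip t v).2 ∪ (nextItem (gossip t v)).toFinset)

variable {G P}

lemma gossip_fst_succ_iff {t : ℕ} {v : V} {x : ℕ} :
    x ∈ (gossip G P (t + 1) v).1 ↔
      x ∈ (gossip G P t v).1 ∨ ∃ u, G.Adj v u ∧ x ∈ nextItem (gossip G P t u) := by
  simp [gossip]

lemma gossip_snd_succ_iff {t : ℕ} {v : V} {x : ℕ} :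
    x ∈ (gossip G P (t + 1) v).2 ↔
      x ∈ (gossip G P t v).2 ∨ x ∈ nextItem (gossip G P t v) := by
  simp [gossip]

lemma gossip_fst_mono {t t' : ℕ} (h : t ≤ t') (v : V) :
    (gossip G P t v).1 ⊆ (gossip G P t' v).1 := by
  induction t', h using Nat.le_induction with
  | base => rfl
  | succ t' _ ih => exact fun x hx => gossip_fst_succ_iff.2 (Or.inl (ih hx))

lemma gossip_snd_mono {t t' : ℕ} (h : t ≤ t') (v : V) :
    (gossip G P t v).2 ⊆ (gossip G P t' v).2 := by
  induction t', h using Nat.le_induction with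
  | base => rfl
  | succ t' _ ih => exact fun x hx => gossip_snd_succ_iff.2 (Or.inl (ih hx))

/-- A message arrives in the round in which it is sent, so sent items are known to all neighbors
without delay. -/
lemma gossip_snd_subset_fst_adj (t : ℕ) {u v : V} (h : G.Adj v u) :
    (gossip G P t u).2 ⊆ (gossip G P t v).1 := by
  induction t with
  | zero => simp [gossip]
  | succ t ih =>
    intro x hx
    rcases gossip_snd_succ_iff.1 hx with hx | hx
    · exact gossip_fst_succ_iff.2 (Or.inl (ih hx))
    · exact gossip_fst_succ_iff.2 (Or.inr ⟨u, h, hx⟩)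

lemma gossip_fst_subset (t : ℕ) (v : V) : (gossip G P t v).1 ⊆ univ.biUnion P := by
  induction t generalizing v with
  | zero => exact subset_biUnion_of_mem P (mem_univ v)
  | succ t ih =>
    intro x hx
    rcases gossip_fst_succ_iff.1 hx with hx | ⟨u, -, hx⟩
    · exact ih v hx
    · exact ih u (mem_sdiff.1 (mem_nextItem.1 hx).1).1

/-- The least unsent item is at most `y`, so the next message adds a new item below `x` to the sent
ones. -/
lemma card_gossip_snd_step {t : ℕ} {v : V} {x y : ℕ} (hy : y ∈ (gossip G P t v).1)
    (hy' : y ∉ (gossip G P t v).2) (hyx : y ≤ x) :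
    ((gossip G P t v).2.filter (· ≤ x)).card + 1 ≤
      ((gossip G P (t + 1) v).2.filter (· ≤ x)).card := by
  obtain ⟨z, hz, hzy⟩ := exists_nextItem (s := gossip G P t v) (mem_sdiff.2 ⟨hy, hy'⟩)
  have hz' : z ∉ (gossip G P t v).2.filter (· ≤ x) := fun h =>
    (mem_sdiff.1 (mem_nextItem.1 hz).1).2 (mem_filter.1 h).1
  rw [← card_insert_of_notMem hz']
  apply card_le_card
  intro w hw
  rcases mem_insert.1 hw with rfl | hw
  · exact mem_filter.2 ⟨gossip_snd_succ_iff.2 (Or.inr hz), hzy.trans hyx⟩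
  · exact mem_filter.2 ⟨gossip_snd_succ_iff.2 (Or.inl (mem_filter.1 hw).1), (mem_filter.1 hw).2⟩

/-- Pipelining: an item is delayed on its way only by smaller items, each of which costs at
most one round. -/
lemma gossip_pipelining {x : ℕ} {o : V} (hx : x ∈ P o) {v : V} (p : G.Walk v o) (s : ℕ) :
    x ∈ (gossip G P (p.length + s) v).2 ∨
      s ≤ ((gossip G P (p.length + s) v).2.filter (· ≤ x)).card := by
  induction p generalizing s with
  | nil =>
    induction s with
    | zero => right; simp
    | succ s ih =>
      rename_i o
      have hx' : x ∈ (gossip G P (0 + s) o).1 := gossip_fst_mono (Nat.zero_le _) o hx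
      by_cases h : x ∈ (gossip G P (0 + s) o).2
      · exact Or.inl (gossip_snd_mono (by simp) o h)
      · right
        have h1 := card_gossip_snd_step hx' h le_rfl
        rcases ih with h2 | h2
        · exact absurd h2 h
        · exact (Nat.succ_le_succ h2).trans h1
  | cons hadj p ih =>
    rename_i v u o
    induction s with
    | zero => right; simp
    | succ s ihs =>
      simp only [SimpleGraph.Walk.length_cons] at ihs ⊢
      by_cases h : x ∈ (gossip G P (p.length + 1 + s) v).2
      · exact Or.inl (gossip_snd_mono (by omega) v h)
      · right
        have h2 := ihs.resolve_left h
        by_cases hge : s + 1 ≤ ((gossip G P (p.length + 1 + s) v).2.filter (· ≤ x)).card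
        · exact hge.trans (card_le_card (filter_subset_filter _ (gossip_snd_mono (by omega) v)))
        · have hsub := gossip_snd_subset_fst_adj (P := P) (p.length + 1 + s) hadj
          -- The neighbor `u` is one step closer to the origin, hence one item ahead of `v`; as `v`
          -- knows all that `u` has sent, it still has an unsent item that is at most `x`.
          have hu := ih hx (s + 1)
          rw [show p.length + (s + 1) = p.length + 1 + s by omega] at hu
          have : ∃ y ∈ (gossip G P (p.length + 1 + s) v).1,
              y ∉ (gossip G P (p.length + 1 + s) v).2 ∧ y ≤ x := by
            rcases hu with hu | hu
            · exact ⟨x, hsub hu, h, le_rfl⟩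
            · by_contra! hcon
              apply hge
              refine hu.trans (card_le_card fun y hy => ?_)
              rw [mem_filter] at hy ⊢
              refine ⟨?_, hy.2⟩
              by_contra hy'
              exact absurd hy.2 (not_le.2 (hcon y (hsub hy.1) hy'))
          obtain ⟨y, hy, hy', hyx⟩ := this
          exact (Nat.succ_le_succ h2).trans (card_gossip_snd_step hy hy' hyx)

/-- A node that has not received everything knows many items. -/
lemma lt_two_mul_card_gossip (hG : G.Connected) (hne : ∀ v, (P v).Nonempty)
    (hdis : ∀ u v, u ≠ v → Disjoint (P u) (P v)) {t : ℕ} {v : V}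
    (h : (gossip G P t v).1 ≠ univ.biUnion P) : t < 2 * (gossip G P t v).1.card := by
  classical
  -- Take a closest node `o` some item of which is missing at `v`.
  have hex : ∃ i o, G.dist v o = i ∧ ¬ P o ⊆ (gossip G P t v).1 := by
    by_contra! hcon
    exact h ((gossip_fst_subset t v).antisymm (biUnion_subset.2 fun o _ => hcon _ o rfl))
  obtain ⟨o, ho, hoP⟩ := Nat.find_spec hex
  set i := Nat.find hex with hi
  have hmin : ∀ u, G.dist v u < i → P u ⊆ (gossip G P t v).1 := fun u hu => by
    by_contra hcon
    exact Nat.find_min hex hu ⟨u, rfl, hcon⟩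
  obtain ⟨x, hx, hx'⟩ := not_subset.1 hoP
  obtain ⟨p, hp, hplen⟩ := hG.exists_path_of_dist v o
  -- The `i` nodes before `o` on a shortest path are closer than `o`, so all their items are known;
  -- these are nonempty disjoint sets.
  have hcard : i ≤ (gossip G P t v).1.card := by
    have hlt : ∀ k, k < i → P (p.getVert k) ⊆ (gossip G P t v).1 := fun k hk => by
      apply hmin
      refine lt_of_le_of_lt ?_ hk
      have := SimpleGraph.dist_le (p.take k)
      exact this.trans (by simp)
    rw [← card_range i]
    choose a ha using hne
    refine card_le_card_of_injOn (fun k => a (p.getVert k)) ?_ ?_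
    · intro k hk
      exact hlt k (by simpa using hk) (ha _)
    · intro k hk k' hk' hkk
      have hk1 : k < i := by simpa using hk
      have hk2 : k' < i := by simpa using hk'
      by_contra hne'
      have hvne : p.getVert k ≠ p.getVert k' := fun hv =>
        hne' (hp.getVert_injOn (by simp; omega) (by simp; omega) hv)
      refine disjoint_left.1 (hdis _ _ hvne) (ha _) ?_
      simp only at hkk
      rw [hkk]
      exact ha _
  cases p with
  | nil => exact absurd (gossip_fst_mono (Nat.zero_le t) _ hx) hx'
  | cons hadj q =>
    simp only [SimpleGraph.Walk.length_cons] at hplen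
    by_cases ht : t < i
    · omega
    -- The first neighbor on the path is at distance `i - 1` from `o`. It cannot have sent `x`, so
    -- it has sent at least `t - (i - 1)` items, all known to `v`. Together with the `i` known items
    -- above, twice the number of known items is at least `t + 1`.
    · have := gossip_pipelining hx q (t - q.length)
      rw [show q.length + (t - q.length) = t by omega] at this
      have hsub := gossip_snd_subset_fst_adj (P := P) t hadj
      rcases this with h1 | h1
      · exact absurd (hsub h1) hx'
      · have h2 := h1.trans ((card_filter_le _ _).trans (card_le_card hsub))
        omega

/-- The local test `2 |known| ≤ t` becomes true at all nodes at the same time, namely after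
twice as many rounds as there are items. -/
lemma two_mul_card_gossip_le_iff (hG : G.Connected) (hne : ∀ v, (P v).Nonempty)
    (hdis : ∀ u v, u ≠ v → Disjoint (P u) (P v)) (t : ℕ) (v : V) :
    2 * (gossip G P t v).1.card ≤ t ↔ 2 * (univ.biUnion P).card ≤ t := by
  constructor
  · intro h
    by_cases h' : (gossip G P t v).1 = univ.biUnion P
    · rwa [h'] at h
    · have := lt_two_mul_card_gossip hG hne hdis h'
      omega
  · intro h
    have := card_le_card (gossip_fst_subset (G := G) (P := P) t v)
    omega

lemma gossip_fst_eq (hG : G.Connected) (hne : ∀ v, (P v).Nonempty)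
    (hdis : ∀ u v, u ≠ v → Disjoint (P u) (P v)) {t : ℕ} (v : V)
    (h : 2 * (univ.biUnion P).card ≤ t) : (gossip G P t v).1 = univ.biUnion P := by
  by_contra h'
  have h1 := lt_two_mul_card_gossip hG hne hdis h'
  have := card_le_card (gossip_fst_subset (G := G) (P := P) t v)
  omega

end Gossip

/-! ### Blackboard programs -/

/-- A program for a blackboard shared by all nodes. In each phase, every node posts a finite set of
numbers that depends on its initial knowledge, and the continuation depends on the board,
which consists of the posted numbers tagged with the identifiers of the nodes (see `tagged`). -/
inductive Prog (α : Type) : Type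
  | pure : α → Prog α
  | ask : (LocalInput → Finset ℕ) → (Finset ℕ → Prog α) → Prog α

namespace Prog

def bind {α β : Type} : Prog α → (α → Prog β) → Prog β
  | pure a, f => f a
  | ask post next, f => ask post fun board => bind (next board) f

/-- `n` iterations of a step. -/
def iter {α : Type} (step : ℕ → α → Prog α) : ℕ → α → Prog α
  | 0, a => pure a
  | n + 1, a => (iter step n a).bind (step n)

end Prog

/-- The items that the node with identifier `i` contributes to the board when it posts `S`. At
least one item is contributed by each node. -/
def tagged (i : ℕ) (S : Finset ℕ) : Finset ℕ :=
  insert (Nat.pair i 0) (S.image fun a => Nat.pair i (a + 1))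

/-- The numbers posted by the node with identifier `i`. -/
def contents (board : Finset ℕ) (i : ℕ) : Finset ℕ :=
  (board.image fun x => x.unpair.2 - 1).filter fun a => Nat.pair i (a + 1) ∈ board

/-- The identifiers of the nodes. -/
def senders (board : Finset ℕ) : Finset ℕ := board.image fun x => x.unpair.1

lemma mem_contents {board : Finset ℕ} {i a : ℕ} :
    a ∈ contents board i ↔ Nat.pair i (a + 1) ∈ board := by
  simp only [contents, mem_filter, mem_image, and_iff_right_iff_imp]
  exact fun h => ⟨_, h, by simp⟩

lemma mem_tagged {i x : ℕ} {S : Finset ℕ} :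
    x ∈ tagged i S ↔ x = Nat.pair i 0 ∨ ∃ a ∈ S, Nat.pair i (a + 1) = x := by
  simp [tagged]

/-- The marker with second component `0` supplies the nonemptiness that the termination test of
gossip relies on; disjointness comes from the identifier in the first component. -/
lemma tagged_nonempty (i : ℕ) (S : Finset ℕ) : (tagged i S).Nonempty := insert_nonempty _ _

lemma unpair_fst_of_mem_tagged {i x : ℕ} {S : Finset ℕ} (h : x ∈ tagged i S) :
    x.unpair.1 = i := by
  rcases mem_tagged.1 h with rfl | ⟨a, -, rfl⟩ <;> simp

lemma card_tagged_le (i : ℕ) (S : Finset ℕ) : (tagged i S).card ≤ S.card + 1 :=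
  (card_insert_le _ _).trans (Nat.succ_le_succ card_image_le)

namespace Network

variable {V : Type} [Fintype V] (N : Network V) (ε : ℝ)

/-- The board that results if each node posts `post` of its initial knowledge. -/
def board (post : LocalInput → Finset ℕ) : Finset ℕ :=
  univ.biUnion fun v => tagged (N.ident v) (post (N.localInput ε v))

variable {N ε}

lemma contents_board (post : LocalInput → Finset ℕ) (v : V) :
    contents (N.board ε post) (N.ident v) = post (N.localInput ε v) := by
  ext a
  simp only [mem_contents, board, mem_biUnion, mem_univ, true_and, mem_tagged, Nat.pair_eq_pair]
  constructor
  · rintro ⟨u, ⟨-, h⟩ | ⟨a', ha', hu, h⟩⟩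
    · omega
    · obtain rfl := N.ident_injective hu
      obtain rfl : a' = a := by omega
      exact ha'
  · exact fun h => ⟨v, Or.inr ⟨a, h, rfl, rfl⟩⟩

lemma senders_board (post : LocalInput → Finset ℕ) :
    senders (N.board ε post) = univ.image N.ident := by
  ext i
  simp only [senders, board, mem_image, mem_biUnion, mem_univ, true_and]
  constructor
  · rintro ⟨x, ⟨v, hv⟩, rfl⟩
    exact ⟨v, (unpair_fst_of_mem_tagged hv).symm⟩
  · rintro ⟨v, rfl⟩
    exact ⟨Nat.pair (N.ident v) 0, ⟨v, mem_insert_self _ _⟩, by simp⟩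

lemma card_board_le (post : LocalInput → Finset ℕ) {m : ℕ}
    (h : ∀ v, (post (N.localInput ε v)).card ≤ m) :
    (N.board ε post).card ≤ Fintype.card V * (m + 1) := by
  refine card_biUnion_le_card_mul _ _ _ fun v _ => ?_
  exact (card_tagged_le _ _).trans (Nat.succ_le_succ (h v))

end Network

namespace Prog

section Meets

variable {V : Type} [Fintype V] (N : Network V) (ε : ℝ) (β : ℕ) {α α' : Type}

/-- Running the program takes at most `T` rounds, the posted numbers have at most `β` bits, and the
result has the property `Q`. -/
def Meets : Prog α → ℕ → (α → Prop) → Prop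
  | pure a, _, Q => Q a
  | ask post next, T, Q => (∀ v, ∀ a ∈ post (N.localInput ε v), a + 1 < 2 ^ β) ∧
      -- A phase lasts exactly twice as many rounds as its board has items.
      ∃ T', 2 * (N.board ε post).card + T' ≤ T ∧ Meets (next (N.board ε post)) T' Q

variable {N ε β}

lemma Meets.mono {p : Prog α} {T T' : ℕ} {Q Q' : α → Prop} (h : p.Meets N ε β T Q)
    (hT : T ≤ T') (hQ : ∀ a, Q a → Q' a) : p.Meets N ε β T' Q' := by
  induction p generalizing T T' with
  | pure a => exact hQ a h
  | ask post next ih =>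
    obtain ⟨h1, T1, hT1, h2⟩ := h
    exact ⟨h1, T1, hT1.trans hT, ih _ h2 le_rfl⟩

lemma Meets.bind {p : Prog α} {f : α → Prog α'} {T T' : ℕ} {Q : α → Prop} {Q' : α' → Prop}
    (h : p.Meets N ε β T Q) (hf : ∀ a, Q a → (f a).Meets N ε β T' Q') :
    (p.bind f).Meets N ε β (T + T') Q' := by
  induction p generalizing T with
  | pure a => exact (hf a h).mono (Nat.le_add_left _ _) fun _ => id
  | ask post next ih =>
    obtain ⟨h1, T1, hT1, h2⟩ := h
    exact ⟨h1, T1 + T', by omega, ih _ h2⟩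

lemma meets_ask {post : LocalInput → Finset ℕ} {next : Finset ℕ → Prog α} {m T : ℕ}
    {Q : α → Prop} (h1 : ∀ v, ∀ a ∈ post (N.localInput ε v), a + 1 < 2 ^ β)
    (h2 : ∀ v, (post (N.localInput ε v)).card ≤ m)
    (h3 : (next (N.board ε post)).Meets N ε β T Q) :
    (ask post next).Meets N ε β (2 * (Fintype.card V * (m + 1)) + T) Q :=
  ⟨h1, T, by have := Network.card_board_le post h2; omega, h3⟩

lemma meets_iter {step : ℕ → α → Prog α} {T n : ℕ} (I : ℕ → α → Prop) {a : α} (h0 : I 0 a)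
    (hstep : ∀ i < n, ∀ a, I i a → (step i a).Meets N ε β T (I (i + 1))) :
    (iter step n a).Meets N ε β (n * T) (I n) := by
  induction n with
  | zero => exact h0
  | succ n ih =>
    rw [Nat.succ_mul]
    exact (ih fun i hi => hstep i (by omega)).bind (hstep n (by omega))

end Meets

end Prog

/-- `Nat.pair i j` is less than `(max i j + 1) ^ 2`; the extra bit pays for the successor, by which
items are shifted in messages. -/
lemma pair_succ_lt {i j β : ℕ} (hi : i < 2 ^ β) (hj : j < 2 ^ β) :
    Nat.pair i j + 1 < 2 ^ (2 * β + 1) := by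
  have h3 := Nat.pair_lt_max_add_one_sq i j
  have h4 : max i j + 1 ≤ 2 ^ β := by omega
  have h5 := Nat.pow_le_pow_left h4 2
  have h6 : 2 ^ (2 * β + 1) = 2 * (2 ^ β) ^ 2 := by ring
  have h7 : 0 < 2 ^ β := by positivity
  rw [h6]
  nlinarith

/-! ### Running a blackboard program in the broadcast congest model -/

/-- The encoding of the message that sends an item, or of the empty message. -/
def encodeItem (o : Option ℕ) : List Bool := o.elim [] fun x => (x + 1).bits

lemma bits_injective : Function.Injective Nat.bits := by
  intro m n h
  apply Nat.digits.injective 2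
  rw [Nat.digits_two_eq_bits, Nat.digits_two_eq_bits, h]

/-- The shift by one is essential: `0` has the empty bit string, which stands for sending nothing.
-/
lemma encodeItem_injective : Function.Injective encodeItem := by
  have hne : ∀ x : ℕ, (x + 1).bits ≠ [] := fun x h =>
    absurd (bits_injective (h.trans Nat.zero_bits.symm)) (Nat.succ_ne_zero x)
  intro o o' h
  cases o with
  | none =>
    cases o' with
    | none => rfl
    | some y => exact absurd h.symm (hne y)
  | some x =>
    cases o' with
    | none => exact absurd h (hne x)
    | some y =>
      have := bits_injective h
      simp only [Nat.add_right_cancel_iff] at this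
      rw [this]

lemma length_encodeItem_le {o : Option ℕ} {s : ℕ} (h : ∀ x ∈ o, x + 1 < 2 ^ s) :
    (encodeItem o).length ≤ s := by
  cases o with
  | none => simp [encodeItem]
  | some x =>
    simp only [encodeItem, Option.elim_some]
    rw [Nat.size_eq_bits_len]
    exact Nat.size_le.2 (h x rfl)

def decodeItem : List Bool → Option ℕ := Function.invFun encodeItem

lemma decodeItem_encodeItem (o : Option ℕ) : decodeItem (encodeItem o) = o :=
  Function.leftInverse_invFun encodeItem_injective o

/-- The state of a node that runs a blackboard program: its initial knowledge, the rest of the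
program, the number of rounds since the current phase began, and the known and sent items
of this phase. -/
structure NodeState (Out : Type) where
  input : LocalInput
  prog : Prog (LocalInput → Out)
  clock : ℕ
  items : Finset ℕ × Finset ℕ

namespace NodeState

variable {Out : Type}

/-- The state at the beginning of a phase. -/
def enter (inp : LocalInput) : Prog (LocalInput → Out) → NodeState Out
  | .pure a => ⟨inp, .pure a, 0, (∅, ∅)⟩
  | .ask post next => ⟨inp, .ask post next, 0, (tagged inp.ident (post inp), ∅)⟩

/-- The test succeeds at all nodes in the same round, so they enter the next phase together and no
further synchronization is needed. -/
def step (s : NodeState Out) (received : Finset (ℕ × List Bool)) : NodeState Out :=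
  match s.prog with
  | .pure _ => s
  | .ask _ next =>
    let known := s.items.1 ∪ received.biUnion fun m => (decodeItem m.2).toFinset
    if 2 * known.card ≤ s.clock + 1 then enter s.input (next known)
    else ⟨s.input, s.prog, s.clock + 1, (known, s.items.2 ∪ (nextItem s.items).toFinset)⟩

lemma step_ask (inp : LocalInput) (post : LocalInput → Finset ℕ)
    (next : Finset ℕ → Prog (LocalInput → Out)) (t : ℕ) (items : Finset ℕ × Finset ℕ)
    (received : Finset (ℕ × List Bool)) :
    step ⟨inp, .ask post next, t, items⟩ received =
      let known := items.1 ∪ received.biUnion fun m => (decodeItem m.2).toFinset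
      if 2 * known.card ≤ t + 1 then enter inp (next known)
      else ⟨inp, .ask post next, t + 1, (known, items.2 ∪ (nextItem items).toFinset)⟩ := rfl

def output (s : NodeState Out) : Option Out :=
  match s.prog with
  | .pure a => some (a s.input)
  | .ask _ _ => none

end NodeState

/-- The broadcast congest algorithm that runs a blackboard program. -/
def compile {Out : Type} (p : ℝ → Prog (LocalInput → Out)) : BroadcastAlgorithm Out where
  State := NodeState Out
  init inp := NodeState.enter inp (p inp.accuracy)
  message s := encodeItem (nextItem s.items)
  step := NodeState.step
  output := NodeState.output

section Simulation

variable {V : Type} [Fintype V] {N : Network V} {ε : ℝ} {Out : Type}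
  {p : ℝ → Prog (LocalInput → Out)}

/-- During a phase the execution is literally `gossip`, and the phase ends at all nodes when they
know the whole board. -/
lemma stateAt_compile_phase {t₀ : ℕ} {post : LocalInput → Finset ℕ}
    {next : Finset ℕ → Prog (LocalInput → Out)}
    (h : ∀ v, (compile p).stateAt N ε t₀ v =
      NodeState.enter (N.localInput ε v) (.ask post next)) :
    (∀ t < 2 * (N.board ε post).card, ∀ v, (compile p).stateAt N ε (t₀ + t) v =
      ⟨N.localInput ε v, .ask post next, t,
        gossip N.graph (fun v => tagged (N.ident v) (post (N.localInput ε v))) t v⟩) ∧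
    ∀ v, (compile p).stateAt N ε (t₀ + 2 * (N.board ε post).card) v =
      NodeState.enter (N.localInput ε v) (next (N.board ε post)) := by
  classical
  set P : V → Finset ℕ := fun v => tagged (N.ident v) (post (N.localInput ε v)) with hP
  have hne : ∀ v, (P v).Nonempty := fun v => tagged_nonempty _ _
  have hdis : ∀ u v, u ≠ v → Disjoint (P u) (P v) := fun u v huv =>
    disjoint_left.2 fun x hu hv => huv (N.ident_injective
      ((unpair_fst_of_mem_tagged hu).symm.trans (unpair_fst_of_mem_tagged hv)))
  have hboard : N.board ε post = univ.biUnion P := rfl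
  -- The termination test is made only after a round, so a phase must not be empty.
  have hpos : 0 < (N.board ε post).card := by
    obtain ⟨v⟩ := N.connected.nonempty
    obtain ⟨x, hx⟩ := hne v
    exact card_pos.2 ⟨x, mem_biUnion.2 ⟨v, mem_univ _, hx⟩⟩
  have hknown : ∀ t v, (∀ v, (compile p).stateAt N ε (t₀ + t) v =
      ⟨N.localInput ε v, .ask post next, t, gossip N.graph P t v⟩) →
      (compile p).stateAt N ε (t₀ + (t + 1)) v =
        if 2 * (gossip N.graph P (t + 1) v).1.card ≤ t + 1 then
          NodeState.enter (N.localInput ε v) (next (gossip N.graph P (t + 1) v).1)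
        else ⟨N.localInput ε v, .ask post next, t + 1, gossip N.graph P (t + 1) v⟩ := by
    intro t v ht
    have hk : (gossip N.graph P t v).1 ∪
        ((univ.filter fun u => N.graph.Adj v u).image fun u => (N.ident u,
          (compile p).message ((compile p).stateAt N ε (t₀ + t) u))).biUnion
          (fun m => (decodeItem m.2).toFinset) = (gossip N.graph P (t + 1) v).1 := by
      rw [gossip, image_biUnion]
      congr 1
      refine biUnion_congr (by congr) fun u _ => ?_
      rw [ht u]
      change (decodeItem (encodeItem _)).toFinset = _
      rw [decodeItem_encodeItem]
    rw [← add_assoc, BroadcastAlgorithm.stateAt, ht v]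
    refine (NodeState.step_ask (Out := Out) _ _ _ _ _ _).trans ?_
    dsimp only
    rw [hk]
    rfl
  have hphase : ∀ t < 2 * (N.board ε post).card, ∀ v, (compile p).stateAt N ε (t₀ + t) v =
      ⟨N.localInput ε v, .ask post next, t, gossip N.graph P t v⟩ := by
    intro t
    induction t with
    | zero => exact fun _ v => h v
    | succ t ih =>
      intro ht v
      rw [hknown t v (ih (by omega)), if_neg]
      rw [two_mul_card_gossip_le_iff N.connected hne hdis, ← hboard]
      omega
  refine ⟨hphase, fun v => ?_⟩
  obtain ⟨t, ht⟩ : ∃ t, 2 * (N.board ε post).card = t + 1 := ⟨_, (Nat.succ_pred (by omega)).symm⟩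
  rw [ht, hknown t v (hphase t (by omega)), if_pos,
    gossip_fst_eq N.connected hne hdis v (by rw [← hboard, ht]), ← hboard]
  rw [two_mul_card_gossip_le_iff N.connected hne hdis, ← hboard]
  omega

/-- Generalizing the starting round `t₀` makes the induction over the phases of the program
possible. An item pairs an identifier with a number, both of `β` bits, hence `2 * β + 1`. -/
lemma compile_from {β : ℕ} (hid : ∀ v, N.ident v < 2 ^ β) {q : Prog (LocalInput → Out)} {T t₀ : ℕ}
    {Q : (LocalInput → Out) → Prop}
    (h : ∀ v, (compile p).stateAt N ε t₀ v = NodeState.enter (N.localInput ε v) q)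
    (hq : q.Meets N ε β T Q) :
    ∃ a, Q a ∧
      (∀ v t, t₀ + T ≤ t →
        (compile p).output ((compile p).stateAt N ε t v) = some (a (N.localInput ε v))) ∧
      (∀ v t o, t₀ ≤ t → (compile p).output ((compile p).stateAt N ε t v) = some o →
        o = a (N.localInput ε v)) ∧
      ∀ t v, t₀ ≤ t →
        ((compile p).message ((compile p).stateAt N ε t v)).length ≤ 2 * β + 1 := by
  induction q generalizing T t₀ with
  | pure a =>
    have hs : ∀ t, ∀ v, (compile p).stateAt N ε (t₀ + t) v =
        NodeState.enter (N.localInput ε v) (.pure a) := by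
      intro t
      induction t with
      | zero => exact h
      | succ t ih =>
        intro v
        rw [← add_assoc, BroadcastAlgorithm.stateAt, ih v]
        rfl
    have hs' : ∀ t, t₀ ≤ t → ∀ v, (compile p).stateAt N ε t v =
        NodeState.enter (N.localInput ε v) (.pure a) := fun t ht v => by
      obtain ⟨k, rfl⟩ := Nat.exists_eq_add_of_le ht
      exact hs k v
    refine ⟨a, hq, fun v t ht => ?_, fun v t o ht ho => ?_, fun t v ht => ?_⟩
    · rw [hs' t (by omega) v]; rfl
    · rw [hs' t ht v] at ho
      exact (Option.some.inj ho).symm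
    · rw [hs' t ht v]
      simp [compile, NodeState.enter, nextItem, encodeItem]
  | ask post next ih =>
    obtain ⟨h1, T', hT, h2⟩ := hq
    obtain ⟨hph, hend⟩ := stateAt_compile_phase h
    obtain ⟨a, hQ, ha1, ha2, ha3⟩ := ih _ hend h2
    refine ⟨a, hQ, fun v t ht => ha1 v t (by omega), fun v t o ht ho => ?_, fun t v ht => ?_⟩
    · by_cases htt : t₀ + 2 * (N.board ε post).card ≤ t
      · exact ha2 v t o htt ho
      · obtain ⟨k, rfl⟩ := Nat.exists_eq_add_of_le ht
        rw [hph k (by omega)] at ho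
        simp [compile, NodeState.output] at ho
    · by_cases htt : t₀ + 2 * (N.board ε post).card ≤ t
      · exact ha3 t v htt
      · obtain ⟨k, rfl⟩ := Nat.exists_eq_add_of_le ht
        rw [hph k (by omega)]
        refine length_encodeItem_le fun x hx => ?_
        have hx' := gossip_fst_subset _ _ (mem_sdiff.1 (mem_nextItem.1 hx).1).1
        obtain ⟨u, -, hu⟩ := mem_biUnion.1 hx'
        rcases mem_tagged.1 hu with rfl | ⟨a, haa, rfl⟩
        · exact pair_succ_lt (hid u) (by positivity)
        · exact pair_succ_lt (hid u) (h1 u a haa)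

theorem compile_spec {β : ℕ} (hid : ∀ v, N.ident v < 2 ^ β) {T : ℕ}
    {Q : (LocalInput → Out) → Prop} (hq : (p ε).Meets N ε β T Q) :
    (compile p).MessagesBounded N ε (2 * β + 1) ∧
      ∃ a, Q a ∧ (compile p).ComputesWithin N ε T fun v => a (N.localInput ε v) := by
  obtain ⟨a, hQ, h1, h2, h3⟩ := compile_from (p := p) (t₀ := 0) hid (fun v => rfl) hq
  exact ⟨fun t v => h3 t v (Nat.zero_le t), a, hQ, fun v t ht => h1 v t (by omega),
    fun v t o => h2 v t o (Nat.zero_le t)⟩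

end Simulation

/-! ### Flows and potentials -/

section Flow

variable {ι : Type} [Fintype ι]

/-- The net flow into a node, for a flow given on ordered pairs of nodes. -/
def netFlow (f : ι → ι → ℝ) (v : ι) : ℝ := ∑ u, f u v - ∑ u, f v u

lemma sum_mul_netFlow (f : ι → ι → ℝ) (φ : ι → ℝ) :
    ∑ v, φ v * netFlow f v = ∑ u, ∑ v, f u v * (φ v - φ u) := by
  simp only [netFlow, mul_sub, sum_sub_distrib, mul_sum]
  rw [sum_comm]
  congr 1 <;> exact sum_congr rfl fun u _ => sum_congr rfl fun v _ => mul_comm _ _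

lemma netFlow_add (f g : ι → ι → ℝ) (v : ι) :
    netFlow (fun u w => f u w + g u w) v = netFlow f v + netFlow g v := by
  simp only [netFlow, sum_add_distrib]
  ring

/-- Either there is a cheap flow that satisfies the demands, or a potential that shows that there
is none. -/
theorem exists_flow_or_potential (R : ι → ι → Prop) (c : ι → ι → ℝ)
    (hc : ∀ u v, R u v → 0 < c u v) (r : ι → ℝ) {τ : ℝ} (hτ : 0 < τ) :
    (∃ f : ι → ι → ℝ, (∀ u v, 0 ≤ f u v) ∧ (∀ u v, ¬R u v → f u v = 0) ∧
      ∑ u, ∑ v, c u v * f u v ≤ τ ∧ ∀ v, netFlow f v = r v) ∨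
    ∃ φ : ι → ℝ, (∀ u v, R u v → φ v - φ u ≤ c u v) ∧ τ < ∑ v, r v * φ v := by
  classical
  -- A coordinate of a point of the simplex is the fraction of the budget `τ` spent on an arc;
  -- `none` and the pairs outside `R` carry no flow. So the image `S` of the simplex consists of the
  -- net flows available within the budget.
  set F : (Option (ι × ι) → ℝ) → ι → ι → ℝ := fun w u v =>
    if R u v then w (some (u, v)) * (τ / c u v) else 0 with hF
  set L : (Option (ι × ι) → ℝ) →ₗ[ℝ] ι → ℝ :=
    { toFun := fun w => netFlow (F w)
      map_add' := fun w w' => by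
        ext v
        rw [Pi.add_apply, ← netFlow_add]
        congr 1
        ext a b
        simp only [hF, Pi.add_apply]
        split_ifs <;> ring
      map_smul' := fun x w => by
        ext v
        simp only [netFlow, hF, Pi.smul_apply, smul_eq_mul, RingHom.id_apply, mul_sub, mul_sum]
        congr 1 <;> exact sum_congr rfl fun u _ => by split_ifs <;> ring } with hL
  have hLw : ∀ w, L w = netFlow (F w) := fun w => rfl
  set S : Set (ι → ℝ) := L '' stdSimplex ℝ (Option (ι × ι)) with hS
  by_cases hr : r ∈ S
  · left
    obtain ⟨w, ⟨hw0, hw1⟩, hwr⟩ := hr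
    refine ⟨F w, fun u v => ?_, fun u v h => if_neg h, ?_, fun v => ?_⟩
    · simp only [hF]
      split_ifs with h
      · exact mul_nonneg (hw0 _) (div_nonneg hτ.le (hc u v h).le)
      · rfl
    · have h1 : ∀ u v, c u v * F w u v ≤ τ * w (some (u, v)) := fun u v => by
        simp only [hF]
        split_ifs with h
        · have := (hc u v h).ne'
          apply le_of_eq
          field_simp
        · rw [mul_zero]
          exact mul_nonneg hτ.le (hw0 _)
      calc ∑ u, ∑ v, c u v * F w u v ≤ ∑ u, ∑ v, τ * w (some (u, v)) :=
            sum_le_sum fun u _ => sum_le_sum fun v _ => h1 u v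
        _ = τ * ∑ a : ι × ι, w (some a) := by
            rw [mul_sum, Fintype.sum_prod_type]
        _ ≤ τ * 1 := by
            refine mul_le_mul_of_nonneg_left ?_ hτ.le
            rw [← hw1, Fintype.sum_option]
            exact le_add_of_nonneg_left (hw0 _)
        _ = τ := mul_one τ
    · rw [← hwr, hLw]
  · right
    have hconv : Convex ℝ S := (convex_stdSimplex ℝ _).linear_image L
    have hclosed : IsClosed S := by
      have hcont : Continuous L := L.continuous_of_finiteDimensional
      exact ((isCompact_stdSimplex ℝ _).image hcont).isClosed
    -- `S` is convex and compact, so a linear functional separates `r` from it. Its value at the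
    -- vertex `none` shows `0 < s`, its values at the other vertices bound the potential
    -- differences, and scaling by `τ / s` normalizes the bounds to the costs.
    obtain ⟨ψ, s, hs, hsr⟩ := geometric_hahn_banach_closed_point hconv hclosed hr
    set φ : ι → ℝ := fun v => ψ (Pi.single v 1) with hφ
    have hψ : ∀ z : ι → ℝ, ψ z = ∑ v, z v * φ v := fun z => by
      conv_lhs => rw [pi_eq_sum_univ' z]
      rw [map_sum]
      exact sum_congr rfl fun v _ => by
        rw [map_smul, smul_eq_mul]
    have hs0 : 0 < s := by
      have := hs _ ⟨Pi.single none 1, single_mem_stdSimplex ℝ none, rfl⟩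
      rw [hLw, hψ] at this
      simpa [netFlow, hF] using this
    refine ⟨fun v => τ / s * φ v, fun u v huv => ?_, ?_⟩
    · have h1 := hs _ ⟨Pi.single (some (u, v)) 1, single_mem_stdSimplex ℝ _, rfl⟩
      rw [hLw, hψ] at h1
      have h2 : ∑ x, netFlow (F (Pi.single (some (u, v)) 1)) x * φ x =
          τ / c u v * (φ v - φ u) := by
        simp only [mul_comm _ (φ _)]
        rw [sum_mul_netFlow, sum_eq_single u, sum_eq_single v]
        · simp [hF, huv]
        · intro b _ hb
          simp [hF, hb]
        · simp
        · intro a _ ha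
          exact sum_eq_zero fun b _ => by simp [hF, ha]
        · simp
      rw [h2] at h1
      have hcuv := hc u v huv
      have h3 : τ * (φ v - φ u) < s * c u v := by
        rw [div_mul_eq_mul_div, div_lt_iff₀ hcuv] at h1
        exact h1
      have h4 : τ / s * φ v - τ / s * φ u = τ * (φ v - φ u) / s := by ring
      rw [h4, div_le_iff₀ hs0]
      linarith
    · rw [hψ] at hsr
      have h1 : ∑ v, r v * (τ / s * φ v) = τ / s * ∑ v, r v * φ v := by
        rw [mul_sum]
        exact sum_congr rfl fun v _ => by ring
      rw [h1, div_mul_eq_mul_div, lt_div_iff₀ hs0]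
      exact mul_lt_mul_of_pos_left hsr hτ

end Flow

/-! ### Approximate solutions -/

namespace Network

variable {V : Type} [Fintype V] (N : Network V)

/-- A potential is dual feasible. -/
def IsPotential (y : V → ℝ) : Prop := ∀ u v, N.graph.Adj u v → y v - y u ≤ N.cost u v

/-- A flow on ordered pairs of nodes and a potential that certify each other to be
`(1 + ε)`-approximate. -/
structure IsApproxPair (ε : ℝ) (f : V → V → ℝ) (y : V → ℝ) : Prop where
  nonneg : ∀ u v, 0 ≤ f u v
  support : ∀ u v, ¬N.graph.Adj u v → f u v = 0
  netFlow_eq : ∀ v, netFlow f v = N.demand v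
  isPotential : N.IsPotential y
  cost_le : ∑ u, ∑ v, N.cost u v * f u v ≤ (1 + ε) * N.dualValue y

variable {N}

lemma isForward_or_isForward {u v : V} (h : N.graph.Adj u v) :
    N.IsForward u v ∨ N.IsForward v u := by
  have hne : N.ident u ≠ N.ident v := fun h' => h.ne (N.ident_injective h')
  rcases lt_trichotomy (N.cost u v) (N.cost v u) with hc | hc | hc
  · exact Or.inr ⟨h.symm, Or.inl hc⟩
  · rcases lt_or_gt_of_ne hne with hi | hi
    · exact Or.inl ⟨h, Or.inr ⟨hc.symm, hi⟩⟩
    · exact Or.inr ⟨h.symm, Or.inr ⟨hc, hi⟩⟩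
  · exact Or.inl ⟨h, Or.inl hc⟩

lemma not_isForward_of_isForward {u v : V} (h : N.IsForward u v) : ¬N.IsForward v u := by
  rintro ⟨-, h'⟩
  have := h.2
  omega

lemma cost_pos_of_isForward {u v : V} (h : N.IsForward u v) :
    (1 : ℝ) ≤ N.cost u v ∧ (1 : ℝ) ≤ N.cost v u :=
  ⟨by exact_mod_cast N.cost_pos u v h.1, by exact_mod_cast N.cost_pos v u h.1.symm⟩

/-- Exactly one of the two orientations of an edge is its forward arc. -/
lemma sum_sum_eq_sum_edge (F : V → V → ℝ) (hF : ∀ u v, ¬N.graph.Adj u v → F u v = 0) :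
    ∑ u, ∑ v, F u v =
      ∑ e : N.Edge, (F (N.tail e) (N.head e) + F (N.head e) (N.tail e)) := by
  classical
  have h1 : ∀ u v, F u v = (if N.IsForward u v then F u v else 0) +
      if N.IsForward v u then F u v else 0 := fun u v => by
    by_cases h : N.graph.Adj u v
    · rcases isForward_or_isForward h with h' | h' <;>
        simp [h', not_isForward_of_isForward h']
    · simp [hF u v h]
  have h2 : ∀ G : V → V → ℝ, ∑ u, ∑ v, (if N.IsForward u v then G u v else 0) =
      ∑ e : N.Edge, G (N.tail e) (N.head e) := fun G => by
    rw [← Fintype.sum_prod_type' (f := fun u v => if N.IsForward u v then G u v else 0),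
      ← sum_filter]
    exact sum_subtype _ (fun a => by simp) fun a : V × V => G a.1 a.2
  rw [sum_add_distrib, ← h2 F, ← h2 fun u v => F v u]
  have h3 : ∑ u, ∑ v, F u v = ∑ u, ∑ v, ((if N.IsForward u v then F u v else 0) +
      if N.IsForward v u then F u v else 0) :=
    sum_congr rfl fun u _ => sum_congr rfl fun v _ => h1 u v
  rw [h3]
  simp only [sum_add_distrib]
  congr 1
  exact sum_comm

lemma incidence_transpose_mulVec (y : V → ℝ) (e : N.Edge) :
    (N.incidenceᵀ *ᵥ y) e = y (N.head e) - y (N.tail e) := by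
  classical
  simp [mulVec, dotProduct, incidence, sub_mul, sum_sub_distrib]

lemma primalCost_eq (x : N.Edge → ℝ) :
    N.primalCost x = ∑ e, (max 0 (N.wPlus e * x e) + max 0 (-(N.wMinus e * x e))) := by
  classical
  simp [primalCost, pNorm, wStar, fromRows_mulVec, mulVec_diagonal, sum_add_distrib]

lemma one_le_weights (e : N.Edge) : 1 ≤ N.wPlus e ∧ 1 ≤ N.wMinus e := cost_pos_of_isForward e.2

lemma dualFeasible_iff (y : V → ℝ) : N.DualFeasible y ↔ ∀ e : N.Edge,
    y (N.head e) - y (N.tail e) ≤ N.wPlus e ∧ y (N.tail e) - y (N.head e) ≤ N.wMinus e := by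
  classical
  have h0 : ∀ e : N.Edge, 0 < N.wPlus e ∧ 0 < N.wMinus e := fun e =>
    ⟨by linarith [(one_le_weights e).1], by linarith [(one_le_weights e).2]⟩
  have h1 : ∀ e : N.Edge, (N.rStar *ᵥ (N.incidenceᵀ *ᵥ y)) (Sum.inl e) ≤ 1 ↔
      y (N.head e) - y (N.tail e) ≤ N.wPlus e := fun e => by
    simp only [rStar, fromRows_mulVec, Sum.elim_inl, mulVec_diagonal, incidence_transpose_mulVec]
    rw [inv_mul_le_iff₀ (h0 e).1, mul_one]
  have h2 : ∀ e : N.Edge, (N.rStar *ᵥ (N.incidenceᵀ *ᵥ y)) (Sum.inr e) ≤ 1 ↔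
      y (N.tail e) - y (N.head e) ≤ N.wMinus e := fun e => by
    simp only [rStar, fromRows_mulVec, Sum.elim_inr, neg_mulVec, Pi.neg_apply, mulVec_diagonal,
      incidence_transpose_mulVec]
    rw [← mul_neg, neg_sub, inv_mul_le_iff₀ (h0 e).2, mul_one]
  unfold DualFeasible qNorm
  constructor
  · intro h e
    have h3 : ∀ i, (N.rStar *ᵥ (N.incidenceᵀ *ᵥ y)) i ≤ 1 := fun i =>
      (le_max_right 0 _).trans ((le_ciSup (Set.finite_range _).bddAbove i).trans h)
    exact ⟨(h1 e).1 (h3 _), (h2 e).1 (h3 _)⟩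
  · intro h
    refine Real.iSup_le (fun i => max_le zero_le_one ?_) zero_le_one
    rcases i with e | e
    · exact (h1 e).2 (h e).1
    · exact (h2 e).2 (h e).2

lemma IsPotential.dualFeasible {y : V → ℝ} (h : N.IsPotential y) : N.DualFeasible y :=
  (dualFeasible_iff y).2 fun e => ⟨h _ _ e.2.1, h _ _ e.2.1.symm⟩

/-- Weak duality: `bᵀ y = xᵀ (Aᵀ y)` is compared with the cost edge by edge, according to the sign
of the flow. -/
lemma dualValue_le_primalCost {x : N.Edge → ℝ} {y : V → ℝ} (hx : N.PrimalFeasible x)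
    (hy : N.DualFeasible y) : N.dualValue y ≤ N.primalCost x := by
  have h1 : N.dualValue y = ∑ e, x e * (y (N.head e) - y (N.tail e)) := by
    have : N.dualValue y = (N.incidence *ᵥ x) ⬝ᵥ y := by rw [hx]; rfl
    rw [this, dotProduct_comm, dotProduct_mulVec, ← mulVec_transpose, dotProduct_comm]
    exact sum_congr rfl fun e _ => by rw [incidence_transpose_mulVec]
  rw [h1, primalCost_eq]
  refine sum_le_sum fun e _ => ?_
  obtain ⟨hy1, hy2⟩ := (dualFeasible_iff y).1 hy e
  rcases le_total 0 (x e) with h | h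
  · have := le_max_right 0 (N.wPlus e * x e)
    have := le_max_left 0 (-(N.wMinus e * x e))
    nlinarith
  · have := le_max_left 0 (N.wPlus e * x e)
    have := le_max_right 0 (-(N.wMinus e * x e))
    nlinarith

/-- All weights are at least `1`, so the cost dominates the norm of `x`; the sublevel sets of
feasible flows are compact. -/
lemma exists_isOptimum {x₀ : N.Edge → ℝ} (h : N.PrimalFeasible x₀) :
    ∃ opt, N.IsOptimum opt := by
  have hcont : Continuous N.primalCost := by
    rw [show N.primalCost = fun x => ∑ e, (max 0 (N.wPlus e * x e) +
      max 0 (-(N.wMinus e * x e))) from funext primalCost_eq]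
    fun_prop
  have hfeas : IsClosed {x | N.PrimalFeasible x} :=
    isClosed_eq (Continuous.matrix_mulVec continuous_const continuous_id) continuous_const
  set S := {x | N.PrimalFeasible x} ∩ {x | N.primalCost x ≤ N.primalCost x₀}
  have hSclosed : IsClosed S := hfeas.inter (isClosed_le hcont continuous_const)
  have hbound : ∀ x, ‖x‖ ≤ N.primalCost x := fun x => by
    have hterm : ∀ e, |x e| ≤ max 0 (N.wPlus e * x e) + max 0 (-(N.wMinus e * x e)) := fun e => by
      obtain ⟨h1, h2⟩ := one_le_weights e
      rcases le_total 0 (x e) with h | h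
      · rw [abs_of_nonneg h]
        have := le_max_right 0 (N.wPlus e * x e)
        have := le_max_left 0 (-(N.wMinus e * x e))
        nlinarith
      · rw [abs_of_nonpos h]
        have := le_max_left 0 (N.wPlus e * x e)
        have := le_max_right 0 (-(N.wMinus e * x e))
        nlinarith
    have hnn : ∀ e, 0 ≤ max 0 (N.wPlus e * x e) + max 0 (-(N.wMinus e * x e)) := fun e =>
      (abs_nonneg _).trans (hterm e)
    rw [primalCost_eq]
    refine (pi_norm_le_iff_of_nonneg (sum_nonneg fun e _ => hnn e)).2 fun e => ?_
    exact (hterm e).trans (single_le_sum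
      (f := fun e => max 0 (N.wPlus e * x e) + max 0 (-(N.wMinus e * x e)))
      (fun e _ => hnn e) (mem_univ e))
  have hScompact : IsCompact S := by
    refine Metric.isCompact_of_isClosed_isBounded hSclosed ?_
    refine (Metric.isBounded_closedBall (x := (0 : N.Edge → ℝ))
      (r := N.primalCost x₀)).subset fun x hx => ?_
    rw [mem_closedBall_zero_iff]
    exact (hbound x).trans hx.2
  obtain ⟨x, hx, hmin⟩ := hScompact.exists_isMinOn ⟨x₀, h, le_refl (N.primalCost x₀)⟩ hcont.continuousOn
  refine ⟨N.primalCost x, ⟨x, hx.1, rfl⟩, ?_⟩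
  rintro z ⟨x', hx', rfl⟩
  rcases le_total (N.primalCost x') (N.primalCost x₀) with h' | h'
  · exact hmin ⟨hx', h'⟩
  · exact le_trans hx.2 h'

/-- The flow on an edge, signed with respect to its forward orientation. -/
def edgeFlow (f : V → V → ℝ) (e : N.Edge) : ℝ :=
  f (N.tail e) (N.head e) - f (N.head e) (N.tail e)

lemma primalFeasible_edgeFlow {f : V → V → ℝ} (hf : ∀ u v, ¬N.graph.Adj u v → f u v = 0)
    (hb : ∀ v, netFlow f v = N.demand v) : N.PrimalFeasible (edgeFlow f) := by
  classical
  ext v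
  rw [← hb v]
  have h1 := sum_mul_netFlow f fun u => if v = u then 1 else 0
  simp only [ite_mul, one_mul, zero_mul, sum_ite_eq, mem_univ, if_true] at h1
  rw [h1, sum_sum_eq_sum_edge _ fun a b hab => by rw [hf a b hab, zero_mul]]
  simp only [mulVec, dotProduct, incidence, edgeFlow]
  exact sum_congr rfl fun e _ => by ring

/-- Cancelling opposite flows on an edge does not increase the cost. -/
lemma primalCost_edgeFlow_le {f : V → V → ℝ} (h0 : ∀ u v, 0 ≤ f u v)
    (hf : ∀ u v, ¬N.graph.Adj u v → f u v = 0) :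
    N.primalCost (edgeFlow f) ≤ ∑ u, ∑ v, N.cost u v * f u v := by
  rw [sum_sum_eq_sum_edge _ fun a b hab => by rw [hf a b hab, mul_zero], primalCost_eq]
  refine sum_le_sum fun e _ => ?_
  obtain ⟨h1, h2⟩ := one_le_weights e
  have h3 := h0 (N.tail e) (N.head e)
  have h4 := h0 (N.head e) (N.tail e)
  change _ ≤ N.wPlus e * _ + N.wMinus e * _
  simp only [edgeFlow]
  refine add_le_add (max_le (by positivity) ?_) (max_le (by positivity) ?_) <;> nlinarith

/-- If the nodes know a pair of an approximate flow and an approximate potential, then this is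
an approximate solution. -/
theorem IsApproxPair.isApproximation {ε : ℝ} {f : V → V → ℝ} {y : V → ℝ}
    (h : N.IsApproxPair ε f y) (hε : 0 ≤ ε) {out : V → NodeOutput}
    (hval : ∀ v, (out v).value = (1 + ε) * N.dualValue y) (hpot : ∀ v, (out v).potential = y v)
    (hflow : ∀ u v, N.IsForward u v → (out u).flow (N.ident v) = f u v - f v u ∧
      (out v).flow (N.ident u) = f u v - f v u) : N.IsApproximation ε out := by
  have hx := primalFeasible_edgeFlow h.support h.netFlow_eq
  have hy := h.isPotential.dualFeasible
  have hcost := (primalCost_edgeFlow_le h.nonneg h.support).trans h.cost_le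
  obtain ⟨opt, hopt⟩ := exists_isOptimum hx
  refine ⟨⟨opt, hopt, fun v => ?_⟩, edgeFlow f, y, fun e => hflow _ _ e.2, hpot, hx, hy, hcost⟩
  -- The optimum is at most the cost of the flow, this is at most `(1 + ε) * bᵀ y`, and `bᵀ y` is at
  -- most the optimum.
  rw [hval v]
  refine ⟨(hopt.2 ⟨_, hx, rfl⟩).trans hcost, ?_⟩
  obtain ⟨x', hx', rfl⟩ := hopt.1
  exact mul_le_mul_of_nonneg_left (dualValue_le_primalCost hx' hy) (by linarith)

end Network

/-! ### Bounds for polynomially bounded instances, and approximate duality. -/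

namespace Network

variable {V : Type} [Fintype V] {N : Network V} {c : ℕ}

variable (V) in
/-- The number of bits of the number of nodes. -/
def bitLength : ℕ := Nat.log 2 (Fintype.card V) + 1

lemma card_lt_two_pow_bitLength : Fintype.card V < 2 ^ bitLength V :=
  Nat.lt_pow_succ_log_self one_lt_two _

lemma card_pow_le (c : ℕ) : Fintype.card V ^ c ≤ 2 ^ (c * bitLength V) := by
  rw [mul_comm, pow_mul]
  exact Nat.pow_le_pow_left card_lt_two_pow_bitLength.le c

lemma card_le_real : (Fintype.card V : ℝ) ≤ 2 ^ bitLength V := by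
  exact_mod_cast (card_lt_two_pow_bitLength (V := V)).le

lemma PolyBounded.cost_le (h : N.PolyBounded c) {u v : V} (huv : N.graph.Adj u v) :
    N.cost u v ≤ 2 ^ (c * bitLength V) := (h.2.1 u v huv).trans (card_pow_le c)

lemma PolyBounded.cost_le_real (h : N.PolyBounded c) {u v : V} (huv : N.graph.Adj u v) :
    (N.cost u v : ℝ) ≤ 2 ^ (c * bitLength V) := by
  exact_mod_cast h.cost_le huv

lemma PolyBounded.ident_le (h : N.PolyBounded c) (v : V) :
    N.ident v ≤ 2 ^ (c * bitLength V) := (h.1 v).trans (card_pow_le c)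

lemma PolyBounded.abs_demand_le (h : N.PolyBounded c) (v : V) :
    |N.demand v| ≤ 2 ^ (c * bitLength V) :=
  (h.2.2 v).trans (by exact_mod_cast card_pow_le c)

/-- Add up the cost bounds along a path, which has fewer than `n` edges. -/
lemma IsPotential.sub_le {y : V → ℝ} (h : N.IsPotential y) (hN : N.PolyBounded c) (u v : V) :
    y v - y u ≤ 2 ^ ((c + 1) * bitLength V) := by
  have hwalk : ∀ {u v : V} (p : N.graph.Walk u v),
      y v - y u ≤ p.length * 2 ^ (c * bitLength V) := by
    intro u v p
    induction p with
    | nil => simp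
    | cons hadj p ih =>
      have h1 := (h _ _ hadj).trans (hN.cost_le_real hadj)
      simp only [SimpleGraph.Walk.length_cons, Nat.cast_add, Nat.cast_one]
      linarith
  obtain ⟨p, hp⟩ := (N.connected u v).exists_isPath
  refine (hwalk p).trans ?_
  rw [add_mul, one_mul, add_comm, pow_add]
  refine mul_le_mul_of_nonneg_right ?_ (by positivity)
  refine le_trans ?_ card_le_real
  exact_mod_cast hp.length_lt.le

/-- As the total demand is zero, the potential may be shifted to vanish at a node `r`. This bound
ends the scan over the target values. -/
lemma IsPotential.dualValue_le {y : V → ℝ} (h : N.IsPotential y) (hN : N.PolyBounded c) :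
    N.dualValue y ≤ 2 ^ ((2 * c + 2) * bitLength V) := by
  obtain ⟨r⟩ := N.connected.nonempty
  have h1 : N.dualValue y = ∑ v, (N.demand v : ℝ) * (y v - y r) := by
    have : ∑ v, (N.demand v : ℝ) = 0 := by exact_mod_cast N.sum_demand
    simp only [mul_sub, sum_sub_distrib, ← sum_mul, this, zero_mul, sub_zero, dualValue]
  have h2 : ∀ v, (N.demand v : ℝ) * (y v - y r) ≤
      2 ^ (c * bitLength V) * 2 ^ ((c + 1) * bitLength V) := fun v => by
    refine (le_abs_self _).trans ?_
    rw [abs_mul]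
    refine mul_le_mul (by exact_mod_cast hN.abs_demand_le v) ?_ (abs_nonneg _) (by positivity)
    rw [abs_le]
    have := h.sub_le hN r v
    have := h.sub_le hN v r
    constructor <;> linarith
  rw [h1]
  refine (sum_le_sum fun v _ => h2 v).trans ?_
  rw [sum_const, nsmul_eq_mul, card_univ]
  calc (Fintype.card V : ℝ) * (2 ^ (c * bitLength V) * 2 ^ ((c + 1) * bitLength V))
      ≤ 2 ^ bitLength V * (2 ^ (c * bitLength V) * 2 ^ ((c + 1) * bitLength V)) :=
        mul_le_mul_of_nonneg_right card_le_real (by positivity)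
    _ = 2 ^ ((2 * c + 2) * bitLength V) := by ring

/-- The potential that is `1` at the nodes with positive demand and `0` elsewhere. -/
lemma isPotential_indicator :
    N.IsPotential fun v => if 0 < N.demand v then 1 else 0 := by
  intro u v huv
  have : (1 : ℝ) ≤ N.cost u v := by exact_mod_cast N.cost_pos u v huv
  dsimp only
  split_ifs <;> linarith

/-- Demands are integral with sum zero, so some demand is at least `1`. This supplies the first
target value of the scan. -/
lemma one_le_dualValue_indicator (h : ∃ v, N.demand v ≠ 0) :
    1 ≤ N.dualValue fun v => if 0 < N.demand v then 1 else 0 := by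
  have hnn : ∀ v, 0 ≤ N.demand v * (if 0 < N.demand v then 1 else 0) := fun v => by
    split_ifs with h
    · omega
    · simp
  obtain ⟨v, hv⟩ : ∃ v, 0 < N.demand v := by
    by_contra! hcon
    obtain ⟨v, hv⟩ := h
    have := sum_lt_sum (s := univ) (fun v _ => hcon v)
      ⟨v, mem_univ v, lt_of_le_of_ne (hcon v) hv⟩
    rw [N.sum_demand] at this
    simp at this
  have h1 : 1 ≤ ∑ v, N.demand v * (if 0 < N.demand v then 1 else 0) := by
    refine le_trans ?_ (single_le_sum (fun v _ => hnn v) (mem_univ v))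
    rw [if_pos hv]
    omega
  unfold dualValue
  beta_reduce
  exact_mod_cast h1

lemma isApproxPair_zero {ε : ℝ} (h : ∀ v, N.demand v = 0) :
    N.IsApproxPair ε (fun _ _ => 0) fun _ => 0 where
  nonneg _ _ := le_rfl
  support _ _ _ := rfl
  netFlow_eq v := by simp [netFlow, h v]
  isPotential u v _ := by simp
  cost_le := by simp [dualValue]

/-- Approximate linear programming duality. -/
theorem exists_isApproxPair (hN : N.PolyBounded c) {ε : ℝ} (hε : 0 < ε) :
    ∃ f y, N.IsApproxPair ε f y := by
  by_cases h : ∃ v, N.demand v ≠ 0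
  · set S : Set ℝ := N.dualValue '' {y | N.IsPotential y}
    have hbdd : BddAbove S := ⟨2 ^ ((2 * c + 2) * bitLength V), by
      rintro _ ⟨y, hy, rfl⟩
      exact hy.dualValue_le hN⟩
    have hind : N.dualValue (fun v => if 0 < N.demand v then 1 else 0) ∈ S :=
      ⟨_, isPotential_indicator, rfl⟩
    have hpos : 0 < sSup S :=
      lt_of_lt_of_le zero_lt_one ((one_le_dualValue_indicator h).trans (le_csSup hbdd hind))
    have hlt : sSup S / (1 + ε) < sSup S := by
      rw [div_lt_iff₀ (by linarith)]
      nlinarith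
    obtain ⟨_, ⟨y, hy, rfl⟩, hlt'⟩ := exists_lt_of_lt_csSup ⟨_, hind⟩ hlt
    rw [div_lt_iff₀ (by linarith)] at hlt'
    -- The value of `y` is so close to the supremum that no potential exceeds the budget `(1 + ε) *
    -- bᵀ y`; hence the alternative must produce a flow.
    have hτ : 0 < (1 + ε) * N.dualValue y := by linarith
    rcases exists_flow_or_potential N.graph.Adj (fun u v => (N.cost u v : ℝ))
      (fun u v huv => by exact_mod_cast N.cost_pos u v huv) (fun v => (N.demand v : ℝ)) hτ with
      ⟨f, h0, h1, h2, h3⟩ | ⟨φ, h1, h2⟩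
    · exact ⟨f, y, h0, h1, h3, hy, h2⟩
    · have : N.dualValue φ ≤ sSup S := le_csSup hbdd ⟨φ, h1, rfl⟩
      change _ < N.dualValue φ at h2
      linarith
  · push Not at h
    exact ⟨_, _, isApproxPair_zero h⟩

end Network

/-! ### Hitting sets and representatives -/

/-- A counting form of the probabilistic method: a uniformly random `T ⊆ U` misses a given `S i`
with probability at most `2 ^ (-d)`, and so does its complement. As `2 * |I| < 2 ^ d`, for some `T`
both `T` and `U \ T` hit every `S i`; take the smaller one. -/
lemma exists_small_hittingSet {α ι : Type} [DecidableEq α] (U : Finset α) (I : Finset ι)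
    (S : ι → Finset α) {d : ℕ} (hS : ∀ i ∈ I, S i ⊆ U ∧ d ≤ (S i).card)
    (hI : 2 * I.card < 2 ^ d) :
    ∃ T ⊆ U, 2 * T.card ≤ U.card ∧ ∀ i ∈ I, ∃ x ∈ S i, x ∈ T := by
  classical
  rcases I.eq_empty_or_nonempty with rfl | ⟨i₀, hi₀⟩
  · exact ⟨∅, by simp, by simp, by simp⟩
  have hdU : d ≤ U.card := (hS i₀ hi₀).2.trans (card_le_card (hS i₀ hi₀).1)
  set bad : Finset (Finset α) :=
    I.biUnion fun i => (U \ S i).powerset ∪ ((U \ S i).powerset).image (U \ ·) with hbad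
  have hlt : bad.card < U.powerset.card := by
    have h1 : bad.card ≤ I.card * (2 * 2 ^ (U.card - d)) := by
      refine card_biUnion_le_card_mul _ _ _ fun i hi => ?_
      have h2 : (U \ S i).powerset.card ≤ 2 ^ (U.card - d) := by
        rw [card_powerset]
        refine Nat.pow_le_pow_right two_pos ?_
        rw [card_sdiff_of_subset (hS i hi).1]
        have := (hS i hi).2
        omega
      refine (card_union_le _ _).trans ?_
      have := card_image_le (s := (U \ S i).powerset) (f := (U \ ·))
      omega
    rw [card_powerset]
    calc bad.card ≤ 2 * I.card * 2 ^ (U.card - d) := by rw [mul_comm 2, mul_assoc]; exact h1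
      _ < 2 ^ d * 2 ^ (U.card - d) := Nat.mul_lt_mul_of_pos_right hI (by positivity)
      _ = 2 ^ U.card := by rw [← pow_add]; congr 1; omega
  obtain ⟨T, hTU, hT⟩ := exists_mem_notMem_of_card_lt_card hlt
  rw [mem_powerset] at hTU
  simp only [hbad, mem_biUnion, mem_union, mem_powerset, mem_image, not_exists, not_and,
    not_or] at hT
  have hhit : ∀ i ∈ I, (∃ x ∈ S i, x ∈ T) ∧ ∃ x ∈ S i, x ∈ U \ T := by
    intro i hi
    obtain ⟨h1, h2⟩ := hT i hi
    constructor
    · by_contra! hcon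
      exact h1 fun x hx => mem_sdiff.2 ⟨hTU hx, fun hx' => hcon x hx' hx⟩
    · by_contra! hcon
      refine h2 (U \ T) (fun x hx => mem_sdiff.2 ⟨(mem_sdiff.1 hx).1, fun hx' =>
        hcon x hx' hx⟩) ?_
      exact _root_.sdiff_sdiff_eq_self hTU
  by_cases hc : 2 * T.card ≤ U.card
  · exact ⟨T, hTU, hc, fun i hi => (hhit i hi).1⟩
  · refine ⟨U \ T, sdiff_subset, ?_, fun i hi => (hhit i hi).2⟩
    rw [card_sdiff_of_subset hTU]
    omega

lemma exists_representatives {α β : Type} [DecidableEq β] (A : Finset α) (f : α → β) (d : ℕ) :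
    ∃ S ⊆ A, Set.InjOn f S ∧ S.card ≤ d ∧ (S.card = d ∨ ∀ a ∈ A, ∃ s ∈ S, f s = f a) := by
  classical
  obtain ⟨S, hSA, hinj, himg⟩ : ∃ S ⊆ A, Set.InjOn f S ∧ ∀ a ∈ A, ∃ s ∈ S, f s = f a := by
    obtain ⟨S, hSA, hbij⟩ := Set.exists_subset_bijOn (A : Set α) f
    have hfin : S.Finite := A.finite_toSet.subset hSA
    refine ⟨hfin.toFinset, by simpa [← coe_subset] using hSA, by simpa using hbij.injOn,
      fun a ha => ?_⟩
    obtain ⟨s, hs, hsa⟩ := hbij.surjOn ⟨a, ha, rfl⟩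
    exact ⟨s, by simpa using hs, hsa⟩
  rcases le_total S.card d with h | h
  · exact ⟨S, hSA, hinj, h, Or.inr himg⟩
  · obtain ⟨S', hS', hcard⟩ := exists_subset_card_eq h
    exact ⟨S', hS'.trans hSA, hinj.mono (by exact_mod_cast hS'), hcard.le, Or.inl hcard⟩

/-- At most `d` elements of `A` with distinct values of `f`, which attain all values of `f` on `A`
unless there are `d` of them. -/
def representatives {α β : Type} [DecidableEq β] (A : Finset α) (f : α → β) (d : ℕ) : Finset α :=
  (exists_representatives A f d).choose

lemma representatives_spec {α β : Type} [DecidableEq β] (A : Finset α) (f : α → β) (d : ℕ) :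
    representatives A f d ⊆ A ∧ Set.InjOn f (representatives A f d) ∧
      (representatives A f d).card ≤ d ∧ ((representatives A f d).card = d ∨
        ∀ a ∈ A, ∃ s ∈ representatives A f d, f s = f a) :=
  (exists_representatives A f d).choose_spec

/-! ### A sparse subgraph that preserves distances -/

/-- A clustering of the nodes for each class of edges, where the edges of class `j` have costs between
`2 ^ j` and `2 ^ (j + 1)` in their cheaper direction, and the edges selected so far (class,
selecting node, neighbor). -/
structure Clustering where
  cluster : ℕ → ℕ → Option ℕ
  selected : ℕ → ℕ → ℕ → Prop

open Classical in
/-- The identifiers of the neighbors by edges of class `j` that belong to a cluster. -/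
def LocalInput.clusteredNeighbors (inp : LocalInput) (s : Clustering) (j : ℕ) : Finset ℕ :=
  (inp.incident.filter fun a => Nat.log 2 (min a.2.1 a.2.2) = j ∧
    (s.cluster j a.1).isSome).image fun a => a.1

open Classical in
/-- The edges that a node selects, one for each of at most `d` adjacent clusters. -/
def Clustering.post (s : Clustering) (J d : ℕ) (inp : LocalInput) : Finset ℕ :=
  (range J).biUnion fun j =>
    if (s.cluster j inp.ident).isSome then
      (representatives (inp.clusteredNeighbors s j) (s.cluster j) d).image (Nat.pair j)
    else ∅

/-- The neighbors selected in class `j` by node `i`. -/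
def selectedNeighbors (board : Finset ℕ) (j i : ℕ) : Finset ℕ :=
  ((contents board i).filter fun a => a.unpair.1 = j).image fun a => a.unpair.2

lemma mem_selectedNeighbors {board : Finset ℕ} {j i a : ℕ} :
    a ∈ selectedNeighbors board j i ↔ Nat.pair j a ∈ contents board i := by
  simp only [selectedNeighbors, mem_image, mem_filter]
  constructor
  · rintro ⟨x, ⟨hx, rfl⟩, rfl⟩
    simpa using hx
  · exact fun h => ⟨_, ⟨h, by simp⟩, by simp⟩

/-- The clusters of class `j`. -/
def Clustering.clusters (s : Clustering) (ids : Finset ℕ) (j : ℕ) : Finset ℕ :=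
  ids.biUnion fun i => (s.cluster j i).toFinset

lemma Clustering.mem_clusters {s : Clustering} {ids : Finset ℕ} {j k : ℕ} :
    k ∈ s.clusters ids j ↔ ∃ i ∈ ids, s.cluster j i = some k := by
  simp [Clustering.clusters]

/-- `T` contains at most half of the clusters of class `j`, and it contains a neighboring cluster of
each node that has selected `d` edges. -/
def Clustering.IsSample (s : Clustering) (ids : Finset ℕ) (d : ℕ) (board : Finset ℕ) (j : ℕ)
    (T : Finset ℕ) : Prop :=
  T ⊆ s.clusters ids j ∧ 2 * T.card ≤ (s.clusters ids j).card ∧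
    ∀ i ∈ ids, (selectedNeighbors board j i).card = d →
      ∃ a ∈ selectedNeighbors board j i, ∃ k ∈ T, s.cluster j a = some k

-- This replaces the random sampling of clusters in the construction of Baswana and Sen. It depends
-- on public data only, so all nodes make the same choice; the default `∅` never occurs
-- (`isSample_sample`).
open Classical in
def Clustering.sample (s : Clustering) (ids : Finset ℕ) (d : ℕ) (board : Finset ℕ) (j : ℕ) :
    Finset ℕ :=
  if h : ∃ T, s.IsSample ids d board j T then h.choose else ∅

open Classical in
/-- The nodes of the sampled clusters stay in their clusters, the other nodes join an adjacent sampled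
cluster along a selected edge, if there is one. -/
def Clustering.next (s : Clustering) (ids : Finset ℕ) (d : ℕ) (board : Finset ℕ) : Clustering where
  cluster j i :=
    if (∃ k ∈ s.sample ids d board j, s.cluster j i = some k) ∨ s.cluster j i = none then
      s.cluster j i
    else if h : ∃ a ∈ selectedNeighbors board j i, ∃ k ∈ s.sample ids d board j,
      s.cluster j a = some k then s.cluster j h.choose
    else none
  selected j i a := s.selected j i a ∨ (i ∈ ids ∧ a ∈ selectedNeighbors board j i)

/-- The program that selects the edges of the sparse subgraph. -/
def sparsify (ids : Finset ℕ) (J l : ℕ) : Prog Clustering :=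
  -- With `n < 2 ^ l`, selecting `l + 1` edges satisfies the hypothesis `2 * n < 2 ^ d` of the
  -- hitting set lemma, and `l` halvings leave no cluster.
  Prog.iter (fun _ s => .ask (s.post J (l + 1)) fun board => .pure (s.next ids (l + 1) board)) l
    ⟨fun _ i => some i, fun _ _ _ => False⟩

/-- The potential differences along the selected edges are at most the costs of their classes. -/
def Clustering.Respects (s : Clustering) (φ : ℕ → ℝ) : Prop :=
  ∀ j u v, s.selected j u v → |φ u - φ v| ≤ 2 ^ j

namespace Network

variable {V : Type} [Fintype V] {N : Network V} {ε : ℝ} {c : ℕ}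

lemma mem_incident {v : V} {a : ℕ × ℕ × ℕ} : a ∈ (N.localInput ε v).incident ↔
    ∃ u, N.graph.Adj v u ∧ a = (N.ident u, N.cost v u, N.cost u v) := by
  classical
  simp only [localInput, mem_image, mem_filter, mem_univ, true_and]
  exact ⟨fun ⟨u, h, e⟩ => ⟨u, h, e.symm⟩, fun ⟨u, h, e⟩ => ⟨u, h, e.symm⟩⟩

variable (N) in
/-- The class of an edge. -/
def edgeClass (u v : V) : ℕ := Nat.log 2 (min (N.cost u v) (N.cost v u))

lemma edgeClass_comm (u v : V) : N.edgeClass u v = N.edgeClass v u := by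
  rw [edgeClass, min_comm, edgeClass]

lemma two_pow_edgeClass_le {u v : V} (h : N.graph.Adj u v) :
    2 ^ N.edgeClass u v ≤ min (N.cost u v) (N.cost v u) :=
  Nat.pow_log_le_self 2 (by have := N.cost_pos u v h; have := N.cost_pos v u h.symm; omega)

lemma min_cost_lt {u v : V} :
    min (N.cost u v) (N.cost v u) < 2 ^ (N.edgeClass u v + 1) :=
  Nat.lt_pow_succ_log_self one_lt_two _

lemma PolyBounded.edgeClass_lt (hN : N.PolyBounded c) {u v : V} (h : N.graph.Adj u v) :
    N.edgeClass u v < c * bitLength V + 1 := by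
  have h1 := (two_pow_edgeClass_le h).trans ((min_le_left _ _).trans (hN.cost_le h))
  have := (Nat.pow_le_pow_iff_right one_lt_two).1 h1
  omega

lemma mem_clusteredNeighbors {s : Clustering} {j a : ℕ} {v : V} :
    a ∈ (N.localInput ε v).clusteredNeighbors s j ↔
      ∃ u, N.graph.Adj v u ∧ N.edgeClass v u = j ∧ (s.cluster j (N.ident u)).isSome ∧
        a = N.ident u := by
  classical
  simp only [LocalInput.clusteredNeighbors, mem_image, mem_filter, mem_incident]
  constructor
  · rintro ⟨_, ⟨⟨u, hu, rfl⟩, h1, h2⟩, rfl⟩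
    exact ⟨u, hu, h1, h2, rfl⟩
  · rintro ⟨u, hu, h1, h2, rfl⟩
    exact ⟨_, ⟨⟨u, hu, rfl⟩, h1, h2⟩, rfl⟩

lemma selectedNeighbors_board {s : Clustering} {J d j : ℕ} (v : V) :
    selectedNeighbors (N.board ε (s.post J d)) j (N.ident v) =
      if j < J ∧ (s.cluster j (N.ident v)).isSome then
        representatives ((N.localInput ε v).clusteredNeighbors s j) (s.cluster j) d
      else ∅ := by
  classical
  ext a
  rw [mem_selectedNeighbors, contents_board]
  have hid : (N.localInput ε v).ident = N.ident v := rfl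
  simp only [Clustering.post, mem_biUnion, mem_range, hid]
  constructor
  · rintro ⟨j', hj', h⟩
    split_ifs at h with h1
    · obtain ⟨a', ha', he⟩ := mem_image.1 h
      obtain ⟨rfl, rfl⟩ := Nat.pair_eq_pair.1 he
      rw [if_pos ⟨hj', h1⟩]
      convert ha'
    · simp at h
  · intro h
    split_ifs at h with h1
    · refine ⟨j, h1.1, ?_⟩
      rw [if_pos h1.2]
      refine mem_image_of_mem _ ?_
      convert h
    · simp at h

/-- The invariant of the construction of the sparse subgraph. -/
structure ClusteringInvariant (N : Network V) (i : ℕ) (s : Clustering) : Prop where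
  isEdge : ∀ j a b, s.selected j a b →
    ∃ u v, a = N.ident u ∧ b = N.ident v ∧ N.graph.Adj u v ∧ N.edgeClass u v = j
  -- Distances are expressed in dual form, through all potentials that respect the selected edges;
  -- `k` is the center of the cluster.
  radius : ∀ φ, s.Respects φ → ∀ j v k, s.cluster j (N.ident v) = some k →
    |φ (N.ident v) - φ k| ≤ i * 2 ^ j
  -- Either the edge is still undecided, both ends being clustered in its class, or its stretch is
  -- already bounded.
  stretch : ∀ φ, s.Respects φ → ∀ u v, N.graph.Adj u v →
    ((s.cluster (N.edgeClass u v) (N.ident u)).isSome ∧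
      (s.cluster (N.edgeClass u v) (N.ident v)).isSome) ∨
    |φ (N.ident u) - φ (N.ident v)| ≤ (2 * i + 1) * 2 ^ N.edgeClass u v
  card_le : ∀ j, (s.clusters (univ.image N.ident) j).card * 2 ^ i ≤ Fintype.card V

lemma clusteringInvariant_zero :
    N.ClusteringInvariant 0 ⟨fun _ i => some i, fun _ _ _ => False⟩ where
  isEdge _ _ _ h := h.elim
  radius φ _ j v k h := by
    obtain rfl := Option.some.inj h
    simp
  stretch _ _ u v _ := Or.inl ⟨rfl, rfl⟩
  card_le j := by
    rw [pow_zero, mul_one]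
    refine (card_le_card (t := univ.image N.ident) fun k hk => ?_).trans card_image_le
    obtain ⟨i, hi, h⟩ := Clustering.mem_clusters.1 hk
    obtain rfl := Option.some.inj h
    exact hi

end Network

namespace Network

variable {V : Type} [Fintype V] {N : Network V} {ε : ℝ} {c : ℕ}

lemma of_mem_selectedNeighbors {s : Clustering} {J d j a : ℕ} {v : V}
    (h : a ∈ selectedNeighbors (N.board ε (s.post J d)) j (N.ident v)) :
    ∃ u, a = N.ident u ∧ N.graph.Adj v u ∧ N.edgeClass v u = j ∧
      (s.cluster j (N.ident u)).isSome := by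
  rw [selectedNeighbors_board] at h
  split_ifs at h
  · obtain ⟨u, h1, h2, h3, rfl⟩ := mem_clusteredNeighbors.1 ((representatives_spec _ _ _).1 h)
    exact ⟨u, rfl, h1, h2, h3⟩
  · simp at h

/-- Each node with `d` selected edges has `d` distinct adjacent clusters, because representatives
have distinct clusters; the hitting set lemma applies to these sets of clusters. -/
lemma isSample_sample {s : Clustering} {J : ℕ} (j : ℕ) :
    s.IsSample (univ.image N.ident) (bitLength V + 1)
      (N.board ε (s.post J (bitLength V + 1))) j
      (s.sample (univ.image N.ident) (bitLength V + 1)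
        (N.board ε (s.post J (bitLength V + 1))) j) := by
  classical
  set d := bitLength V + 1
  set board := N.board ε (s.post J d)
  have hex : ∃ T, s.IsSample (univ.image N.ident) d board j T := by
    obtain ⟨T, h1, h2, h3⟩ := exists_small_hittingSet (s.clusters (univ.image N.ident) j)
      ((univ.image N.ident).filter fun i => (selectedNeighbors board j i).card = d)
      (fun i => (selectedNeighbors board j i).image fun a => (s.cluster j a).getD 0) (d := d)
      (fun i hi => by
        obtain ⟨hi, hcard⟩ := mem_filter.1 hi
        obtain ⟨v, -, rfl⟩ := mem_image.1 hi
        constructor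
        · intro k hk
          obtain ⟨a, ha, rfl⟩ := mem_image.1 hk
          obtain ⟨u, rfl, -, -, hu⟩ := of_mem_selectedNeighbors ha
          obtain ⟨k, hk⟩ := Option.isSome_iff_exists.1 hu
          rw [hk]
          exact Clustering.mem_clusters.2 ⟨_, mem_image_of_mem _ (mem_univ u), hk⟩
        · rw [card_image_of_injOn, hcard]
          have hinj : Set.InjOn (s.cluster j) (selectedNeighbors board j (N.ident v)) := by
            rw [selectedNeighbors_board]
            split_ifs
            · exact (representatives_spec _ _ _).2.1
            · simp
          intro a ha b hb hab
          refine hinj ha hb ?_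
          obtain ⟨u, rfl, -, -, hu⟩ := of_mem_selectedNeighbors ha
          obtain ⟨w, rfl, -, -, hw⟩ := of_mem_selectedNeighbors hb
          obtain ⟨k, hk⟩ := Option.isSome_iff_exists.1 hu
          obtain ⟨k', hk'⟩ := Option.isSome_iff_exists.1 hw
          simp only [hk, hk', Option.getD_some] at hab
          rw [hk, hk', hab])
      (by
        have h1 := (card_filter_le (univ.image N.ident)
          fun i => (selectedNeighbors board j i).card = d).trans card_image_le
        have h2 : Fintype.card V < 2 ^ bitLength V := card_lt_two_pow_bitLength
        rw [card_univ] at h1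
        rw [pow_succ]
        omega)
    refine ⟨T, h1, h2, fun i hi hcard => ?_⟩
    obtain ⟨k, hk, hkT⟩ := h3 i (mem_filter.2 ⟨hi, hcard⟩)
    obtain ⟨a, ha, rfl⟩ := mem_image.1 hk
    obtain ⟨v, -, rfl⟩ := mem_image.1 hi
    obtain ⟨u, rfl, -, -, hu⟩ := of_mem_selectedNeighbors ha
    obtain ⟨k, hk⟩ := Option.isSome_iff_exists.1 hu
    rw [hk] at hkT
    exact ⟨_, ha, k, hkT, hk⟩
  rw [Clustering.sample, dif_pos hex]
  exact hex.choose_spec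

/-- A node that drops out of the clustering has no sampled neighboring cluster, so by the choice of
the sample it has selected fewer than `d` edges, hence one to every adjacent cluster. This settles
all its undecided edges of the class. -/
lemma ClusteringInvariant.next {i : ℕ} {s : Clustering} (h : N.ClusteringInvariant i s)
    (hN : N.PolyBounded c) :
    N.ClusteringInvariant (i + 1) (s.next (univ.image N.ident) (bitLength V + 1)
      (N.board ε (s.post (c * bitLength V + 1) (bitLength V + 1)))) := by
  classical
  set d := bitLength V + 1
  set J := c * bitLength V + 1 with hJ
  set board := N.board ε (s.post J d)
  set ids := univ.image N.ident with hids
  have hmem : ∀ v, N.ident v ∈ ids := fun v => mem_image_of_mem _ (mem_univ v)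
  have hsample : ∀ j, s.IsSample ids d board j (s.sample ids d board j) := fun j =>
    isSample_sample j
  have hresp : ∀ φ, (s.next ids d board).Respects φ → s.Respects φ :=
    fun φ hφ j u v huv => hφ j u v (Or.inl huv)
  have hcluster : ∀ j v k, (s.next ids d board).cluster j (N.ident v) = some k →
      k ∈ s.sample ids d board j ∧ (s.cluster j (N.ident v) = some k ∨
        ∃ a ∈ selectedNeighbors board j (N.ident v), s.cluster j a = some k) := by
    intro j v k hk
    simp only [Clustering.next] at hk
    split_ifs at hk with h1 h2
    · refine ⟨?_, Or.inl hk⟩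
      rcases h1 with ⟨k', hk', h1⟩ | h1
      · rw [h1] at hk
        exact Option.some.inj hk ▸ hk'
      · simp [h1] at hk
    · obtain ⟨h3, k', hk', h4⟩ := h2.choose_spec
      refine ⟨?_, Or.inr ⟨_, h3, hk⟩⟩
      rw [h4] at hk
      exact Option.some.inj hk ▸ hk'
  have hnone : ∀ j v, (s.cluster j (N.ident v)).isSome →
      (s.next ids d board).cluster j (N.ident v) = none →
      (selectedNeighbors board j (N.ident v)).card ≠ d := by
    intro j v hv hk hcard
    obtain ⟨a, ha, k, hkT, hak⟩ := (hsample j).2.2 _ (hmem v) hcard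
    have hex : ∃ a ∈ selectedNeighbors board j (N.ident v), ∃ k ∈ s.sample ids d board j,
      s.cluster j a = some k := ⟨a, ha, k, hkT, hak⟩
    simp only [Clustering.next] at hk
    split_ifs at hk with h1
    · rw [hk] at hv
      simp at hv
    · obtain ⟨-, k', -, h4⟩ := hex.choose_spec
      rw [h4] at hk
      simp at hk
  have hstretch : ∀ φ, (s.next ids d board).Respects φ → ∀ u v, N.graph.Adj u v →
      (s.cluster (N.edgeClass u v) (N.ident u)).isSome →
      (s.cluster (N.edgeClass u v) (N.ident v)).isSome →
      (s.next ids d board).cluster (N.edgeClass u v) (N.ident u) = none →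
      |φ (N.ident u) - φ (N.ident v)| ≤ (2 * i + 1) * 2 ^ N.edgeClass u v := by
    intro φ hφ u v huv hu hv hk
    have hcard := hnone _ u hu hk
    have hnb : N.ident v ∈ (N.localInput ε u).clusteredNeighbors s (N.edgeClass u v) :=
      mem_clusteredNeighbors.2 ⟨v, huv, rfl, hv, rfl⟩
    obtain ⟨a, ha, hav⟩ : ∃ a ∈ selectedNeighbors board (N.edgeClass u v) (N.ident u),
        s.cluster (N.edgeClass u v) a = s.cluster (N.edgeClass u v) (N.ident v) := by
      rw [selectedNeighbors_board, if_pos ⟨hN.edgeClass_lt huv, hu⟩] at hcard ⊢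
      exact (representatives_spec _ _ _).2.2.2.resolve_left hcard _ hnb
    obtain ⟨w, rfl, -, -, -⟩ := of_mem_selectedNeighbors ha
    obtain ⟨k, hvk⟩ := Option.isSome_iff_exists.1 hv
    -- The detour from `u` to `v` uses the selected edge to `w`, then goes via the center `k` of the
    -- common cluster: `1 + i + i` units of `2 ^ j`.
    have h1 := hφ _ _ _ (Or.inr ⟨hmem u, ha⟩)
    have h2 := h.radius φ (hresp φ hφ) _ w k (hav.trans hvk)
    have h3 := h.radius φ (hresp φ hφ) _ v k hvk
    rw [abs_le] at h1 h2 h3 ⊢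
    constructor <;> linarith
  refine ⟨?_, ?_, ?_, ?_⟩
  · rintro j a b (hab | ⟨ha, hb⟩)
    · exact h.isEdge j a b hab
    · obtain ⟨u, -, rfl⟩ := mem_image.1 ha
      obtain ⟨v, rfl, h1, h2, -⟩ := of_mem_selectedNeighbors hb
      exact ⟨u, v, rfl, rfl, h1, h2⟩
  · intro φ hφ j v k hk
    have hpos : (0 : ℝ) < 2 ^ j := by positivity
    push_cast
    rcases (hcluster j v k hk).2 with h1 | ⟨a, ha, h1⟩
    · have := h.radius φ (hresp φ hφ) j v k h1
      linarith
    · obtain ⟨u, rfl, -, -, -⟩ := of_mem_selectedNeighbors ha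
      have h2 := hφ _ _ _ (Or.inr ⟨hmem v, ha⟩)
      have h3 := h.radius φ (hresp φ hφ) j u k h1
      rw [abs_le] at h2 h3 ⊢
      constructor <;> linarith
  · intro φ hφ u v huv
    have hpos : (0 : ℝ) < 2 ^ N.edgeClass u v := by positivity
    have hmono : |φ (N.ident u) - φ (N.ident v)| ≤ (2 * i + 1) * 2 ^ N.edgeClass u v →
        |φ (N.ident u) - φ (N.ident v)| ≤ (2 * (i + 1 : ℕ) + 1) * 2 ^ N.edgeClass u v :=
      fun h' => by push_cast; linarith
    rcases h.stretch φ (hresp φ hφ) u v huv with ⟨h1, h2⟩ | h1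
    · by_cases h3 : (s.next ids d board).cluster (N.edgeClass u v) (N.ident u) = none
      · exact Or.inr (hmono (hstretch φ hφ u v huv h1 h2 h3))
      · by_cases h4 : (s.next ids d board).cluster (N.edgeClass u v) (N.ident v) = none
        · right
          rw [edgeClass_comm] at h1 h2 h4
          have := hstretch φ hφ v u huv.symm h2 h1 h4
          rw [abs_sub_comm, edgeClass_comm] at this
          exact hmono this
        · exact Or.inl ⟨Option.isSome_iff_ne_none.2 h3, Option.isSome_iff_ne_none.2 h4⟩
    · exact Or.inr (hmono h1)
  · intro j
    have h1 : (s.next ids d board).clusters ids j ⊆ s.sample ids d board j := by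
      intro k hk
      obtain ⟨a, ha, hak⟩ := Clustering.mem_clusters.1 hk
      obtain ⟨v, -, rfl⟩ := mem_image.1 ha
      exact (hcluster j v k hak).1
    have h2 := card_le_card h1
    have h3 := (hsample j).2.1
    refine le_trans ?_ (h.card_le j)
    rw [← hids]
    rw [pow_succ, mul_comm _ 2, ← mul_assoc]
    exact Nat.mul_le_mul_right _ (by omega)

/-- The selected edges are edges of the network, and they preserve distances approximately. -/
structure IsSparsifier (N : Network V) (s : Clustering) : Prop where
  isEdge : ∀ j a b, s.selected j a b →
    ∃ u v, a = N.ident u ∧ b = N.ident v ∧ N.graph.Adj u v ∧ N.edgeClass u v = j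
  stretch : ∀ φ, s.Respects φ → ∀ u v, N.graph.Adj u v →
    |φ (N.ident u) - φ (N.ident v)| ≤ (2 * bitLength V + 1) * 2 ^ N.edgeClass u v

/-- A cluster that survives would give `2 ^ bitLength V ≤ n`, so no edge is undecided any more. -/
lemma ClusteringInvariant.isSparsifier {s : Clustering}
    (h : N.ClusteringInvariant (bitLength V) s) : N.IsSparsifier s where
  isEdge := h.isEdge
  stretch φ hφ u v huv := by
    refine (h.stretch φ hφ u v huv).resolve_left fun ⟨h1, _⟩ => ?_
    obtain ⟨k, hk⟩ := Option.isSome_iff_exists.1 h1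
    have h2 : 0 < (s.clusters (univ.image N.ident) (N.edgeClass u v)).card :=
      card_pos.2 ⟨k, Clustering.mem_clusters.2 ⟨_, mem_image_of_mem _ (mem_univ u), hk⟩⟩
    have h3 := h.card_le (N.edgeClass u v)
    have h4 : Fintype.card V < 2 ^ bitLength V := card_lt_two_pow_bitLength
    have h5 := Nat.mul_le_mul_right (2 ^ bitLength V) h2
    omega

lemma one_le_bitLength : 1 ≤ bitLength V := Nat.le_add_left _ _

lemma meets_sparsify (hN : N.PolyBounded c) {β : ℕ}
    (hβ : 2 * ((c + 1) * bitLength V) + 1 ≤ β) :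
    (sparsify (univ.image N.ident) (c * bitLength V + 1) (bitLength V)).Meets N ε β
      (bitLength V * (2 * (Fintype.card V *
        ((c * bitLength V + 1) * (bitLength V + 1) + 1)))) N.IsSparsifier := by
  classical
  refine (Prog.meets_iter (I := N.ClusteringInvariant) clusteringInvariant_zero
    fun i _ s hs => ?_).mono le_rfl fun s => ClusteringInvariant.isSparsifier
  refine Prog.meets_ask (T := 0) (fun v a ha => ?_) (fun v => ?_) (hs.next hN)
  · simp only [Clustering.post, mem_biUnion, mem_range] at ha
    obtain ⟨j, hj, ha⟩ := ha
    split_ifs at ha with h1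
    · obtain ⟨b, hb, rfl⟩ := mem_image.1 ha
      obtain ⟨u, -, -, -, rfl⟩ := mem_clusteredNeighbors.1 ((representatives_spec _ _ _).1 hb)
      have h2 : 2 ^ (c * bitLength V) < 2 ^ ((c + 1) * bitLength V) :=
        Nat.pow_lt_pow_right one_lt_two (by have := one_le_bitLength (V := V); nlinarith)
      refine (pair_succ_lt (β := (c + 1) * bitLength V) ?_ ((hN.ident_le u).trans_lt h2)).trans_le
        (Nat.pow_le_pow_right two_pos hβ)
      have h3 : c * bitLength V < 2 ^ (c * bitLength V) := Nat.lt_two_pow_self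
      omega
    · simp at ha
  · refine (card_biUnion_le_card_mul _ _ (bitLength V + 1) fun j _ => ?_).trans
      (by rw [card_range])
    split_ifs
    · exact card_image_le.trans (representatives_spec _ _ _).2.2.1
    · simp

end Network

/-! ### Multiplicative weights -/

/-- The flow on an arc of cost `w` if the potential difference is `d`. -/
def arcFlow (n : ℕ) (g η s d : ℝ) (w : ℕ) : ℝ := g * Real.exp (η * (d / w) - s) / (n ^ 2 * w)

namespace Network

variable {V : Type} [Fintype V] {N : Network V} {c : ℕ}

open Classical in
variable (N) in
/-- The sum of the exponential weights of all arcs. -/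
def totalWeight (η : ℝ) (Φ : V → ℝ) : ℝ :=
  ∑ u, ∑ v, if N.graph.Adj u v then Real.exp (η * ((Φ v - Φ u) / N.cost u v)) else 0

open Classical in
variable (N) in
/-- The flow that is proportional to the exponential weights. -/
def weightFlow (g η s : ℝ) (Φ : V → ℝ) (u v : V) : ℝ :=
  if N.graph.Adj u v then arcFlow (Fintype.card V) g η s (Φ v - Φ u) (N.cost u v) else 0

open Classical in
variable (N) in
/-- The weight flow rounded down to multiples of `1 / K`. -/
def roundedFlow (K : ℕ) (g η s : ℝ) (Φ : V → ℝ) (u v : V) : ℝ :=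
  if N.graph.Adj u v then
    (⌊K * arcFlow (Fintype.card V) g η s (Φ v - Φ u) (N.cost u v)⌋₊ : ℝ) / K else 0

lemma one_le_cost {u v : V} (h : N.graph.Adj u v) : (1 : ℝ) ≤ N.cost u v := by
  exact_mod_cast N.cost_pos u v h

lemma arcFlow_nonneg {n : ℕ} {g η s d : ℝ} {w : ℕ} (hg : 0 ≤ g) : 0 ≤ arcFlow n g η s d w := by
  unfold arcFlow
  positivity

lemma weightFlow_nonneg {g η s : ℝ} {Φ : V → ℝ} (hg : 0 ≤ g) (u v : V) :
    0 ≤ N.weightFlow g η s Φ u v := by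
  unfold weightFlow
  split_ifs
  · exact arcFlow_nonneg hg
  · rfl

lemma roundedFlow_nonneg {K : ℕ} {g η s : ℝ} {Φ : V → ℝ} (u v : V) :
    0 ≤ N.roundedFlow K g η s Φ u v := by
  unfold roundedFlow
  split_ifs
  · positivity
  · rfl

lemma roundedFlow_le {K : ℕ} (hK : 0 < K) {g η s : ℝ} {Φ : V → ℝ} (hg : 0 ≤ g) (u v : V) :
    N.roundedFlow K g η s Φ u v ≤ N.weightFlow g η s Φ u v := by
  have hK' : (0 : ℝ) < K := by exact_mod_cast hK
  unfold roundedFlow weightFlow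
  split_ifs
  · rw [div_le_iff₀ hK']
    exact (Nat.floor_le (mul_nonneg hK'.le (arcFlow_nonneg hg))).trans (mul_comm _ _).le
  · rfl

lemma weightFlow_sub_roundedFlow_le {K : ℕ} (hK : 0 < K) {g η s : ℝ} {Φ : V → ℝ} (u v : V) :
    N.weightFlow g η s Φ u v - N.roundedFlow K g η s Φ u v ≤ 1 / K := by
  have hK' : (0 : ℝ) < K := by exact_mod_cast hK
  unfold roundedFlow weightFlow
  split_ifs
  · rw [sub_le_iff_le_add, ← add_div, le_div_iff₀ hK', mul_comm, add_comm]
    exact (Nat.lt_floor_add_one _).le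
  · simp

lemma weightFlow_mul_cost [Nonempty V] {g η s : ℝ} {Φ : V → ℝ} {u v : V}
    (h : N.graph.Adj u v) : N.weightFlow g η s Φ u v * N.cost u v =
      g / (Fintype.card V ^ 2 * Real.exp s) * Real.exp (η * ((Φ v - Φ u) / N.cost u v)) := by
  have h1 := one_le_cost h
  have h2 : (0 : ℝ) < Fintype.card V := by exact_mod_cast Fintype.card_pos
  simp only [weightFlow, arcFlow, if_pos h]
  rw [Real.exp_sub]
  field_simp

/-- The flow is normalized by the public bound `n ^ 2 * exp s` for the total weight instead of the
total weight itself, which would require all edge costs. -/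
lemma sum_cost_weightFlow_le [Nonempty V] {g η s : ℝ} {Φ : V → ℝ} (hg : 0 ≤ g)
    (hW : N.totalWeight η Φ ≤ Fintype.card V ^ 2 * Real.exp s) :
    ∑ u, ∑ v, N.cost u v * N.weightFlow g η s Φ u v ≤ g := by
  have h2 : (0 : ℝ) < Fintype.card V ^ 2 * Real.exp s := by
    have : (0 : ℝ) < Fintype.card V := by exact_mod_cast Fintype.card_pos
    positivity
  have h3 : ∑ u, ∑ v, N.cost u v * N.weightFlow g η s Φ u v =
      g / (Fintype.card V ^ 2 * Real.exp s) * N.totalWeight η Φ := by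
    simp only [totalWeight, mul_sum]
    refine sum_congr rfl fun u _ => sum_congr rfl fun v _ => ?_
    split_ifs with h
    · rw [mul_comm, weightFlow_mul_cost h]
    · simp [weightFlow, h]
  rw [h3, div_mul_eq_mul_div, div_le_iff₀ h2]
  exact mul_le_mul_of_nonneg_left hW hg

/-- The potential differences along edges are at most the cheaper costs. -/
def IsSlack (N : Network V) (y : V → ℝ) : Prop :=
  ∀ u v, N.graph.Adj u v → |y v - y u| ≤ N.cost u v

/-- By slackness every exponent changes by at most `η ≤ 1` in absolute value, so `exp x ≤ 1 + x + x
^ 2` applies to each arc. The linear terms add up to a multiple of the sum in `hgap`, because the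
flow is proportional to the weights. -/
lemma totalWeight_add_le [Nonempty V] {g η s γ : ℝ} {Φ y : V → ℝ} (hg : 0 < g) (hη : 0 ≤ η)
    (hη1 : η ≤ 1) (hW : N.totalWeight η Φ ≤ Fintype.card V ^ 2 * Real.exp s) (hy : N.IsSlack y)
    (hgap : ∑ u, ∑ v, N.weightFlow g η s Φ u v * (y v - y u) ≤ N.dualValue y - g * γ) :
    N.totalWeight η (Φ + y) ≤
      Fintype.card V ^ 2 * Real.exp (s + η * N.dualValue y / g - η * γ + η ^ 2) := by
  have h2 : (0 : ℝ) < Fintype.card V ^ 2 * Real.exp s := by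
    have : (0 : ℝ) < Fintype.card V := by exact_mod_cast Fintype.card_pos
    positivity
  set A : ℝ := Fintype.card V ^ 2 * Real.exp s with hA
  have h3 : N.totalWeight η (Φ + y) ≤ (1 + η ^ 2) * N.totalWeight η Φ +
      η * A / g * ∑ u, ∑ v, N.weightFlow g η s Φ u v * (y v - y u) := by
    simp only [totalWeight, mul_sum, ← sum_add_distrib]
    refine sum_le_sum fun u _ => sum_le_sum fun v _ => ?_
    split_ifs with h
    · have hc := one_le_cost h
      have hc0 : (0 : ℝ) < N.cost u v := by linarith
      set z := (y v - y u) / N.cost u v with hz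
      set W := Real.exp (η * ((Φ v - Φ u) / N.cost u v)) with hWdef
      have hz1 : |z| ≤ 1 := by
        rw [hz, abs_div, abs_of_pos hc0, div_le_one hc0]
        exact hy u v h
      have h4 : η * A / g * (N.weightFlow g η s Φ u v * (y v - y u)) = W * (η * z) := by
        have : y v - y u = N.cost u v * z := by rw [hz]; field_simp
        rw [this, ← mul_assoc (N.weightFlow g η s Φ u v), weightFlow_mul_cost h, ← hA, ← hWdef]
        field_simp
      have h5 : η * (((Φ + y) v - (Φ + y) u) / N.cost u v) =
          η * ((Φ v - Φ u) / N.cost u v) + η * z := by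
        rw [hz]
        simp only [Pi.add_apply]
        ring
      rw [h4, h5, Real.exp_add, ← hWdef]
      have h6 : |η * z| ≤ 1 := by
        rw [abs_mul, abs_of_nonneg hη]
        exact mul_le_one₀ hη1 (abs_nonneg _) hz1
      have h7 := (abs_le.1 (Real.abs_exp_sub_one_sub_id_le h6)).2
      have h8 : (η * z) ^ 2 ≤ η ^ 2 := by
        rw [mul_pow]
        have : z ^ 2 ≤ 1 := (sq_le_one_iff_abs_le_one z).2 hz1
        nlinarith [sq_nonneg η]
      have h9 : 0 < W := Real.exp_pos _
      nlinarith
    · simp [weightFlow, h]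
  have h4 : N.totalWeight η (Φ + y) ≤
      A * (1 + (η * N.dualValue y / g - η * γ + η ^ 2)) := by
    refine h3.trans ?_
    have h5 : (1 + η ^ 2) * N.totalWeight η Φ ≤ (1 + η ^ 2) * A :=
      mul_le_mul_of_nonneg_left hW (by positivity)
    have h6 : η * A / g * ∑ u, ∑ v, N.weightFlow g η s Φ u v * (y v - y u) ≤
        η * A / g * (N.dualValue y - g * γ) := mul_le_mul_of_nonneg_left hgap (by positivity)
    have h7 : η * A / g * (N.dualValue y - g * γ) = A * (η * N.dualValue y / g - η * γ) := by
      field_simp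
    linarith
  refine h4.trans ?_
  have h5 := Real.add_one_le_exp (η * N.dualValue y / g - η * γ + η ^ 2)
  calc A * (1 + (η * N.dualValue y / g - η * γ + η ^ 2))
      ≤ A * Real.exp (η * N.dualValue y / g - η * γ + η ^ 2) :=
        mul_le_mul_of_nonneg_left (by linarith) h2.le
    _ = Fintype.card V ^ 2 * Real.exp (s + η * N.dualValue y / g - η * γ + η ^ 2) := by
        rw [hA, mul_assoc, ← Real.exp_add]
        congr 2
        ring

lemma dualValue_mul (k : ℝ) (y : V → ℝ) :
    N.dualValue (fun v => k * y v) = k * N.dualValue y := by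
  rw [dualValue, dualValue, mul_sum]
  exact sum_congr rfl fun v _ => by ring

lemma dualValue_add (y z : V → ℝ) : N.dualValue (y + z) = N.dualValue y + N.dualValue z := by
  simp only [dualValue, Pi.add_apply, mul_add, sum_add_distrib]

/-- If the total weight is small, then the potential is almost dual feasible. -/
lemma isPotential_of_totalWeight_lt {g η : ℝ} {Φ : V → ℝ} (hg : 0 < g) (hη : 0 < η)
    (hadj : ∃ u v, N.graph.Adj u v)
    (hW : N.totalWeight η Φ < Real.exp (η * (N.dualValue Φ / g))) :
    N.IsPotential (fun v => g / N.dualValue Φ * Φ v) ∧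
      N.dualValue (fun v => g / N.dualValue Φ * Φ v) = g := by
  classical
  -- Each single weight is bounded by the total.
  have h1 : ∀ u v, N.graph.Adj u v → Φ v - Φ u < N.dualValue Φ / g * N.cost u v := by
    intro u v h
    have hc0 : (0 : ℝ) < N.cost u v := by linarith [one_le_cost h]
    rw [← div_lt_iff₀ hc0]
    refine lt_of_mul_lt_mul_left (Real.exp_lt_exp.1 (lt_of_le_of_lt ?_ hW)) hη.le
    have hnn : ∀ a b : V, 0 ≤ if N.graph.Adj a b then
        Real.exp (η * ((Φ b - Φ a) / N.cost a b)) else 0 := fun a b => by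
      split_ifs
      · positivity
      · rfl
    have h2 := single_le_sum (f := fun b => if N.graph.Adj u b then
        Real.exp (η * ((Φ b - Φ u) / N.cost u b)) else 0) (fun b _ => hnn u b) (mem_univ v)
    have h3 := single_le_sum (f := fun a => ∑ b, if N.graph.Adj a b then
        Real.exp (η * ((Φ b - Φ a) / N.cost a b)) else 0)
        (fun a _ => sum_nonneg fun b _ => hnn a b) (mem_univ u)
    simp only [if_pos h] at h2
    exact h2.trans h3
  -- Were the value nonpositive, the potential difference of an edge would be negative in both
  -- directions.
  have hpos : 0 < N.dualValue Φ := by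
    obtain ⟨u, v, h⟩ := hadj
    have h2 := h1 u v h
    have h3 := h1 v u h.symm
    have h4 := one_le_cost h
    have h5 := one_le_cost h.symm
    by_contra! hcon
    have h6 : N.dualValue Φ / g ≤ 0 := div_nonpos_of_nonpos_of_nonneg hcon hg.le
    nlinarith
  constructor
  · intro u v h
    have h2 := (h1 u v h).le
    have h3 : g / N.dualValue Φ * Φ v - g / N.dualValue Φ * Φ u =
        g / N.dualValue Φ * (Φ v - Φ u) := by ring
    rw [h3]
    calc g / N.dualValue Φ * (Φ v - Φ u)
        ≤ g / N.dualValue Φ * (N.dualValue Φ / g * N.cost u v) :=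
          mul_le_mul_of_nonneg_left h2 (by positivity)
      _ = N.cost u v := by field_simp
  · rw [dualValue_mul]
    field_simp

end Network

/-! ### Routing on the sparse subgraph -/

namespace Clustering

def Joined (H : Clustering) (a b : ℕ) : Prop := ∃ j, H.selected j a b ∨ H.selected j b a

/-- The class of a selected edge. -/
def level (H : Clustering) (a b : ℕ) : ℕ := sInf {j | H.selected j a b ∨ H.selected j b a}

lemma level_spec {H : Clustering} {a b : ℕ} (h : H.Joined a b) :
    H.selected (H.level a b) a b ∨ H.selected (H.level a b) b a :=
  Nat.sInf_mem (s := {j | H.selected j a b ∨ H.selected j b a}) h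

/-- The flow `F` on the selected edges satisfies the demands `r` and costs at most `τ`. -/
structure IsRouting (H : Clustering) (ids : Finset ℕ) (r : ℕ → ℝ) (τ : ℝ) (F : ℕ → ℕ → ℝ) :
    Prop where
  nonneg : ∀ a b, 0 ≤ F a b
  support : ∀ a b, ¬H.Joined a b → F a b = 0
  cost_le : ∑ a ∈ ids, ∑ b ∈ ids, 2 ^ H.level a b * F a b ≤ τ
  netFlow_eq : ∀ a ∈ ids, ∑ b ∈ ids, F b a - ∑ b ∈ ids, F a b = r a

/-- A potential which shows that no routing has cost at most `τ`. -/
structure IsWitness (H : Clustering) (ids : Finset ℕ) (r : ℕ → ℝ) (τ : ℝ) (φ : ℕ → ℝ) :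
    Prop where
  respects : H.Respects φ
  lt : τ < ∑ a ∈ ids, r a * φ a

/-- This is `exists_flow_or_potential` on the subtype `ids`, extended by zero. Both orientations of
a selected edge are arcs, which gives the absolute values in `Respects`. -/
lemma exists_isRouting_or_isWitness (H : Clustering) (ids : Finset ℕ)
    (hH : ∀ j a b, H.selected j a b → a ∈ ids ∧ b ∈ ids) (r : ℕ → ℝ) {τ : ℝ} (hτ : 0 < τ) :
    (∃ F, H.IsRouting ids r τ F) ∨ ∃ φ, H.IsWitness ids r τ φ := by
  classical
  rcases exists_flow_or_potential (ι := ids) (fun a b => H.Joined a b)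
    (fun a b => 2 ^ H.level a b) (fun a b _ => by positivity) (fun a => r a) hτ with
    ⟨f, h0, h1, h2, h3⟩ | ⟨φ, h1, h2⟩
  · left
    set F : ℕ → ℕ → ℝ := fun a b =>
      if h : a ∈ ids ∧ b ∈ ids then f ⟨a, h.1⟩ ⟨b, h.2⟩ else 0 with hF
    have hFf : ∀ a b : ids, F a b = f a b := fun a b => by simp [hF]
    refine ⟨F, fun a b => ?_, fun a b hab => ?_, ?_, fun a ha => ?_⟩
    · simp only [hF]
      split_ifs
      · exact h0 _ _
      · rfl
    · simp only [hF]
      split_ifs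
      · exact h1 _ _ hab
      · rfl
    · rw [← sum_coe_sort ids]
      simp only [← sum_coe_sort ids, hFf]
      exact h2
    · have := h3 ⟨a, ha⟩
      simp only [netFlow, ← hFf] at this
      rw [← sum_coe_sort ids, ← sum_coe_sort ids]
      exact this
  · right
    set ψ : ℕ → ℝ := fun a => if h : a ∈ ids then φ ⟨a, h⟩ else 0 with hψ
    have hψφ : ∀ a : ids, ψ a = φ a := fun a => by simp [hψ]
    refine ⟨ψ, fun j a b hab => ?_, ?_⟩
    · obtain ⟨ha, hb⟩ := hH j a b hab
      have h3 := h1 ⟨a, ha⟩ ⟨b, hb⟩ ⟨j, Or.inl hab⟩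
      have h4 := h1 ⟨b, hb⟩ ⟨a, ha⟩ ⟨j, Or.inr hab⟩
      rw [← hψφ, ← hψφ] at h3 h4
      have h5 : (2 : ℝ) ^ H.level a b ≤ 2 ^ j :=
        pow_le_pow_right₀ one_le_two (Nat.sInf_le (Or.inl hab))
      have h6 : (2 : ℝ) ^ H.level b a ≤ 2 ^ j :=
        pow_le_pow_right₀ one_le_two (Nat.sInf_le (Or.inr hab))
      dsimp only at h3 h4
      rw [abs_le]
      constructor <;> linarith
    · rw [← sum_coe_sort ids]
      simp only [hψφ]
      exact h2

end Clustering

/-! ### The multiplicative weights program -/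

/-- Public knowledge about the instance: the identifiers, the demands, and an upper bound for the
asymmetry. -/
structure Setup where
  ids : Finset ℕ
  demand : ℕ → ℤ
  ratio : ℕ

/-- A potential, and the flow on the arcs (from, to, cost). -/
structure Solution where
  potential : ℕ → ℝ
  flow : ℕ → ℕ → ℕ → ℝ

namespace Setup

variable (S : Setup) (c : ℕ) (ε : ℝ)

def bits : ℕ := Nat.log 2 S.ids.card + 1

/-- The stretch of the sparse subgraph. -/
def stretch : ℝ := 2 * S.bits + 1

/-- The progress of an iteration. -/
def gap : ℝ := ε / 3 / (4 * S.ratio * S.stretch)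

/-- The flow is rounded to multiples of the reciprocal of this number. -/
def precision : ℕ := 2 ^ ((2 * c + 10) * S.bits)

def dual (φ : ℕ → ℝ) : ℝ := ∑ a ∈ S.ids, (S.demand a : ℝ) * φ a

/-- The logarithm of the bound for the total weight after `t` iterations. -/
def shift (g : ℝ) (t : ℕ) (Φ : ℕ → ℝ) : ℝ :=
  -- With `η = gap / 2`, the gain `η * gap - η ^ 2` of an iteration is `gap ^ 2 / 4`.
  S.gap ε / 2 * S.dual Φ / g - t * (S.gap ε ^ 2 / 4)

/-- The rounded flow on an arc in multiples of the reciprocal of the precision. -/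
def units (g : ℝ) (t : ℕ) (Φ : ℕ → ℝ) (a b w : ℕ) : ℕ :=
  ⌊S.precision c * arcFlow S.ids.card g (S.gap ε / 2) (S.shift ε g t Φ) (Φ b - Φ a) w⌋₊

/-- Each node announces its total rounded inflow and outflow. -/
def flowPost (g : ℝ) (t : ℕ) (Φ : ℕ → ℝ) (inp : LocalInput) : Finset ℕ :=
  {Nat.pair (∑ x ∈ inp.incident, S.units c ε g t Φ x.1 inp.ident x.2.2)
    (∑ x ∈ inp.incident, S.units c ε g t Φ inp.ident x.1 x.2.1)}

/-- The demands that the rounded flow does not satisfy. -/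
def residual (board : Finset ℕ) (a : ℕ) : ℝ :=
  S.demand a - ((((contents board a).sup id).unpair.1 : ℝ) -
    (((contents board a).sup id).unpair.2 : ℝ)) / S.precision c

open Classical in
/-- An iteration either finds a solution or improves the potential. -/
def mwStep (H : Clustering) (g : ℝ) (y : ℕ → ℝ) (t : ℕ) (Φ : ℕ → ℝ) :
    Prog (Solution ⊕ (ℕ → ℝ)) :=
  .ask (S.flowPost c ε g t Φ) fun board =>
    -- On real edges the cost is at most `2 * ratio` times the power of two of the class, so this
    -- budget limits the correction to `ε / 3 * g`. The routing and the witness are chosen from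
    -- public data, identically at all nodes; one of them exists (`exists_isRouting_or_isWitness`).
    if h : ∃ F, H.IsRouting S.ids (S.residual c board) (ε / 3 * g / (2 * S.ratio)) F then
      .pure (Sum.inl ⟨y, fun a b w => S.units c ε g t Φ a b w / S.precision c + h.choose a b⟩)
    else if h : ∃ φ, H.IsWitness S.ids (S.residual c board) (ε / 3 * g / (2 * S.ratio)) φ then
      .pure (Sum.inr (Φ + fun a => 1 / S.stretch * h.choose a))
    else .pure (Sum.inr Φ)

end Setup

/-! ### Public knowledge and rounding errors. -/

namespace Network

variable {V : Type} [Fintype V] {N : Network V} {ε : ℝ} {c : ℕ}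

variable (N) in
/-- The public knowledge is correct. -/
structure IsSetup (c : ℕ) (S : Setup) : Prop where
  ids_eq : S.ids = univ.image N.ident
  demand_eq : ∀ v, S.demand (N.ident v) = N.demand v
  one_le_ratio : 1 ≤ S.ratio
  ratio_le : S.ratio ≤ 2 ^ ((c + 1) * bitLength V)
  cost_le : ∀ u v, N.graph.Adj u v → N.cost u v ≤ S.ratio * N.cost v u

variable (N) in
/-- The public solution is a `(1 + ε)`-approximate solution. -/
def IsGood (ε : ℝ) (sol : Solution) : Prop :=
  ∃ f, N.IsApproxPair ε f (sol.potential ∘ N.ident) ∧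
    ∀ u v, N.graph.Adj u v → f u v = sol.flow (N.ident u) (N.ident v) (N.cost u v)

lemma sum_ids (F : ℕ → ℝ) : ∑ a ∈ univ.image N.ident, F a = ∑ v, F (N.ident v) :=
  sum_image fun _ _ _ _ h => N.ident_injective h

open Classical in
lemma sum_incident {M : Type} [AddCommMonoid M] (v : V) (F : ℕ × ℕ × ℕ → M) :
    ∑ x ∈ (N.localInput ε v).incident, F x =
      ∑ u, if N.graph.Adj v u then F (N.ident u, N.cost v u, N.cost u v) else 0 := by
  rw [← sum_filter]
  exact sum_image fun a _ b _ h => N.ident_injective (Prod.ext_iff.1 h).1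

namespace IsSetup

variable {S : Setup}

lemma card_ids (h : N.IsSetup c S) : S.ids.card = Fintype.card V := by
  rw [h.ids_eq, card_image_of_injective _ N.ident_injective, card_univ]

lemma bits_eq (h : N.IsSetup c S) : S.bits = bitLength V := by
  rw [Setup.bits, h.card_ids, bitLength]

lemma dual_eq (h : N.IsSetup c S) (φ : ℕ → ℝ) : S.dual φ = N.dualValue (φ ∘ N.ident) := by
  rw [Setup.dual, h.ids_eq, sum_ids]
  simp [dualValue, h.demand_eq]

lemma one_le_ratio_real (h : N.IsSetup c S) : (1 : ℝ) ≤ S.ratio := by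
  exact_mod_cast h.one_le_ratio

lemma one_le_stretch : 1 ≤ S.stretch := by
  unfold Setup.stretch
  have : (0 : ℝ) ≤ S.bits := Nat.cast_nonneg _
  linarith

lemma gap_pos (h : N.IsSetup c S) (hε : 0 < ε) : 0 < S.gap ε := by
  have h1 := h.one_le_ratio_real
  have h2 := one_le_stretch (S := S)
  unfold Setup.gap
  positivity

lemma gap_le_one (h : N.IsSetup c S) (hε1 : ε ≤ 1) : S.gap ε ≤ 1 := by
  have h1 := h.one_le_ratio_real
  have h2 := one_le_stretch (S := S)
  unfold Setup.gap
  rw [div_le_one (by positivity)]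
  nlinarith

lemma precision_pos : 0 < S.precision c := by unfold Setup.precision; positivity

/-- The rounding errors are negligible. -/
lemma rounding_le (h : N.IsSetup c S) (hε : 0 < ε) (hn : 1 ≤ Fintype.card V * ε) :
    (Fintype.card V : ℝ) ^ 2 * 2 ^ (c * bitLength V) / S.precision c ≤ S.gap ε := by
  have h1 := h.one_le_ratio_real
  have h2 := one_le_stretch (S := S)
  set l := bitLength V with hl
  have hl1 : 1 ≤ l := one_le_bitLength
  have hn2 : (Fintype.card V : ℝ) ≤ 2 ^ l := card_le_real
  have hn0 : (0 : ℝ) ≤ Fintype.card V := Nat.cast_nonneg _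
  have h3 : S.stretch ≤ 2 ^ (2 * l) := by
    have h4 : ∀ k : ℕ, 1 ≤ k → 2 * k + 1 ≤ 2 ^ (2 * k) := by
      intro k hk
      induction k, hk using Nat.le_induction with
      | base => norm_num
      | succ k _ ih =>
        rw [show 2 * (k + 1) = 2 * k + 2 by ring, pow_add]
        omega
    have := h4 l hl1
    unfold Setup.stretch
    rw [h.bits_eq]
    exact_mod_cast this
  have h4 : (S.ratio : ℝ) ≤ 2 ^ ((c + 1) * l) := by exact_mod_cast h.ratio_le
  have h5 : (12 : ℝ) ≤ 2 ^ (4 * l) :=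
    le_trans (by norm_num : (12 : ℝ) ≤ 2 ^ 4) (pow_le_pow_right₀ one_le_two (by omega))
  have hε2 : 1 ≤ 2 ^ l * ε := hn.trans (mul_le_mul_of_nonneg_right hn2 hε.le)
  -- The factors cover, in this order, `n ^ 2`, the largest cost, the constant `12`, the ratio, the
  -- stretch, and `1 / ε ≤ n`.
  have hK : (S.precision c : ℝ) =
      (2 ^ l) ^ 2 * 2 ^ (c * l) * (2 ^ (4 * l) * 2 ^ ((c + 1) * l) * 2 ^ (2 * l)) * 2 ^ l := by
    rw [Setup.precision, h.bits_eq]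
    push_cast
    ring
  have hgap : S.gap ε = ε / (12 * S.ratio * S.stretch) := by
    unfold Setup.gap
    field_simp
    norm_num
  rw [hgap, div_le_div_iff₀ (by rw [hK]; positivity) (by positivity), hK]
  have h6 : (Fintype.card V : ℝ) ^ 2 ≤ (2 ^ l) ^ 2 := pow_le_pow_left₀ hn0 hn2 2
  have h7 : 12 * (S.ratio : ℝ) * S.stretch ≤
      2 ^ (4 * l) * 2 ^ ((c + 1) * l) * 2 ^ (2 * l) := by gcongr
  calc (Fintype.card V : ℝ) ^ 2 * 2 ^ (c * l) * (12 * S.ratio * S.stretch)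
      ≤ (2 ^ l) ^ 2 * 2 ^ (c * l) * (2 ^ (4 * l) * 2 ^ ((c + 1) * l) * 2 ^ (2 * l)) * 1 := by
        rw [mul_one]; gcongr
    _ ≤ (2 ^ l) ^ 2 * 2 ^ (c * l) * (2 ^ (4 * l) * 2 ^ ((c + 1) * l) * 2 ^ (2 * l)) *
        (2 ^ l * ε) := by gcongr
    _ = ε * ((2 ^ l) ^ 2 * 2 ^ (c * l) * (2 ^ (4 * l) * 2 ^ ((c + 1) * l) * 2 ^ (2 * l)) *
        2 ^ l) := by ring

lemma units_div (h : N.IsSetup c S) {g : ℝ} {t : ℕ} {Φ : ℕ → ℝ} {u v : V}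
    (huv : N.graph.Adj u v) :
    (S.units c ε g t Φ (N.ident u) (N.ident v) (N.cost u v) : ℝ) / S.precision c =
      N.roundedFlow (S.precision c) g (S.gap ε / 2) (S.shift ε g t Φ) (Φ ∘ N.ident) u v := by
  rw [roundedFlow, if_pos huv, Setup.units, h.card_ids]
  rfl

/-- The residual depends only on the net flow into each node, so two totals per node suffice. -/
lemma residual_board (h : N.IsSetup c S) (g : ℝ) (t : ℕ) (Φ : ℕ → ℝ) (v : V) :
    S.residual c (N.board ε (S.flowPost c ε g t Φ)) (N.ident v) =
      N.demand v - netFlow (N.roundedFlow (S.precision c) g (S.gap ε / 2) (S.shift ε g t Φ)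
        (Φ ∘ N.ident)) v := by
  classical
  have hid : (N.localInput ε v).ident = N.ident v := rfl
  rw [Setup.residual, contents_board, h.demand_eq, Setup.flowPost, sup_singleton, id,
    Nat.unpair_pair, netFlow, sum_incident, sum_incident, hid]
  push_cast
  rw [sub_div, sum_div, sum_div]
  congr 2
  · refine sum_congr rfl fun u _ => ?_
    split_ifs with hu
    · exact h.units_div hu.symm
    · rw [roundedFlow, if_neg fun hu' => hu hu'.symm, zero_div]
  · refine sum_congr rfl fun u _ => ?_
    split_ifs with hu
    · exact h.units_div hu
    · rw [roundedFlow, if_neg hu, zero_div]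

end IsSetup

end Network

/-! ### Correctness of one multiplicative weights iteration. -/

namespace Network

variable {V : Type} [Fintype V] {N : Network V} {ε : ℝ} {c : ℕ}

namespace IsSparsifier

variable {H : Clustering}

lemma mem_ids (hH : N.IsSparsifier H) {j a b : ℕ} (h : H.selected j a b) :
    a ∈ univ.image N.ident ∧ b ∈ univ.image N.ident := by
  obtain ⟨u, v, rfl, rfl, -, -⟩ := hH.isEdge j a b h
  exact ⟨mem_image_of_mem _ (mem_univ u), mem_image_of_mem _ (mem_univ v)⟩

lemma adj_of_joined (hH : N.IsSparsifier H) {u v : V}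
    (h : H.Joined (N.ident u) (N.ident v)) :
    N.graph.Adj u v ∧ H.level (N.ident u) (N.ident v) = N.edgeClass u v := by
  rcases Clustering.level_spec h with h1 | h1
  · obtain ⟨u', v', hu, hv, h2, h3⟩ := hH.isEdge _ _ _ h1
    obtain rfl := N.ident_injective hu
    obtain rfl := N.ident_injective hv
    exact ⟨h2, h3.symm⟩
  · obtain ⟨v', u', hv, hu, h2, h3⟩ := hH.isEdge _ _ _ h1
    obtain rfl := N.ident_injective hu
    obtain rfl := N.ident_injective hv
    rw [edgeClass_comm]
    exact ⟨h2.symm, h3.symm⟩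

end IsSparsifier

namespace IsSetup

variable {S : Setup} {H : Clustering} {g : ℝ} {t : ℕ} {Φ : ℕ → ℝ}

lemma cost_le_two_pow (h : N.IsSetup c S) {u v : V} (huv : N.graph.Adj u v) :
    (N.cost u v : ℝ) ≤ 2 * S.ratio * 2 ^ N.edgeClass u v := by
  have h1 := h.cost_le u v huv
  have h2 := min_cost_lt (N := N) (u := u) (v := v)
  have h3 : N.cost u v ≤ S.ratio * min (N.cost u v) (N.cost v u) := by
    rcases min_choice (N.cost u v) (N.cost v u) with h4 | h4 <;> rw [h4]
    · exact Nat.le_mul_of_pos_left _ h.one_le_ratio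
    · exact h1
  have h4 : N.cost u v ≤ 2 * S.ratio * 2 ^ N.edgeClass u v :=
    calc N.cost u v ≤ S.ratio * min (N.cost u v) (N.cost v u) := h3
      _ ≤ S.ratio * 2 ^ (N.edgeClass u v + 1) := Nat.mul_le_mul_left _ h2.le
      _ = 2 * S.ratio * 2 ^ N.edgeClass u v := by ring
  exact_mod_cast h4

/-- The invariant of the multiplicative weights iterations. -/
def WeightInvariant (N : Network V) (ε : ℝ) (S : Setup) (g : ℝ) (t : ℕ) (Φ : ℕ → ℝ) : Prop :=
  N.totalWeight (S.gap ε / 2) (Φ ∘ N.ident) ≤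
    Fintype.card V ^ 2 * Real.exp (S.shift ε g t Φ)

/-- The weight flow costs at most `g` and the correction at most `ε / 3 * g`; since `g ≤ (1 + ε / 3)
* bᵀ y`, the total is at most `(1 + ε / 3) ^ 2 * bᵀ y`. -/
lemma isGood_of_isRouting [Nonempty V] (h : N.IsSetup c S) (hH : N.IsSparsifier H) (hε : 0 < ε)
    (hε1 : ε ≤ 1) (hg : 0 < g) (hI : WeightInvariant N ε S g t Φ) {y : ℕ → ℝ}
    (hy : N.IsPotential (y ∘ N.ident)) (hgy : g ≤ (1 + ε / 3) * N.dualValue (y ∘ N.ident))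
    {F : ℕ → ℕ → ℝ} (hF : H.IsRouting S.ids
      (S.residual c (N.board ε (S.flowPost c ε g t Φ))) (ε / 3 * g / (2 * S.ratio)) F) :
    N.IsGood ε ⟨y, fun a b w => S.units c ε g t Φ a b w / S.precision c + F a b⟩ := by
  set r := N.roundedFlow (S.precision c) g (S.gap ε / 2) (S.shift ε g t Φ) (Φ ∘ N.ident) with hr
  have hratio := h.one_le_ratio_real
  have hsupp : ∀ u v, ¬N.graph.Adj u v → F (N.ident u) (N.ident v) = 0 := fun u v huv =>
    hF.support _ _ fun hj => huv (hH.adj_of_joined hj).1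
  refine ⟨fun u v => r u v + F (N.ident u) (N.ident v), ⟨?_, ?_, ?_, hy, ?_⟩, ?_⟩
  · exact fun u v => add_nonneg (roundedFlow_nonneg u v) (hF.nonneg _ _)
  · intro u v huv
    rw [hsupp u v huv, hr, roundedFlow, if_neg huv, add_zero]
  · intro v
    rw [netFlow_add r fun u v => F (N.ident u) (N.ident v)]
    have h1 := hF.netFlow_eq (N.ident v) (by rw [h.ids_eq]; exact mem_image_of_mem _ (mem_univ v))
    rw [h.residual_board, h.ids_eq, sum_ids, sum_ids] at h1
    simp only [netFlow] at h1 ⊢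
    linarith
  · have h1 : ∑ u, ∑ v, N.cost u v * r u v ≤ g := by
      refine le_trans (sum_le_sum fun u _ => sum_le_sum fun v _ => ?_)
        (sum_cost_weightFlow_le hg.le hI)
      exact mul_le_mul_of_nonneg_left (roundedFlow_le precision_pos hg.le u v)
        (Nat.cast_nonneg _)
    have h2 : ∑ u, ∑ v, N.cost u v * F (N.ident u) (N.ident v) ≤ ε / 3 * g := by
      have h3 := hF.cost_le
      rw [h.ids_eq] at h3
      simp only [sum_ids] at h3
      calc ∑ u, ∑ v, N.cost u v * F (N.ident u) (N.ident v)
          ≤ ∑ u, ∑ v, 2 * S.ratio *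
            (2 ^ H.level (N.ident u) (N.ident v) * F (N.ident u) (N.ident v)) := by
            refine sum_le_sum fun u _ => sum_le_sum fun v _ => ?_
            by_cases hj : H.Joined (N.ident u) (N.ident v)
            · obtain ⟨h4, h5⟩ := hH.adj_of_joined hj
              rw [h5, ← mul_assoc]
              exact mul_le_mul_of_nonneg_right (h.cost_le_two_pow h4) (hF.nonneg _ _)
            · rw [hF.support _ _ hj]
              simp
        _ = 2 * S.ratio * ∑ u, ∑ v,
            2 ^ H.level (N.ident u) (N.ident v) * F (N.ident u) (N.ident v) := by
            simp only [mul_sum]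
        _ ≤ 2 * S.ratio * (ε / 3 * g / (2 * S.ratio)) :=
            mul_le_mul_of_nonneg_left h3 (by positivity)
        _ = ε / 3 * g := by field_simp
    simp only [mul_add, sum_add_distrib]
    calc _ ≤ g + ε / 3 * g := add_le_add h1 h2
      _ = (1 + ε / 3) * g := by ring
      _ ≤ (1 + ε / 3) * ((1 + ε / 3) * N.dualValue (y ∘ N.ident)) :=
          mul_le_mul_of_nonneg_left hgy (by positivity)
      _ ≤ (1 + ε) * N.dualValue (y ∘ N.ident) := by
          have : 0 ≤ N.dualValue (y ∘ N.ident) := by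
            by_contra! hcon
            nlinarith
          rw [← mul_assoc]
          refine mul_le_mul_of_nonneg_right ?_ this
          nlinarith
  · intro u v huv
    simp only [hr]
    rw [h.units_div huv]

/-- Divided by the stretch, the witness becomes slack on all edges of the network, and its value on
the residual demands is the shortfall that `totalWeight_add_le` needs. -/
lemma weightInvariant_of_isWitness [Nonempty V] (h : N.IsSetup c S) (hN : N.PolyBounded c)
    (hH : N.IsSparsifier H) (hε : 0 < ε) (hε1 : ε ≤ 1) (hn : 1 ≤ Fintype.card V * ε) (hg : 1 ≤ g)
    (hI : WeightInvariant N ε S g t Φ) {φ : ℕ → ℝ} (hφ : H.IsWitness S.ids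
      (S.residual c (N.board ε (S.flowPost c ε g t Φ))) (ε / 3 * g / (2 * S.ratio)) φ) :
    WeightInvariant N ε S g (t + 1) (Φ + fun a => 1 / S.stretch * φ a) := by
  have hg0 : 0 < g := by linarith
  have hgap := h.gap_pos hε
  have hgap1 := h.gap_le_one hε1
  have hstr := one_le_stretch (S := S)
  have hratio := h.one_le_ratio_real
  have hK : (0 : ℝ) < S.precision c := by exact_mod_cast precision_pos
  set y : V → ℝ := fun v => 1 / S.stretch * φ (N.ident v) with hy
  have hcomp : (Φ + fun a => 1 / S.stretch * φ a) ∘ N.ident = Φ ∘ N.ident + y := rfl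
  have hslack : N.IsSlack y := by
    intro u v huv
    have h1 := hH.stretch φ hφ.respects v u huv.symm
    have h2 : (2 : ℝ) ^ N.edgeClass v u ≤ N.cost u v := by
      exact_mod_cast (two_pow_edgeClass_le huv.symm).trans (min_le_right _ _)
    have h3 : y v - y u = 1 / S.stretch * (φ (N.ident v) - φ (N.ident u)) := by
      rw [hy]; ring
    rw [h3, abs_mul, abs_of_pos (by positivity)]
    have h4 : (2 * (bitLength V : ℝ) + 1) = S.stretch := by rw [Setup.stretch, h.bits_eq]
    rw [h4] at h1
    calc 1 / S.stretch * |φ (N.ident v) - φ (N.ident u)|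
        ≤ 1 / S.stretch * (S.stretch * 2 ^ N.edgeClass v u) :=
          mul_le_mul_of_nonneg_left h1 (by positivity)
      _ = 2 ^ N.edgeClass v u := by field_simp
      _ ≤ _ := h2
  set w := N.weightFlow g (S.gap ε / 2) (S.shift ε g t Φ) (Φ ∘ N.ident) with hw
  set r := N.roundedFlow (S.precision c) g (S.gap ε / 2) (S.shift ε g t Φ) (Φ ∘ N.ident) with hr
  -- The witness concerns the rounded flow, the weights the exact one.
  have hround : ∑ u, ∑ v, w u v * (y v - y u) ≤
      ∑ u, ∑ v, r u v * (y v - y u) + S.gap ε := by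
    have h1 : ∀ u v, w u v * (y v - y u) ≤
        r u v * (y v - y u) + 2 ^ (c * bitLength V) / S.precision c := by
      intro u v
      by_cases huv : N.graph.Adj u v
      · have h2 := weightFlow_sub_roundedFlow_le (N := N) (precision_pos (c := c) (S := S))
          (g := g) (η := S.gap ε / 2) (s := S.shift ε g t Φ) (Φ := Φ ∘ N.ident) u v
        have h3 := roundedFlow_le (N := N) (precision_pos (c := c) (S := S))
          (η := S.gap ε / 2) (s := S.shift ε g t Φ) (Φ := Φ ∘ N.ident) hg0.le u v
        have h4 : y v - y u ≤ 2 ^ (c * bitLength V) :=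
          (le_abs_self _).trans ((hslack u v huv).trans (hN.cost_le_real huv))
        have h5 : (w u v - r u v) * (y v - y u) ≤ 1 / S.precision c * 2 ^ (c * bitLength V) :=
          (mul_le_mul_of_nonneg_left h4 (sub_nonneg.2 h3)).trans
            (mul_le_mul_of_nonneg_right h2 (by positivity))
        rw [one_div_mul_eq_div] at h5
        linarith
      · rw [hw, hr, weightFlow, roundedFlow, if_neg huv, if_neg huv]
        have : (0 : ℝ) ≤ 2 ^ (c * bitLength V) / S.precision c := by positivity
        linarith
    refine (sum_le_sum fun u _ => sum_le_sum fun v _ => h1 u v).trans ?_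
    simp only [sum_add_distrib, sum_const, card_univ, nsmul_eq_mul]
    have h2 := h.rounding_le hε hn
    have h3 : (Fintype.card V : ℝ) * (Fintype.card V *
        (2 ^ (c * bitLength V) / S.precision c)) =
        (Fintype.card V : ℝ) ^ 2 * 2 ^ (c * bitLength V) / S.precision c := by ring
    rw [h3]
    linarith
  have hres : ∑ u, ∑ v, r u v * (y v - y u) ≤ N.dualValue y - 2 * (g * S.gap ε) := by
    rw [← sum_mul_netFlow]
    have h1 := hφ.lt
    rw [h.ids_eq, sum_ids] at h1
    simp only [h.residual_board] at h1
    have h2 : ∑ v, y v * netFlow r v = N.dualValue y -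
        1 / S.stretch * ∑ v, (N.demand v - netFlow r v) * φ (N.ident v) := by
      rw [dualValue, mul_sum, ← sum_sub_distrib]
      exact sum_congr rfl fun v _ => by rw [hy]; ring
    -- The gap is defined as half of what the witness yields per unit of `g`; the other half pays
    -- for the rounding, as `g ≥ 1`.
    have h3 : 2 * (g * S.gap ε) = 1 / S.stretch * (ε / 3 * g / (2 * S.ratio)) := by
      unfold Setup.gap
      field_simp
      norm_num
    rw [h2, h3]
    have h4 := mul_le_mul_of_nonneg_left h1.le (show 0 ≤ 1 / S.stretch by positivity)
    linarith
  have hstep := totalWeight_add_le (γ := S.gap ε) hg0 (by positivity) (by linarith) hI hslack (by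
    have : S.gap ε ≤ g * S.gap ε := le_mul_of_one_le_left hgap.le hg
    linarith)
  unfold WeightInvariant
  rw [hcomp]
  refine hstep.trans (le_of_eq ?_)
  congr 2
  simp only [Setup.shift, h.dual_eq, hcomp, dualValue_add]
  push_cast
  ring

/-- As costs are at least `1`, the total flow at a node is at most the cost `g` of the whole flow.
This keeps the announced numbers short. -/
lemma sum_units_le [Nonempty V] (h : N.IsSetup c S) (hg : 0 < g)
    (hI : WeightInvariant N ε S g t Φ) (v : V) :
    ((∑ x ∈ (N.localInput ε v).incident, S.units c ε g t Φ x.1 (N.ident v) x.2.2 : ℕ) : ℝ) ≤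
      S.precision c * g ∧
    ((∑ x ∈ (N.localInput ε v).incident, S.units c ε g t Φ (N.ident v) x.1 x.2.1 : ℕ) : ℝ) ≤
      S.precision c * g := by
  classical
  have hK : (0 : ℝ) < S.precision c := by exact_mod_cast precision_pos
  set w := N.weightFlow g (S.gap ε / 2) (S.shift ε g t Φ) (Φ ∘ N.ident) with hw
  have h0 : ∀ a b, 0 ≤ N.cost a b * w a b := fun a b =>
    mul_nonneg (Nat.cast_nonneg _) (weightFlow_nonneg hg.le a b)
  have htot : ∑ a, ∑ b, N.cost a b * w a b ≤ g := sum_cost_weightFlow_le hg.le hI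
  have hunits : ∀ a b, N.graph.Adj a b →
      (S.units c ε g t Φ (N.ident a) (N.ident b) (N.cost a b) : ℝ) ≤
        S.precision c * (N.cost a b * w a b) := by
    intro a b hab
    have h1 := h.units_div (ε := ε) (g := g) (t := t) (Φ := Φ) hab
    rw [div_eq_iff hK.ne'] at h1
    rw [h1, mul_comm]
    refine mul_le_mul_of_nonneg_left ?_ hK.le
    refine (roundedFlow_le precision_pos hg.le a b).trans ?_
    exact le_mul_of_one_le_left (weightFlow_nonneg hg.le a b) (one_le_cost hab)
  rw [sum_incident, sum_incident]
  push_cast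
  constructor
  · calc _ ≤ ∑ u, S.precision c * (N.cost u v * w u v) := by
          refine sum_le_sum fun u _ => ?_
          split_ifs with huv
          · exact hunits u v huv.symm
          · exact mul_nonneg hK.le (h0 u v)
      _ = S.precision c * ∑ u, N.cost u v * w u v := by rw [mul_sum]
      _ ≤ S.precision c * ∑ u, ∑ b, N.cost u b * w u b :=
          mul_le_mul_of_nonneg_left (sum_le_sum fun u _ =>
            single_le_sum (f := fun b => N.cost u b * w u b) (fun b _ => h0 u b) (mem_univ v))
            hK.le
      _ ≤ _ := mul_le_mul_of_nonneg_left htot hK.le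
  · calc _ ≤ ∑ u, S.precision c * (N.cost v u * w v u) := by
          refine sum_le_sum fun u _ => ?_
          split_ifs with huv
          · exact hunits v u huv
          · exact mul_nonneg hK.le (h0 v u)
      _ = S.precision c * ∑ u, N.cost v u * w v u := by rw [mul_sum]
      _ ≤ S.precision c * ∑ a, ∑ b, N.cost a b * w a b :=
          mul_le_mul_of_nonneg_left (single_le_sum (f := fun a => ∑ b, N.cost a b * w a b)
            (fun a _ => sum_nonneg fun b _ => h0 a b) (mem_univ v)) hK.le
      _ ≤ _ := mul_le_mul_of_nonneg_left htot hK.le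

lemma meets_mwStep [Nonempty V] (h : N.IsSetup c S) (hN : N.PolyBounded c)
    (hH : N.IsSparsifier H) (hε : 0 < ε) (hε1 : ε ≤ 1) (hn : 1 ≤ Fintype.card V * ε) (hg : 1 ≤ g)
    (hI : WeightInvariant N ε S g t Φ) {y : ℕ → ℝ} (hy : N.IsPotential (y ∘ N.ident))
    (hgy : g ≤ (1 + ε / 3) * N.dualValue (y ∘ N.ident)) {β : ℕ}
    (hβ : 2 * ((4 * c + 14) * bitLength V) + 1 ≤ β) :
    (S.mwStep c ε H g y t Φ).Meets N ε β (4 * Fintype.card V)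
      (Sum.elim (N.IsGood ε) (WeightInvariant N ε S g (t + 1))) := by
  have hg0 : 0 < g := by linarith
  have hratio := h.one_le_ratio_real
  refine (Prog.meets_ask (m := 1) (T := 0) (fun v a ha => ?_) (fun v => ?_) ?_).mono
    (T := 2 * (Fintype.card V * (1 + 1)) + 0) (by omega) fun _ => id
  · rw [Setup.flowPost, mem_singleton] at ha
    obtain rfl := ha
    obtain ⟨h1, h2⟩ := h.sum_units_le hg0 hI v
    have hid : (N.localInput ε v).ident = N.ident v := rfl
    rw [hid]
    have hbound : S.precision c * g < 2 ^ ((4 * c + 14) * bitLength V) := by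
      -- The known potential `y` has value at least `g / (1 + ε / 3)`, and dual values are bounded.
      have h3 : g ≤ 2 * 2 ^ ((2 * c + 2) * bitLength V) := by
        have h4 := hy.dualValue_le hN
        have h5 : 0 ≤ N.dualValue (y ∘ N.ident) := by
          by_contra! hcon
          nlinarith
        nlinarith
      have hl := one_le_bitLength (V := V)
      have h6 : (2 : ℝ) < 2 ^ (2 * bitLength V) :=
        lt_of_lt_of_le (by norm_num : (2 : ℝ) < 2 ^ 2) (pow_le_pow_right₀ one_le_two (by omega))
      calc S.precision c * g ≤ 2 ^ ((2 * c + 10) * bitLength V) *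
            (2 * 2 ^ ((2 * c + 2) * bitLength V)) := by
            rw [Setup.precision, h.bits_eq]
            push_cast
            gcongr
        _ < 2 ^ ((2 * c + 10) * bitLength V) *
            (2 ^ (2 * bitLength V) * 2 ^ ((2 * c + 2) * bitLength V)) := by gcongr
        _ = 2 ^ ((4 * c + 14) * bitLength V) := by ring
    refine (pair_succ_lt (β := (4 * c + 14) * bitLength V) ?_ ?_).trans_le
      (Nat.pow_le_pow_right two_pos hβ)
    · exact_mod_cast h1.trans_lt hbound
    · exact_mod_cast h2.trans_lt hbound
  · simp [Setup.flowPost]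
  · split_ifs with h1 h2
    · exact h.isGood_of_isRouting hH hε hε1 hg0 hI hy hgy h1.choose_spec
    · exact h.weightInvariant_of_isWitness hN hH hε hε1 hn hg hI h2.choose_spec
    · have := H.exists_isRouting_or_isWitness S.ids
        (fun j a b hab => by rw [h.ids_eq]; exact hH.mem_ids hab)
        (S.residual c (N.board ε (S.flowPost c ε g t Φ)))
        (τ := ε / 3 * g / (2 * S.ratio)) (by positivity)
      rcases this with h3 | h3
      · exact absurd h3 h1
      · exact absurd h3 h2

end IsSetup

end Network

/-! ### The algorithm -/

namespace Setup

variable (S : Setup) (c : ℕ) (ε : ℝ)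

/-- The number of iterations of the multiplicative weights method for one value. -/
def iterations : ℕ := ⌊8 * S.bits / S.gap ε ^ 2⌋₊ + 1

/-- The number of values for which the multiplicative weights method is run. -/
def scanLength : ℕ := ⌈3 / ε⌉₊ * ((2 * c + 3) * S.bits)

/-- The multiplicative weights method finds a solution or a potential of value `g`. -/
def mwLoop (H : Clustering) (g : ℝ) (y : ℕ → ℝ) : Prog (Solution ⊕ (ℕ → ℝ)) :=
  (Prog.iter (fun t => Sum.elim (fun sol => .pure (.inl sol)) (S.mwStep c ε H g y t))
    (S.iterations ε) (.inr 0)).bind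
    (Sum.elim (fun sol => .pure (.inl sol))
      -- The rescaled potential has value exactly `g`.
      fun Φ => .pure (.inr fun a => g / S.dual Φ * Φ a))

/-- The multiplicative weights method is run for increasing values until it finds a solution. -/
def scan (H : Clustering) : Prog Solution :=
  (Prog.iter (fun j => Sum.elim (fun sol => .pure (.inl sol))
      (S.mwLoop c ε H ((1 + ε / 3) ^ j)))
    (S.scanLength c ε) (.inr fun a => if 0 < S.demand a then 1 else 0)).bind
    (Sum.elim .pure fun y => .pure ⟨y, 0⟩)

/-- If all edges are announced, then a solution is known. -/
structure IsPublicSolution (board : Finset ℕ) (F : ℕ → ℕ → ℝ) (y : ℕ → ℝ) : Prop where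
  nonneg : ∀ a b, 0 ≤ F a b
  support : ∀ a b, (¬∃ w w', Nat.pair b (Nat.pair w w') ∈ contents board a) → F a b = 0
  netFlow_eq : ∀ a ∈ S.ids, ∑ b ∈ S.ids, F b a - ∑ b ∈ S.ids, F a b = S.demand a
  potential : ∀ a b w w', Nat.pair b (Nat.pair w w') ∈ contents board a → y b - y a ≤ w
  cost_le : ∑ a ∈ S.ids, ∑ b ∈ S.ids,
    (sInf {w | ∃ w', Nat.pair b (Nat.pair w w') ∈ contents board a} : ℕ) * F a b ≤
      (1 + ε) * S.dual y

open Classical in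
/-- All edges are announced, and a solution is computed locally. -/
def gather : Prog Solution :=
  .ask (fun inp => inp.incident.image fun x => Nat.pair x.1 (Nat.pair x.2.1 x.2.2)) fun board =>
    if h : ∃ p : (ℕ → ℕ → ℝ) × (ℕ → ℝ), S.IsPublicSolution ε board p.1 p.2 then
      .pure ⟨h.choose.2, fun a b _ => h.choose.1 a b⟩
    else .pure ⟨0, 0⟩

-- Zero demands leave no positive value to start the scan from. If `n * ε < 1`, posting all edges is
-- within the round bound; otherwise `1 / ε ≤ n`, which the rounding needs.
open Classical in
def solve : Prog Solution :=
  if ∀ a ∈ S.ids, S.demand a = 0 then .pure ⟨0, 0⟩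
  else if S.ids.card * ε < 1 then S.gather ε
  else (sparsify S.ids (c * S.bits + 1) S.bits).bind (S.scan c ε)

open Classical in
/-- The output of a node that knows the public solution. -/
def output (sol : Solution) (inp : LocalInput) : NodeOutput where
  value := (1 + ε) * S.dual sol.potential
  potential := sol.potential inp.ident
  flow b := ∑ x ∈ inp.incident, if x.1 = b then
    if x.2.2 < x.2.1 ∨ x.2.2 = x.2.1 ∧ inp.ident < b then
      sol.flow inp.ident b x.2.1 - sol.flow b inp.ident x.2.2
    else sol.flow b inp.ident x.2.2 - sol.flow inp.ident b x.2.1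
  else 0

end Setup

/-- Each node announces its demand and a bound for the asymmetry of the incident edges. -/
def setupPost (inp : LocalInput) : Finset ℕ :=
  {Nat.pair (Nat.pair inp.demand.toNat (-inp.demand).toNat)
    -- Quotients are rounded down; adding one turns them into upper bounds for the ratios.
    (inp.incident.sup fun x => max (x.2.1 / x.2.2) (x.2.2 / x.2.1) + 1)}

def readSetup (board : Finset ℕ) : Setup where
  ids := senders board
  demand a := (((contents board a).sup id).unpair.1.unpair.1 : ℤ) -
    ((contents board a).sup id).unpair.1.unpair.2
  ratio := max 1 ((senders board).sup fun a => ((contents board a).sup id).unpair.2)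

/-- The transshipment algorithm as a program for a shared blackboard. -/
def transshipment (c : ℕ) (ε : ℝ) : Prog (LocalInput → NodeOutput) :=
  .ask setupPost fun board => ((readSetup board).solve c ε).bind fun sol =>
    .pure ((readSetup board).output ε sol)

/-! ### Correctness of the setup, of the output, and of gathering all edges. -/

namespace Network

variable {V : Type} [Fintype V] {N : Network V} {ε : ℝ} {c : ℕ}

lemma cost_div_le_asymmetry {u v : V} (h : N.graph.Adj u v) :
    (N.cost u v : ℝ) / N.cost v u ≤ N.asymmetry := by
  rcases isForward_or_isForward h with h' | h'
  · exact (le_ciSup (f := fun e : N.Edge => N.wPlus e / N.wMinus e)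
      (Set.finite_range _).bddAbove ⟨(u, v), h'⟩).trans (le_max_right _ _)
  · refine le_trans ?_ (le_max_left _ _)
    rw [div_le_one (by linarith [one_le_cost h.symm])]
    have : N.cost u v ≤ N.cost v u := by
      have := h'.2
      omega
    exact_mod_cast this

lemma one_le_asymmetry : 1 ≤ N.asymmetry := le_max_left _ _

lemma readSetup_board (v : V) : (contents (N.board ε setupPost) (N.ident v)).sup id =
    Nat.pair (Nat.pair (N.demand v).toNat (-N.demand v).toNat)
      ((N.localInput ε v).incident.sup fun x => max (x.2.1 / x.2.2) (x.2.2 / x.2.1) + 1) := by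
  rw [contents_board, setupPost, sup_singleton]
  rfl

lemma ratio_readSetup_le {m : ℕ} (h1 : 1 ≤ m)
    (h : ∀ u v, N.graph.Adj u v → N.cost u v / N.cost v u + 1 ≤ m) :
    (readSetup (N.board ε setupPost)).ratio ≤ m := by
  refine max_le h1 (Finset.sup_le fun a ha => ?_)
  rw [senders_board] at ha
  obtain ⟨v, -, rfl⟩ := mem_image.1 ha
  rw [readSetup_board, Nat.unpair_pair]
  refine Finset.sup_le fun x hx => ?_
  obtain ⟨u, hu, rfl⟩ := mem_incident.1 hx
  have h2 := h v u hu
  have h3 := h u v hu.symm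
  dsimp only
  omega

/-- A ratio rounded down plus one is at most `λ + 1 ≤ 2 * λ`. -/
lemma ratio_readSetup_le_asymmetry :
    ((readSetup (N.board ε setupPost)).ratio : ℝ) ≤ 2 * N.asymmetry := by
  have h1 := one_le_asymmetry (N := N)
  refine (Nat.le_floor_iff (by linarith)).1 (ratio_readSetup_le ?_ fun u v h => ?_)
  · exact Nat.le_floor (by push_cast; linarith)
  · refine Nat.le_floor ?_
    have h2 := cost_div_le_asymmetry h
    have h3 : ((N.cost u v / N.cost v u : ℕ) : ℝ) ≤ (N.cost u v : ℝ) / N.cost v u :=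
      Nat.cast_div_le
    push_cast
    linarith

lemma cost_le_two_pow' (hN : N.PolyBounded c) {u v : V} (h : N.graph.Adj u v) :
    N.cost u v / N.cost v u + 1 ≤ 2 ^ ((c + 1) * bitLength V) := by
  have h1 := (Nat.div_le_self (N.cost u v) (N.cost v u)).trans (hN.cost_le h)
  have h2 : 2 ^ (c * bitLength V) < 2 ^ ((c + 1) * bitLength V) :=
    Nat.pow_lt_pow_right one_lt_two (by have := one_le_bitLength (V := V); nlinarith)
  omega

lemma isSetup_readSetup (hN : N.PolyBounded c) :
    N.IsSetup c (readSetup (N.board ε setupPost)) where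
  ids_eq := senders_board _
  demand_eq v := by
    change (((contents (N.board ε setupPost) (N.ident v)).sup id).unpair.1.unpair.1 : ℤ) -
      ((contents (N.board ε setupPost) (N.ident v)).sup id).unpair.1.unpair.2 = _
    rw [readSetup_board, Nat.unpair_pair, Nat.unpair_pair]
    dsimp only
    omega
  one_le_ratio := le_max_left _ _
  ratio_le := ratio_readSetup_le Nat.one_le_two_pow fun _ _ => cost_le_two_pow' hN
  cost_le u v h := by
    have h1 : N.cost u v / N.cost v u + 1 ≤ (readSetup (N.board ε setupPost)).ratio := by
      refine le_trans ?_ (le_max_right _ _)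
      refine le_trans ?_ (Finset.le_sup (f := fun a =>
        ((contents (N.board ε setupPost) a).sup id).unpair.2) (b := N.ident u) ?_)
      · rw [readSetup_board, Nat.unpair_pair]
        refine le_trans ?_ (Finset.le_sup (f := fun x : ℕ × ℕ × ℕ =>
          max (x.2.1 / x.2.2) (x.2.2 / x.2.1) + 1) (mem_incident.2 ⟨v, h, rfl⟩))
        dsimp only
        omega
      · rw [senders_board]
        exact mem_image_of_mem _ (mem_univ u)
    have h2 := Nat.div_add_mod (N.cost u v) (N.cost v u)
    have h3 := Nat.mod_lt (N.cost u v) (N.cost_pos v u h.symm)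
    calc N.cost u v ≤ (N.cost u v / N.cost v u + 1) * N.cost v u := by
          rw [add_mul, one_mul, mul_comm (_ / _)]
          omega
      _ ≤ _ := Nat.mul_le_mul_right _ h1

lemma meets_setupPost (hN : N.PolyBounded c) {β : ℕ} (hβ : (4 * c + 8) * bitLength V + 3 ≤ β)
    (v : V) : ∀ a ∈ setupPost (N.localInput ε v), a + 1 < 2 ^ β := by
  intro a ha
  rw [setupPost, mem_singleton] at ha
  obtain rfl := ha
  have hl := one_le_bitLength (V := V)
  have h0 : 2 ^ (c * bitLength V) < 2 ^ ((c + 1) * bitLength V) :=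
    Nat.pow_lt_pow_right one_lt_two (by nlinarith)
  have hd : (N.localInput ε v).demand = N.demand v := rfl
  have h1 : |N.demand v| ≤ ((2 ^ (c * bitLength V) : ℕ) : ℤ) := by
    exact_mod_cast hN.abs_demand_le v
  rw [abs_le] at h1
  refine (pair_succ_lt (β := 2 * ((c + 1) * bitLength V) + 1) ?_ ?_).trans_le
    (Nat.pow_le_pow_right two_pos (by nlinarith))
  · refine (Nat.lt_succ_self _).trans (pair_succ_lt ?_ ?_) <;> rw [hd] <;> omega
  · refine lt_of_le_of_lt (b := 2 ^ ((c + 1) * bitLength V)) (Finset.sup_le fun x hx => ?_)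
      (Nat.pow_lt_pow_right one_lt_two (by omega))
    obtain ⟨u, hu, rfl⟩ := mem_incident.1 hx
    have h2 := cost_le_two_pow' hN hu
    have h3 := cost_le_two_pow' hN hu.symm
    dsimp only
    omega

namespace IsSetup

variable {S : Setup} {H : Clustering}

lemma isApproximation (h : N.IsSetup c S) (hε : 0 < ε) {sol : Solution} (hsol : N.IsGood ε sol) :
    N.IsApproximation ε fun v => S.output ε sol (N.localInput ε v) := by
  classical
  obtain ⟨f, hf, hfs⟩ := hsol
  have hid : ∀ v, (N.localInput ε v).ident = N.ident v := fun v => rfl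
  have hflow : ∀ u v, N.graph.Adj u v → (S.output ε sol (N.localInput ε u)).flow (N.ident v) =
      if N.IsForward u v then f u v - f v u else f v u - f u v := by
    intro u v huv
    simp only [Setup.output, hid]
    rw [sum_incident, sum_eq_single v]
    · simp only [if_true, hfs u v huv, hfs v u huv.symm, IsForward, huv, true_and]
    · intro w _ hw
      simp [N.ident_injective.ne hw]
    · simp
  refine hf.isApproximation hε.le (fun v => ?_) (fun v => rfl) fun u v huv => ?_
  · simp only [Setup.output, h.dual_eq]
  · rw [hflow u v huv.1, hflow v u huv.1.symm, if_pos huv, if_neg (not_isForward_of_isForward huv)]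
    exact ⟨rfl, rfl⟩

lemma sInf_announced {board : Finset ℕ} (hboard : ∀ v b w w', Nat.pair b (Nat.pair w w') ∈
    contents board (N.ident v) ↔ ∃ u, N.graph.Adj v u ∧ b = N.ident u ∧ w = N.cost v u ∧
      w' = N.cost u v) {u v : V} (huv : N.graph.Adj u v) :
    sInf {w | ∃ w', Nat.pair (N.ident v) (Nat.pair w w') ∈ contents board (N.ident u)} =
      N.cost u v := by
  have h : {w | ∃ w', Nat.pair (N.ident v) (Nat.pair w w') ∈ contents board (N.ident u)} =
      {N.cost u v} := by
    ext w
    simp only [hboard, Set.mem_ofPred_eq, Set.mem_singleton_iff]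
    constructor
    · rintro ⟨w', x, -, hx, hw, -⟩
      rw [N.ident_injective hx]
      exact hw
    · rintro rfl
      exact ⟨_, v, huv, rfl, rfl, rfl⟩
  rw [h, csInf_singleton]

/-- An approximate pair exists by duality; it is transported from nodes to identifiers, with zero
elsewhere. -/
lemma exists_isPublicSolution (h : N.IsSetup c S) (hN : N.PolyBounded c) (hε : 0 < ε)
    {board : Finset ℕ} (hboard : ∀ v b w w', Nat.pair b (Nat.pair w w') ∈
      contents board (N.ident v) ↔ ∃ u, N.graph.Adj v u ∧ b = N.ident u ∧ w = N.cost v u ∧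
        w' = N.cost u v)
    (hids : ∀ a x, x ∈ contents board a → ∃ v, a = N.ident v) :
    ∃ F y, S.IsPublicSolution ε board F y := by
  classical
  obtain ⟨f, y, hf⟩ := exists_isApproxPair hN hε
  have hinj : Function.Injective (Prod.map N.ident N.ident) :=
    N.ident_injective.prodMap N.ident_injective
  set F : ℕ → ℕ → ℝ := fun a b =>
    Function.extend (Prod.map N.ident N.ident) (fun p => f p.1 p.2) 0 (a, b) with hF
  set z : ℕ → ℝ := Function.extend N.ident y 0 with hz
  have hFf : ∀ u v, F (N.ident u) (N.ident v) = f u v := fun u v =>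
    hinj.extend_apply (fun p => f p.1 p.2) 0 (u, v)
  have hF0 : ∀ a b, (¬∃ u v, a = N.ident u ∧ b = N.ident v) → F a b = 0 := fun a b hab => by
    refine Function.extend_apply' _ _ _ ?_
    rintro ⟨⟨u, v⟩, huv⟩
    obtain ⟨h1, h2⟩ := Prod.ext_iff.1 huv
    exact hab ⟨u, v, h1.symm, h2.symm⟩
  have hzy : ∀ v, z (N.ident v) = y v := fun v => N.ident_injective.extend_apply y 0 v
  refine ⟨F, z, fun a b => ?_, fun a b hab => ?_, fun a ha => ?_, fun a b w w' hab => ?_, ?_⟩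
  · by_cases hab : ∃ u v, a = N.ident u ∧ b = N.ident v
    · obtain ⟨u, v, rfl, rfl⟩ := hab
      rw [hFf]
      exact hf.nonneg u v
    · rw [hF0 a b hab]
  · by_cases hab' : ∃ u v, a = N.ident u ∧ b = N.ident v
    · obtain ⟨u, v, rfl, rfl⟩ := hab'
      rw [hFf]
      exact hf.support u v fun huv => hab ⟨_, _, (hboard _ _ _ _).2 ⟨v, huv, rfl, rfl, rfl⟩⟩
    · exact hF0 a b hab'
  · rw [h.ids_eq] at ha ⊢
    obtain ⟨v, -, rfl⟩ := mem_image.1 ha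
    rw [sum_ids, sum_ids, h.demand_eq, ← hf.netFlow_eq v]
    simp only [hFf, netFlow]
  · obtain ⟨v, rfl⟩ := hids a _ hab
    obtain ⟨u, huv, rfl, rfl, rfl⟩ := (hboard _ _ _ _).1 hab
    rw [hzy, hzy]
    exact hf.isPotential v u huv
  · rw [h.dual_eq, h.ids_eq]
    simp only [sum_ids, hFf]
    have h1 : z ∘ N.ident = y := funext hzy
    rw [h1]
    refine le_trans (le_of_eq (sum_congr rfl fun u _ => sum_congr rfl fun v _ => ?_)) hf.cost_le
    by_cases huv : N.graph.Adj u v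
    · rw [sInf_announced hboard huv]
    · rw [hf.support u v huv, mul_zero, mul_zero]

lemma isGood_of_isPublicSolution (h : N.IsSetup c S)
    {board : Finset ℕ} (hboard : ∀ v b w w', Nat.pair b (Nat.pair w w') ∈
      contents board (N.ident v) ↔ ∃ u, N.graph.Adj v u ∧ b = N.ident u ∧ w = N.cost v u ∧
        w' = N.cost u v) {F : ℕ → ℕ → ℝ} {y : ℕ → ℝ} (hF : S.IsPublicSolution ε board F y) :
    N.IsGood ε ⟨y, fun a b _ => F a b⟩ := by
  refine ⟨fun u v => F (N.ident u) (N.ident v), ⟨fun u v => hF.nonneg _ _, fun u v huv => ?_,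
    fun v => ?_, fun u v huv => ?_, ?_⟩, fun u v _ => rfl⟩
  · refine hF.support _ _ ?_
    rintro ⟨w, w', hw⟩
    obtain ⟨u', h1, h2, -, -⟩ := (hboard _ _ _ _).1 hw
    rw [N.ident_injective h2] at huv
    exact huv h1
  · have h1 := hF.netFlow_eq (N.ident v) (by rw [h.ids_eq]; exact mem_image_of_mem _ (mem_univ v))
    rw [h.ids_eq, sum_ids, sum_ids, h.demand_eq] at h1
    exact h1
  · exact hF.potential _ _ _ _ ((hboard _ _ _ _).2 ⟨v, huv, rfl, rfl, rfl⟩)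
  · have h1 := hF.cost_le
    rw [h.dual_eq, h.ids_eq] at h1
    simp only [sum_ids] at h1
    refine le_trans (le_of_eq (sum_congr rfl fun u _ => sum_congr rfl fun v _ => ?_)) h1
    by_cases huv : N.graph.Adj u v
    · rw [sInf_announced hboard huv]
    · have h3 : F (N.ident u) (N.ident v) = 0 := by
        refine hF.support _ _ ?_
        rintro ⟨w, w', hw⟩
        obtain ⟨u', h1, h2, -, -⟩ := (hboard _ _ _ _).1 hw
        rw [N.ident_injective h2] at huv
        exact huv h1
      rw [h3, mul_zero, mul_zero]

lemma meets_gather (h : N.IsSetup c S) (hN : N.PolyBounded c) (hε : 0 < ε) {β : ℕ}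
    (hβ : (4 * c + 4) * bitLength V + 3 ≤ β) :
    (S.gather ε).Meets N ε β (2 * (Fintype.card V * (Fintype.card V + 1))) (N.IsGood ε) := by
  classical
  have h0 : 2 ^ (c * bitLength V) < 2 ^ ((c + 1) * bitLength V) :=
    Nat.pow_lt_pow_right one_lt_two (by have := one_le_bitLength (V := V); nlinarith)
  refine Prog.meets_ask (T := 0) (fun v a ha => ?_) (fun v => ?_) ?_
  · obtain ⟨x, hx, rfl⟩ := mem_image.1 ha
    obtain ⟨u, hu, rfl⟩ := mem_incident.1 hx
    have h1 := hN.cost_le hu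
    have h2 := hN.cost_le hu.symm
    have h3 := hN.ident_le u
    refine (pair_succ_lt (β := 2 * ((c + 1) * bitLength V) + 1) ?_ ?_).trans_le
      (Nat.pow_le_pow_right two_pos (by nlinarith))
    · exact (h3.trans_lt h0).trans_le (Nat.pow_le_pow_right two_pos (by omega))
    · exact (Nat.lt_succ_self _).trans (pair_succ_lt (h1.trans_lt h0) (h2.trans_lt h0))
  · refine card_image_le.trans ?_
    simp only [localInput]
    exact card_image_le.trans (card_filter_le _ _)
  · set board := N.board ε
      fun inp => inp.incident.image fun x => Nat.pair x.1 (Nat.pair x.2.1 x.2.2) with hbdef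
    have hboard : ∀ v b w w', Nat.pair b (Nat.pair w w') ∈
        contents board (N.ident v) ↔ ∃ u, N.graph.Adj v u ∧ b = N.ident u ∧ w = N.cost v u ∧
          w' = N.cost u v := by
      intro v b w w'
      rw [hbdef, contents_board, mem_image]
      constructor
      · rintro ⟨x, hx, hxe⟩
        obtain ⟨u, hu, rfl⟩ := mem_incident.1 hx
        simp only [Nat.pair_eq_pair] at hxe
        exact ⟨u, hu, hxe.1.symm, hxe.2.1.symm, hxe.2.2.symm⟩
      · rintro ⟨u, hu, rfl, rfl, rfl⟩
        exact ⟨_, mem_incident.2 ⟨u, hu, rfl⟩, rfl⟩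
    have hids : ∀ a x, x ∈ contents board a → ∃ v, a = N.ident v := by
      intro a x hx
      have h1 : a ∈ senders board := mem_image.2 ⟨_, mem_contents.1 hx, by simp⟩
      rw [hbdef, senders_board] at h1
      obtain ⟨v, -, rfl⟩ := mem_image.1 h1
      exact ⟨v, rfl⟩
    obtain ⟨F, y, hFy⟩ := h.exists_isPublicSolution hN hε hboard hids
    have hex : ∃ p : (ℕ → ℕ → ℝ) × (ℕ → ℝ), S.IsPublicSolution ε board p.1 p.2 := ⟨(F, y), hFy⟩
    rw [dif_pos hex]
    exact h.isGood_of_isPublicSolution hboard hex.choose_spec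

end IsSetup

end Network

/-! ### Correctness and round complexity of the scan. -/

namespace Network

variable {V : Type} [Fintype V] {N : Network V} {ε : ℝ} {c : ℕ}

/-- A connected network without edges is a single node, whose demand is the total demand zero. -/
lemma exists_adj (h : ∃ v, N.demand v ≠ 0) : ∃ u v, N.graph.Adj u v := by
  by_contra! hcon
  obtain ⟨v, hv⟩ := h
  have h1 : ∀ u, u = v := by
    intro u
    obtain ⟨p⟩ := N.connected u v
    cases p with
    | nil => rfl
    | cons hadj _ => exact absurd hadj (hcon _ _)
  have h2 := N.sum_demand
  rw [Fintype.sum_eq_single v fun u hu => absurd (h1 u) hu] at h2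
  exact hv h2

namespace IsSetup

variable {S : Setup} {H : Clustering}

lemma weightInvariant_zero (g : ℝ) : WeightInvariant N ε S g 0 0 := by
  classical
  have h1 : S.shift ε g 0 0 = 0 := by simp [Setup.shift, Setup.dual]
  rw [WeightInvariant, h1, Real.exp_zero, mul_one]
  calc N.totalWeight (S.gap ε / 2) ((0 : ℕ → ℝ) ∘ N.ident) ≤ ∑ _u : V, ∑ _v : V, (1 : ℝ) := by
        refine sum_le_sum fun u _ => sum_le_sum fun v _ => ?_
        split_ifs <;> simp
    _ = Fintype.card V ^ 2 := by simp [sq]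

/-- After this many iterations the accumulated gain exceeds `2 * bits`, hence `log (n ^ 2)`, so the
factor `n ^ 2` is absorbed and `isPotential_of_totalWeight_lt` applies. -/
lemma isPotential_of_weightInvariant [Nonempty V] (h : N.IsSetup c S) (hε : 0 < ε) {g : ℝ}
    (hg : 0 < g) (hb : ∃ v, N.demand v ≠ 0) {Φ : ℕ → ℝ}
    (hI : WeightInvariant N ε S g (S.iterations ε) Φ) :
    N.IsPotential ((fun a => g / S.dual Φ * Φ a) ∘ N.ident) ∧
      N.dualValue ((fun a => g / S.dual Φ * Φ a) ∘ N.ident) = g := by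
  have hgap := h.gap_pos hε
  have h1 : (fun a => g / S.dual Φ * Φ a) ∘ N.ident =
      fun v => g / N.dualValue (Φ ∘ N.ident) * (Φ ∘ N.ident) v := by
    rw [← h.dual_eq]
    rfl
  rw [h1]
  refine isPotential_of_totalWeight_lt hg (half_pos hgap) (exists_adj hb) (lt_of_le_of_lt hI ?_)
  have h2 : (Fintype.card V : ℝ) ^ 2 ≤ Real.exp (2 * S.bits) := by
    rw [h.bits_eq]
    have h3 : (2 : ℝ) ≤ Real.exp 1 := by
      have := Real.add_one_le_exp (1 : ℝ)
      linarith
    calc (Fintype.card V : ℝ) ^ 2 ≤ (2 ^ bitLength V) ^ 2 :=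
          pow_le_pow_left₀ (Nat.cast_nonneg _) card_le_real 2
      _ = 2 ^ (2 * bitLength V) := by rw [← pow_mul, mul_comm]
      _ ≤ Real.exp 1 ^ (2 * bitLength V) := pow_le_pow_left₀ zero_le_two h3 _
      _ = Real.exp (2 * bitLength V) := by
          rw [← Real.exp_nat_mul]
          push_cast
          rw [mul_one]
  have h3 : 2 * S.bits < S.iterations ε * (S.gap ε ^ 2 / 4) := by
    have h4 : 8 * S.bits / S.gap ε ^ 2 < S.iterations ε := by
      rw [Setup.iterations]
      push_cast
      exact Nat.lt_floor_add_one _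
    rw [div_lt_iff₀ (by positivity)] at h4
    linarith
  calc (Fintype.card V : ℝ) ^ 2 * Real.exp (S.shift ε g (S.iterations ε) Φ)
      ≤ Real.exp (2 * S.bits) * Real.exp (S.shift ε g (S.iterations ε) Φ) :=
        mul_le_mul_of_nonneg_right h2 (Real.exp_pos _).le
    _ = Real.exp (2 * S.bits + S.shift ε g (S.iterations ε) Φ) := (Real.exp_add _ _).symm
    _ < Real.exp (S.gap ε / 2 * (N.dualValue (Φ ∘ N.ident) / g)) := by
        refine Real.exp_lt_exp.2 ?_
        rw [Setup.shift, h.dual_eq, mul_div_assoc (S.gap ε / 2)]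
        linarith

/-- The invariant of the scan: a potential whose value is close to the next value. -/
def ScanInvariant (N : Network V) (ε : ℝ) (j : ℕ) (y : ℕ → ℝ) : Prop :=
  N.IsPotential (y ∘ N.ident) ∧ (1 + ε / 3) ^ j ≤ (1 + ε / 3) * N.dualValue (y ∘ N.ident)

lemma meets_mwLoop [Nonempty V] (h : N.IsSetup c S) (hN : N.PolyBounded c)
    (hH : N.IsSparsifier H) (hε : 0 < ε) (hε1 : ε ≤ 1) (hn : 1 ≤ Fintype.card V * ε)
    (hb : ∃ v, N.demand v ≠ 0) {j : ℕ} {y : ℕ → ℝ} (hy : ScanInvariant N ε j y) {β : ℕ}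
    (hβ : 2 * ((4 * c + 14) * bitLength V) + 1 ≤ β) :
    (S.mwLoop c ε H ((1 + ε / 3) ^ j) y).Meets N ε β (S.iterations ε * (4 * Fintype.card V))
      (Sum.elim (N.IsGood ε) (ScanInvariant N ε (j + 1))) := by
  have hg : 1 ≤ (1 + ε / 3) ^ j := one_le_pow₀ (by linarith)
  rw [← Nat.add_zero (S.iterations ε * _)]
  refine Prog.Meets.bind (Prog.meets_iter (I := fun t => Sum.elim (N.IsGood ε)
    (WeightInvariant N ε S ((1 + ε / 3) ^ j) t)) (weightInvariant_zero _) ?_) ?_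
  · rintro t - (sol | Φ) hs
    · exact hs
    · exact h.meets_mwStep hN hH hε hε1 hn hg hs hy.1 hy.2 hβ
  · rintro (sol | Φ) hs
    · exact hs
    · obtain ⟨h1, h2⟩ := h.isPotential_of_weightInvariant hε (by linarith) hb hs
      refine ⟨h1, ?_⟩
      rw [h2, pow_succ, mul_comm]

lemma meets_scan [Nonempty V] (h : N.IsSetup c S) (hN : N.PolyBounded c)
    (hH : N.IsSparsifier H) (hε : 0 < ε) (hε1 : ε ≤ 1) (hn : 1 ≤ Fintype.card V * ε)
    (hb : ∃ v, N.demand v ≠ 0) {β : ℕ} (hβ : 2 * ((4 * c + 14) * bitLength V) + 1 ≤ β) :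
    (S.scan c ε H).Meets N ε β (S.scanLength c ε * (S.iterations ε * (4 * Fintype.card V)))
      (N.IsGood ε) := by
  rw [← Nat.add_zero (S.scanLength c ε * _)]
  refine Prog.Meets.bind (Prog.meets_iter
    (I := fun j => Sum.elim (N.IsGood ε) (ScanInvariant N ε j)) ?_ ?_) ?_
  · have h1 : (fun a => if 0 < S.demand a then (1 : ℝ) else 0) ∘ N.ident =
        fun v => if 0 < N.demand v then 1 else 0 := by
      ext v
      simp [h.demand_eq]
    refine ⟨?_, ?_⟩
    · rw [h1]
      exact isPotential_indicator
    · rw [h1, pow_zero]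
      have h2 := one_le_dualValue_indicator hb
      nlinarith
  · rintro j - (sol | y) hs
    · exact hs
    · exact h.meets_mwLoop hN hH hε hε1 hn hb hs hβ
  · rintro (sol | y) hs
    · exact hs
    -- By Bernoulli's inequality `⌈3 / ε⌉` steps at least double the target value, so the last one
    -- is at least `2 ^ ((2 * c + 3) * bitLength V)`. This contradicts the bound for dual values.
    · exfalso
      obtain ⟨h1, h2⟩ := hs
      have h3 := h1.dualValue_le hN
      have h4 : (2 : ℝ) ^ ((2 * c + 3) * bitLength V) ≤ (1 + ε / 3) ^ S.scanLength c ε := by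
        rw [Setup.scanLength, pow_mul (1 + ε / 3), h.bits_eq]
        refine pow_le_pow_left₀ (by norm_num : (0 : ℝ) ≤ 2) ?_ _
        have h5 := one_add_mul_le_pow (show -2 ≤ ε / 3 by linarith) ⌈3 / ε⌉₊
        have h6 : 1 ≤ (⌈3 / ε⌉₊ : ℝ) * (ε / 3) := by
          have h7 := Nat.le_ceil (3 / ε)
          have h8 : 1 = 3 / ε * (ε / 3) := by field_simp
          rw [h8]
          exact mul_le_mul_of_nonneg_right h7 (by positivity)
        linarith
      have h5 : (2 : ℝ) ^ ((2 * c + 3) * bitLength V) =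
          2 ^ ((2 * c + 2) * bitLength V) * 2 ^ bitLength V := by ring
      have h6 : (2 : ℝ) ≤ 2 ^ bitLength V := by
        have := pow_le_pow_right₀ (one_le_two (α := ℝ)) (one_le_bitLength (V := V))
        simpa using this
      have h7 : (0 : ℝ) < 2 ^ ((2 * c + 2) * bitLength V) := by positivity
      nlinarith

end IsSetup

/-- The number of rounds of the multiplicative weights method. -/
lemma scan_rounds_le {S : Setup} (h : N.IsSetup c S) (hε : 0 < ε) (hε1 : ε ≤ 1)
    (hratio : (S.ratio : ℝ) ≤ 2 * N.asymmetry) :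
    (S.scanLength c ε * (S.iterations ε * (4 * Fintype.card V)) : ℝ) ≤
      16 * (2 * c + 3) * 41473 * (N.asymmetry ^ 2 * ε⁻¹ ^ 3 * Fintype.card V *
        bitLength V ^ 4) := by
  set L : ℝ := ((bitLength V : ℕ) : ℝ) with hL
  have hL1 : 1 ≤ L := by rw [hL]; exact_mod_cast one_le_bitLength (V := V)
  set l := N.asymmetry with hl
  have hl1 : 1 ≤ l := one_le_asymmetry
  set e := ε⁻¹ with he
  have he1 : 1 ≤ e := (one_le_inv₀ hε).2 hε1
  have h1 : (S.scanLength c ε : ℝ) ≤ 4 * e * ((2 * c + 3) * L) := by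
    rw [Setup.scanLength, h.bits_eq]
    push_cast
    refine mul_le_mul_of_nonneg_right ?_ (by positivity)
    have h2 := (Nat.ceil_lt_add_one (show 0 ≤ 3 / ε by positivity)).le
    have h3 : 3 / ε = 3 * e := by rw [he, div_eq_mul_inv]
    rw [h3] at h2 ⊢
    linarith
  -- Here `41473 = 8 * 72 ^ 2 + 1`, where `72 = 12 * 2 * 3` collects the constants of the gap, the
  -- ratio and the stretch.
  have h2 : (S.iterations ε : ℝ) ≤ 41473 * (l ^ 2 * L ^ 3 * e ^ 2) := by
    have hgap := h.gap_pos hε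
    have hr := h.one_le_ratio_real
    have hs := IsSetup.one_le_stretch (S := S)
    have h3 : S.stretch ≤ 3 * L := by
      rw [Setup.stretch, h.bits_eq]
      linarith
    have h4 : (S.gap ε)⁻¹ ≤ 72 * l * L * e := by
      have h5 : (S.gap ε)⁻¹ = 12 * S.ratio * S.stretch * e := by
        rw [Setup.gap, he]
        field_simp
        norm_num
      rw [h5]
      calc 12 * S.ratio * S.stretch * e ≤ 12 * (2 * l) * (3 * L) * e := by gcongr
        _ = 72 * l * L * e := by ring
    have h5 : 8 * S.bits / S.gap ε ^ 2 ≤ 41472 * (l ^ 2 * L ^ 3 * e ^ 2) := by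
      rw [h.bits_eq, div_eq_mul_inv, ← inv_pow]
      calc 8 * L * (S.gap ε)⁻¹ ^ 2 ≤ 8 * L * (72 * l * L * e) ^ 2 := by gcongr
        _ = 41472 * (l ^ 2 * L ^ 3 * e ^ 2) := by ring
    have h6 : 1 ≤ l ^ 2 * L ^ 3 * e ^ 2 :=
      one_le_mul_of_one_le_of_one_le (one_le_mul_of_one_le_of_one_le (one_le_pow₀ hl1)
        (one_le_pow₀ hL1)) (one_le_pow₀ he1)
    rw [Setup.iterations]
    push_cast
    have h7 := Nat.floor_le (show 0 ≤ 8 * S.bits / S.gap ε ^ 2 by positivity)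
    linarith
  calc (S.scanLength c ε * (S.iterations ε * (4 * Fintype.card V)) : ℝ)
      ≤ 4 * e * ((2 * c + 3) * L) * (41473 * (l ^ 2 * L ^ 3 * e ^ 2) * (4 * Fintype.card V)) := by
        gcongr
    _ = _ := by ring

/-- A bound for the number of rounds of all parts of the algorithm. -/
theorem meets_transshipment (hN : N.PolyBounded c) (hε : 0 < ε) (hε1 : ε ≤ 1) :
    ∃ T : ℕ, (T : ℝ) ≤ (16 * (2 * c + 3) * 41473 + 4 * c + 14) * N.asymmetry ^ 4 * ε⁻¹ ^ 3 *
        Fintype.card V * bitLength V ^ 4 ∧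
      (transshipment c ε).Meets N ε ((8 * c + 30) * bitLength V) T fun a =>
        N.IsApproximation ε fun v => a (N.localInput ε v) := by
  classical
  have : Nonempty V := N.connected.nonempty
  have hl := one_le_bitLength (V := V)
  generalize hβ : (8 * c + 30) * bitLength V = β
  have hS := isSetup_readSetup (ε := ε) hN
  have hratio := ratio_readSetup_le_asymmetry (N := N) (ε := ε)
  set S := readSetup (N.board ε setupPost)
  set L : ℝ := ((bitLength V : ℕ) : ℝ) with hL
  have hL1 : 1 ≤ L := by rw [hL]; exact_mod_cast hl
  have hl1 : 1 ≤ N.asymmetry := one_le_asymmetry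
  have he1 : 1 ≤ ε⁻¹ := (one_le_inv₀ hε).2 hε1
  have hn1 : (1 : ℝ) ≤ Fintype.card V := by exact_mod_cast Fintype.card_pos (α := V)
  set B : ℝ := N.asymmetry ^ 4 * ε⁻¹ ^ 3 * Fintype.card V * L ^ 4 with hB
  have hnB : Fintype.card V * L ^ 3 ≤ B := by
    calc Fintype.card V * L ^ 3 = 1 * 1 * Fintype.card V * L ^ 3 := by ring
      _ ≤ N.asymmetry ^ 4 * ε⁻¹ ^ 3 * Fintype.card V * L ^ 4 := by
        gcongr
        · exact one_le_pow₀ hl1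
        · exact one_le_pow₀ he1
        · norm_num
  have hL3 : 1 ≤ L ^ 3 := one_le_pow₀ hL1
  have hnB1 : (Fintype.card V : ℝ) ≤ B := (le_mul_of_one_le_right (by linarith) hL3).trans hnB
  -- The first summand pays for the scan and `4 * c + 10` for the sparse subgraph; the setup phase
  -- adds `4 * n` rounds afterwards.
  obtain ⟨T, hT, hsolve⟩ : ∃ T : ℕ, (T : ℝ) ≤ (16 * (2 * c + 3) * 41473 + 4 * c + 10) * B ∧
      (S.solve c ε).Meets N ε β T (N.IsGood ε) := by
    unfold Setup.solve
    split_ifs with h1 h2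
    · refine ⟨0, by rw [Nat.cast_zero]; positivity, fun _ _ => 0, ?_, fun _ _ _ => rfl⟩
      refine isApproxPair_zero fun v => ?_
      rw [← hS.demand_eq]
      exact h1 _ (by rw [hS.ids_eq]; exact mem_image_of_mem _ (mem_univ v))
    · refine ⟨_, ?_, hS.meets_gather hN hε (by nlinarith)⟩
      rw [hS.card_ids, ← lt_div_iff₀ hε, one_div] at h2
      have h3 : (Fintype.card V : ℝ) * Fintype.card V ≤ B := by
        calc (Fintype.card V : ℝ) * Fintype.card V ≤ ε⁻¹ ^ 3 * Fintype.card V := by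
              refine mul_le_mul_of_nonneg_right (h2.le.trans ?_) (by linarith)
              exact le_self_pow₀ he1 (by norm_num)
          _ = 1 * ε⁻¹ ^ 3 * Fintype.card V * 1 := by ring
          _ ≤ B := by
              rw [hB]
              gcongr
              · exact one_le_pow₀ hl1
              · exact one_le_pow₀ hL1
      push_cast
      have h4 : 0 ≤ B := by positivity
      have h5 : (0 : ℝ) ≤ c := Nat.cast_nonneg c
      nlinarith [mul_nonneg h5 h4]
    · rw [hS.card_ids, not_lt] at h2
      have hb : ∃ v, N.demand v ≠ 0 := by
        by_contra! hcon
        refine h1 fun a ha => ?_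
        rw [hS.ids_eq] at ha
        obtain ⟨v, -, rfl⟩ := mem_image.1 ha
        rw [hS.demand_eq, hcon]
      have h3 := meets_sparsify (ε := ε) hN (β := β) (by nlinarith)
      rw [← hS.ids_eq, ← hS.bits_eq] at h3
      refine ⟨_, ?_, h3.bind fun H hH => hS.meets_scan hN hH hε hε1 h2 hb (by nlinarith)⟩
      have h4 := scan_rounds_le (c := c) hS hε hε1 hratio
      have h5 : N.asymmetry ^ 2 * ε⁻¹ ^ 3 * Fintype.card V * bitLength V ^ 4 ≤ B := by
        rw [hB]
        gcongr
        norm_num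
      have h6 : (16 * (2 * c + 3) * 41473 : ℝ) * (N.asymmetry ^ 2 * ε⁻¹ ^ 3 * Fintype.card V *
          bitLength V ^ 4) ≤ 16 * (2 * c + 3) * 41473 * B :=
        mul_le_mul_of_nonneg_left h5 (by positivity)
      have h7 : L * (2 * (Fintype.card V * ((c * L + 1) * (L + 1) + 1))) ≤ (4 * c + 10) * B := by
        have h8 : (c * L + 1) * (L + 1) + 1 ≤ (2 * c + 5) * L ^ 2 := by
          have h9 : (0 : ℝ) ≤ c := Nat.cast_nonneg c
          have h10 : c * L ≤ c * L ^ 2 := mul_le_mul_of_nonneg_left (by nlinarith) h9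
          nlinarith
        calc L * (2 * (Fintype.card V * ((c * L + 1) * (L + 1) + 1)))
            ≤ L * (2 * (Fintype.card V * ((2 * c + 5) * L ^ 2))) := by gcongr
          _ = (4 * c + 10) * (Fintype.card V * L ^ 3) := by ring
          _ ≤ (4 * c + 10) * B := mul_le_mul_of_nonneg_left hnB (by positivity)
      rw [hS.bits_eq]
      push_cast
      linarith
  refine ⟨2 * (Fintype.card V * (1 + 1)) + (T + 0), ?_, Prog.meets_ask
    (meets_setupPost hN (by nlinarith)) (fun v => by simp [setupPost])
    (hsolve.bind fun sol hsol => hS.isApproximation hε hsol)⟩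
  have h8 : (16 * (2 * c + 3) * 41473 + 4 * c + 14) * N.asymmetry ^ 4 * ε⁻¹ ^ 3 *
      Fintype.card V * L ^ 4 = 4 * B + (16 * (2 * c + 3) * 41473 + 4 * c + 10) * B := by
    rw [hB]
    ring
  rw [h8]
  push_cast
  linarith

end Network

end Transshipment

end

theorem mainTheorem9 :
    ∀ c : ℕ,
      ∃ (alg : Transshipment.BroadcastAlgorithm Transshipment.NodeOutput) (B k : ℕ) (C : ℝ),
        ∀ (V : Type) [Fintype V] (N : Transshipment.Network V), N.PolyBounded c →
          ∀ ε : ℝ, 0 < ε → ε ≤ 1 →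
            alg.MessagesBounded N ε (B * (Nat.log 2 (Fintype.card V) + 1)) ∧
            ∃ (T : ℕ) (out : V → Transshipment.NodeOutput),
              (T : ℝ) ≤ C * N.asymmetry ^ 4 * (ε⁻¹) ^ 3 * (Fintype.card V : ℝ) *
                ((Nat.log 2 (Fintype.card V) : ℝ) + 1) ^ k ∧
              alg.ComputesWithin N ε T out ∧
              N.IsApproximation ε out := by
  intro c
  -- Items are pairs of numbers of `(8 * c + 30) * bitLength V` bits; doubling and one more bit give
  -- the constant `16 * c + 61`.
  refine ⟨Transshipment.compile (Transshipment.transshipment c), 16 * c + 61, 4,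
    16 * (2 * c + 3) * 41473 + 4 * c + 14, fun V _ N hN ε hε hε1 => ?_⟩
  have hl := Transshipment.Network.one_le_bitLength (V := V)
  obtain ⟨T, hT, hmeets⟩ := Transshipment.Network.meets_transshipment hN hε hε1
  have hid : ∀ v, N.ident v < 2 ^ ((8 * c + 30) * Transshipment.Network.bitLength V) := fun v =>
    (hN.ident_le v).trans_lt (Nat.pow_lt_pow_right one_lt_two (by nlinarith))
  obtain ⟨hmsg, a, ha, hcomp⟩ := Transshipment.compile_spec hid hmeets
  refine ⟨fun t v => (hmsg t v).trans ?_, T, _, ?_, hcomp, ha⟩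
  · change _ ≤ (16 * c + 61) * Transshipment.Network.bitLength V
    nlinarith
  · rw [Transshipment.Network.bitLength] at hT
    push_cast at hT
    exact hT
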